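/- Fix $\log q,\log d\in\mathbb C$ and write $q^{c}=e^{c\log q}$, $d^{c}=e^{c\log d}$ for $c\in\mathbb C$. Assume $q,d$ are generic: for rational $a,b$, $q^ad^b=1$ only if $a=b=0$. Put $q_1=q^{-1}d$, $q_2=q^2$, $q_3=q^{-1}d^{-1}$, with $\log q_1=-\log q+\log d$, $\log q_2=2\log q$, $\log q_3=-\log q-\log d$ used for complex powers. **The algebra.** For $i,j\in\mathbb Z/2\mathbb Z$ let $g_{i,i}(z,w)=z-q_2w$ and $g_{i,j}(z,w)=(z-q_1w)(z-q_3w)$ for $i\ne j$. Let $\mathcal E$ (quantum toroidal $\mathfrak{gl}_2$) be the unital associative $\mathbb C$-algebra generated by the coefficients of $E_i(z)=\sum_{k\in\mathbb Z}E_{i,k}z^{-k}$, $F_i(z)=\sum_{k\in\mathbb Z}F_{i,k}z^{-k}$, $K_i^{\pm}(z)=K_i^{\pm1}\bigl(1+O(z^{\mp1})\bigr)\in\mathcal E[[z^{\mp1}]]$ and an invertible central element $\mathsf t$, with relations: all coefficients of all $K_i^\pm(z)$ commute with each other, and $$(-1)^{i+j}g_{i,j}(z,w)K_i^\pm(z)E_j(w)+g_{j,i}(w,z)E_j(w)K_i^\pm(z)=0,$$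 $$(-1)^{i+j}g_{j,i}(w,z)K_i^\pm(z)F_j(w)+g_{i,j}(z,w)F_j(w)K_i^\pm(z)=0,$$ $$[E_i(z),F_j(w)]=\tfrac{\delta_{i,j}}{q-q^{-1}}\,\delta(z/w)\,(K_i^+(w)-K_i^-(z)),$$ $$(-1)^{i+j}g_{i,j}(z,w)E_i(z)E_j(w)+g_{j,i}(w,z)E_j(w)E_i(z)=0,$$ $$(-1)^{i+j}g_{j,i}(w,z)F_i(z)F_j(w)+g_{i,j}(z,w)F_j(w)F_i(z)=0,$$ $$\mathrm{Sym}_{z_1,z_2,z_3}[X_i(z_1),[X_i(z_2),[X_i(z_3),X_{i+1}(w)]_{q^2}]]_{q^{-2}}=0\quad (X=E,F),$$ where $[A,B]_p=AB-pBA$, $[A,B]=[A,B]_1$ and $\delta(z)=\sum_{k\in\mathbb Z}z^k$. For a pair of rational functions $\phi=(\phi^0(z),\phi^1(z))$, a vector $v$ of an $\mathcal E$-module has $\ell$-weight $\phi$ if $K_i^\pm(z)v=\phi^i(z)v$, with $\phi^i$ expanded at $z=\infty$ for $+$ and at $z=0$ for $-$. A module is *tame* if it has a basis of $\ell$-weight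 vectors with distinct $\ell$-weights; it is a *highest $\ell$-weight module of highest $\ell$-weight $\phi$* if it is generated by a vector $v$ of $\ell$-weight $\phi$ with $E_i(z)v=0$, $i=0,1$; it has *level* $\kappa$ if $K_0K_1$ acts as the scalar $\kappa$. **The data.** Let $\mu\in\mathbb C$ be such that $q_2^{\mu}\neq q_1^{2a}q_2^{b}$ for all integers $a,b$ (in particular $\mu\notin\mathbb Z$). Let $$\Psi(G_0^\mu)=\Bigl(q_3q^{-\mu}\frac{z-q_3^{-2}}{z-q_2^{-\mu}},\ q^{\mu}\frac{z-q_3^{-1}q_2^{-\mu}}{z-q_3^{-1}}\Bigr).$$ For integers $i,k\ge0$ there are a box with coordinates $(x,y,z)=(i,k,1)$ and color $i+1$ mod $2$, and a box with coordinates $(i,k+\mu,0)$ and color $i$ mod $2$. The position of a box $\Box=(x,y,z)$ is $p(\Box)=q_1^{-x}q_2^{-y}q_3^{-z}$, and its color is denoted $c(\Box)$; the condition on $\mu$ says that distinct boxes of the same color have distinct positions. Boxes with $z=1$ are larger than boxes with $z=0$; boxes with the same $z$ are ordered by $y$ (that is, by $k$) first and then by $x$. A state is a finite set $\lambda$ of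 boxes for which $\{(i,k):(i,k,1)\in\lambda\}$ and $\{(i,k):(i,k+\mu,0)\in\lambda\}$ are Young diagrams of partitions. Let $S$ be the set of states. Let $A_{i,a}(z)$ be the pair with $i$-th component $\frac{q_2z-a}{z-q_2a}$ and other component $\frac{(q_1z-a)(q_3z-a)}{(z-q_1a)(z-q_3a)}$. For $\lambda\in S$ and a box $\Box$ set (all products coordinate-wise) $$\phi_\lambda=\Psi(G_0^\mu)\prod_{\Box'\in\lambda}A^{-1}_{c(\Box'),p(\Box')},\quad \phi_{\lambda,<\Box}=\Psi(G_0^\mu)\prod_{\Box'\in\lambda,\ \Box'<\Box}A^{-1}_{c(\Box'),p(\Box')},\quad \phi_{\lambda,>\Box}=\prod_{\Box'\in\lambda,\ \Box'>\Box}A^{-1}_{c(\Box'),p(\Box')}.$$ Let $CC_i(\lambda)$ (resp. $CV_i(\lambda)$) be the set of boxes of color $i$ which can be added to (resp. removed from) $\lambda$ so that the result is again a state. **Proposition.** On the vector space $G_0^\mu=\bigoplus_{\lambda\in S}\mathbb C|\lambda\rangle$ the formulas $$K_i^\pm(z)|\lambda\rangle=\phi^i_\lambda(z)|\lambda\rangle,\qquad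 \mathsf t\,|\lambda\rangle=|\lambda\rangle,$$ $$F_i(z)|\lambda\rangle=\sum_{\Box\in CC_i(\lambda)}\phi^i_{\lambda,>\Box}(p(\Box))\,\delta(z/p(\Box))\,|\lambda\sqcup\Box\rangle,$$ $$E_i(z)|\lambda\rangle=\sum_{\Box\in CV_i(\lambda)}\frac{1}{q-q^{-1}}\Bigl(\mathop{\mathrm{res}}_{z'=p(\Box)}\phi^i_{\lambda,<\Box}(z')\frac{dz'}{z'}\Bigr)\delta(z/p(\Box))\,|\lambda\setminus\Box\rangle$$ are well defined (the sums are finite and $\phi^i_{\lambda,>\Box}$ is regular at $p(\Box)$ for $\Box\in CC_i(\lambda)$) and define an $\mathcal E$-module, the evaluation Verma module. This module is irreducible, tame, and a highest $\ell$-weight module of highest $\ell$-weight $\Psi(G_0^\mu)$; its level is $q_3$. -/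

import Mathlib

noncomputable section

namespace ToroidalGL2

/-! ### Parameters

`lq`, `ld` are the chosen values of `log q`, `log d`; the algebra depends on `q`, `d` only. -/

/-- `q` and `d` are generic: `q ^ a * d ^ b = 1` with `a`, `b` rational only for `a = b = 0`.
Powers are taken with respect to the chosen logarithms. -/
def IsGeneric (lq ld : ℂ) : Prop :=
  ∀ a b : ℚ, Complex.exp (a * lq + b * ld) = 1 → a = 0 ∧ b = 0

/-- `q₁ = q⁻¹ d`. -/
def q₁ (q d : ℂ) : ℂ := q⁻¹ * d

/-- `q₂ = q ^ 2`. -/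
def q₂ (q : ℂ) : ℂ := q ^ 2

/-- `q₃ = q⁻¹ d⁻¹`. -/
def q₃ (q d : ℂ) : ℂ := q⁻¹ * d⁻¹

/-! ### Formal series

A series `X(z) = ∑ X_k z^{-k}` is the function `k ↦ X_k`, and a series in `z`, `w` is the function
sending `(k, l)` to the coefficient of `z^{-k} w^{-l}`. -/

section Series

variable {A : Type} [Ring A] [Algebra ℂ A]

/-- The coefficient of `z^{-k} w^{-l}` in `g_{i,j}(z,w) P(z,w)`, where `g_{i,i}(z,w) = z - q₂ w` and
`g_{i,j}(z,w) = (z - q₁ w)(z - q₃ w) = z² - (q₁ + q₃) z w + q₁ q₃ w²` for `i ≠ j`. -/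
def gMul (q d : ℂ) (i j : ZMod 2) (P : ℤ → ℤ → A) (k l : ℤ) : A :=
  if i = j then P (k + 1) l - q₂ q • P k (l + 1)
  else P (k + 2) l - (q₁ q d + q₃ q d) • P (k + 1) (l + 1) + (q₁ q d * q₃ q d) • P k (l + 2)

/-- The coefficient of `z^{-k} w^{-l}` in `g_{i,j}(w,z) P(z,w)`. -/
def gMulSwap (q d : ℂ) (i j : ZMod 2) (P : ℤ → ℤ → A) (k l : ℤ) : A :=
  gMul q d i j (fun l' k' => P k' l') l k

/-- The sign `(-1)^{i+j}`. -/
def sgn (i j : ZMod 2) : ℂ := if i = j then 1 else -1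

/-- The coefficient of `z^{-k} w^{-l}` in
`(-1)^{i+j} g_{i,j}(z,w) X(z) Y(w) + g_{j,i}(w,z) Y(w) X(z)`. -/
def quadE (q d : ℂ) (i j : ZMod 2) (X Y : ℤ → A) (k l : ℤ) : A :=
  sgn i j • gMul q d i j (fun k' l' => X k' * Y l') k l
    + gMulSwap q d j i (fun k' l' => Y l' * X k') k l

/-- The coefficient of `z^{-k} w^{-l}` in
`(-1)^{i+j} g_{j,i}(w,z) X(z) Y(w) + g_{i,j}(z,w) Y(w) X(z)`. -/
def quadF (q d : ℂ) (i j : ZMod 2) (X Y : ℤ → A) (k l : ℤ) : A :=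
  sgn i j • gMulSwap q d j i (fun k' l' => X k' * Y l') k l
    + gMul q d i j (fun k' l' => Y l' * X k') k l

/-- `[a, b]_p = a b - p b a`. -/
def brk (p : ℂ) (a b : A) : A := a * b - p • (b * a)

/-- The coefficient of `z₁^{-k₁} z₂^{-k₂} z₃^{-k₃} w^{-l}` in
`Sym_{z₁,z₂,z₃} [X(z₁), [X(z₂), [X(z₃), Y(w)]_{q²}]]_{q⁻²}`. -/
def serre (q : ℂ) (X Y : ℤ → A) (k : Fin 3 → ℤ) (l : ℤ) : A :=
  (1 / 6 : ℂ) • ∑ π : Equiv.Perm (Fin 3),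
    brk ((q ^ 2)⁻¹) (X (k (π 0))) (brk 1 (X (k (π 1))) (brk (q ^ 2) (X (k (π 2))) (Y l)))

end Series

/-! ### The quantum toroidal algebra of type `gl₂` (parallel realization) -/

/-- The generators: the coefficients of the series `E_i(z)`, `F_i(z)`, `K_i^±(z)` (the coefficient of
`z^{∓r}`, `r ≥ 0`, in the last case), and `t`, `t⁻¹`. The elements `H_{i,±r}` are the coefficients
of the logarithm of `K_i^{∓1} K_i^±(z)`, so they are polynomials in these generators. -/
inductive Gen : Type
  | E (i : ZMod 2) (k : ℤ)
  | F (i : ZMod 2) (k : ℤ)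
  | Kplus (i : ZMod 2) (r : ℕ)
  | Kminus (i : ZMod 2) (r : ℕ)
  | t
  | tinv

/-- The free algebra on the generators. -/
abbrev Free : Type := FreeAlgebra ℂ Gen

namespace Free

/-- The series `E_i(z)`. -/
def E (i : ZMod 2) (k : ℤ) : Free := FreeAlgebra.ι ℂ (Gen.E i k)

/-- The series `F_i(z)`. -/
def F (i : ZMod 2) (k : ℤ) : Free := FreeAlgebra.ι ℂ (Gen.F i k)

/-- The series `K_i^+(z)`, a power series in `z⁻¹`. -/
def Kplus (i : ZMod 2) (k : ℤ) : Free :=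
  if 0 ≤ k then FreeAlgebra.ι ℂ (Gen.Kplus i k.toNat) else 0

/-- The series `K_i^-(z)`, a power series in `z`. -/
def Kminus (i : ZMod 2) (k : ℤ) : Free :=
  if k ≤ 0 then FreeAlgebra.ι ℂ (Gen.Kminus i (-k).toNat) else 0

end Free

/-- The defining relations. -/
inductive Rel (q d : ℂ) : Free → Free → Prop
  | t_tinv : Rel q d (FreeAlgebra.ι ℂ Gen.t * FreeAlgebra.ι ℂ Gen.tinv) 1
  | tinv_t : Rel q d (FreeAlgebra.ι ℂ Gen.tinv * FreeAlgebra.ι ℂ Gen.t) 1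
  | t_central (x : Gen) : Rel q d (FreeAlgebra.ι ℂ Gen.t * FreeAlgebra.ι ℂ x)
      (FreeAlgebra.ι ℂ x * FreeAlgebra.ι ℂ Gen.t)
  | K_Kinv (i : ZMod 2) : Rel q d (Free.Kplus i 0 * Free.Kminus i 0) 1
  | Kinv_K (i : ZMod 2) : Rel q d (Free.Kminus i 0 * Free.Kplus i 0) 1
  | KpKp (i j : ZMod 2) (k l : ℤ) :
      Rel q d (Free.Kplus i k * Free.Kplus j l) (Free.Kplus j l * Free.Kplus i k)
  | KmKm (i j : ZMod 2) (k l : ℤ) :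
      Rel q d (Free.Kminus i k * Free.Kminus j l) (Free.Kminus j l * Free.Kminus i k)
  | KpKm (i j : ZMod 2) (k l : ℤ) :
      Rel q d (Free.Kplus i k * Free.Kminus j l) (Free.Kminus j l * Free.Kplus i k)
  | KpE (i j : ZMod 2) (k l : ℤ) : Rel q d (quadE q d i j (Free.Kplus i) (Free.E j) k l) 0
  | KmE (i j : ZMod 2) (k l : ℤ) : Rel q d (quadE q d i j (Free.Kminus i) (Free.E j) k l) 0
  | KpF (i j : ZMod 2) (k l : ℤ) : Rel q d (quadF q d i j (Free.Kplus i) (Free.F j) k l) 0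
  | KmF (i j : ZMod 2) (k l : ℤ) : Rel q d (quadF q d i j (Free.Kminus i) (Free.F j) k l) 0
  /-- `[E_i(z), F_j(w)] = δ_{ij} (q - q⁻¹)⁻¹ δ(z/w) (K_i^+(w) - K_i^-(z))`. -/
  | EF (i j : ZMod 2) (k l : ℤ) :
      Rel q d (Free.E i k * Free.F j l - Free.F j l * Free.E i k)
        (if i = j then (1 / (q - q⁻¹)) • (Free.Kplus i (k + l) - Free.Kminus i (k + l)) else 0)
  | EE (i j : ZMod 2) (k l : ℤ) : Rel q d (quadE q d i j (Free.E i) (Free.E j) k l) 0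
  | FF (i j : ZMod 2) (k l : ℤ) : Rel q d (quadF q d i j (Free.F i) (Free.F j) k l) 0
  | serreE (i : ZMod 2) (k : Fin 3 → ℤ) (l : ℤ) :
      Rel q d (serre q (Free.E i) (Free.E (i + 1)) k l) 0
  | serreF (i : ZMod 2) (k : Fin 3 → ℤ) (l : ℤ) :
      Rel q d (serre q (Free.F i) (Free.F (i + 1)) k l) 0

/-- The quantum toroidal algebra `𝓔` of type `gl₂`. -/
abbrev QTA (q d : ℂ) : Type := RingQuot (Rel q d)

namespace QTA

/-- The quotient map from the free algebra. -/
def mk (q d : ℂ) : Free →ₐ[ℂ] QTA q d := RingQuot.mkAlgHom ℂ (Rel q d)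

/-- `E_{i,k}`, the coefficient of `z^{-k}` in `E_i(z)`. -/
def E (q d : ℂ) (i : ZMod 2) (k : ℤ) : QTA q d := mk q d (Free.E i k)

/-- `F_{i,k}`, the coefficient of `z^{-k}` in `F_i(z)`. -/
def F (q d : ℂ) (i : ZMod 2) (k : ℤ) : QTA q d := mk q d (Free.F i k)

/-- The coefficient of `z^{-k}` in `K_i^+(z)`; in particular `K_i = Kplus i 0`. -/
def Kplus (q d : ℂ) (i : ZMod 2) (k : ℤ) : QTA q d := mk q d (Free.Kplus i k)

/-- The coefficient of `z^{-k}` in `K_i^-(z)`; in particular `K_i⁻¹ = Kminus i 0`. -/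
def Kminus (q d : ℂ) (i : ZMod 2) (k : ℤ) : QTA q d := mk q d (Free.Kminus i k)

/-- The split central element `t`. -/
def t (q d : ℂ) : QTA q d := mk q d (FreeAlgebra.ι ℂ Gen.t)

end QTA

/-! ### Rational functions -/

/-- The coefficient of `z^k` in the expansion of `f` at `z = 0`. -/
def coeffZero (f : RatFunc ℂ) (k : ℤ) : ℂ := (f : LaurentSeries ℂ).coeff k

/-- The coefficient of `z^{-k}` in the expansion of `f` at `z = ∞`, that is the coefficient of `u^k`
in the expansion of `f(1/u)` at `u = 0`. -/
def coeffInfty (f : RatFunc ℂ) (k : ℤ) : ℂ :=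
  coeffZero (RatFunc.eval RatFunc.C (RatFunc.X : RatFunc ℂ)⁻¹ f) k

/-- `f` is regular at `p`. -/
def RegularAt (f : RatFunc ℂ) (p : ℂ) : Prop := f.denom.eval p ≠ 0

/-- The value of `f` at `p`. -/
def value (f : RatFunc ℂ) (p : ℂ) : ℂ := RatFunc.eval (RingHom.id ℂ) p f

/-- The residue of `f(z) dz` at `z = p`: the coefficient of `(z - p)⁻¹` in the Laurent expansion of
`f` at `p`. -/
def residue (f : RatFunc ℂ) (p : ℂ) : ℂ := coeffZero (RatFunc.laurent p f) (-1)

/-! ### Notions for `𝓔`-modules -/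

section Modules

variable (q d : ℂ) (V : Type) [AddCommGroup V] [Module ℂ V] [Module (QTA q d) V]

/-- `V` has level `κ`: the element `K_0 K_1` acts as the scalar `κ`. -/
def HasLevel (κ : ℂ) : Prop :=
  ∀ v : V, (QTA.Kplus q d 0 0 * QTA.Kplus q d 1 0) • v = κ • v

variable {V}

/-- `v` is a vector of `ℓ`-weight `φ = (φ⁰(z), φ¹(z))`: `K_i^±(z) v = φ^i(z) v`, where `φ^i(z)` is
expanded at `z = ∞` for `K_i^+` and at `z = 0` for `K_i^-`. -/
def IsLWeightVector (φ : ZMod 2 → RatFunc ℂ) (v : V) : Prop :=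
  ∀ (i : ZMod 2) (k : ℤ),
    QTA.Kplus q d i k • v = coeffInfty (φ i) k • v ∧
    QTA.Kminus q d i k • v = coeffZero (φ i) (-k) • v

variable (V)

/-- `V` is tame: it has a basis of `ℓ`-weight vectors with distinct `ℓ`-weights. -/
def IsTame : Prop :=
  ∃ (ι : Type) (b : Module.Basis ι ℂ V) (φ : ι → ZMod 2 → RatFunc ℂ),
    Function.Injective φ ∧ ∀ s, IsLWeightVector q d (φ s) (b s)

/-- `V` is a highest `ℓ`-weight module of highest `ℓ`-weight `φ`: it is generated by a vector `v` of
`ℓ`-weight `φ` such that `E_i(z) v = 0`, `i = 0, 1`. -/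
def IsHighestLWeight (φ : ZMod 2 → RatFunc ℂ) : Prop :=
  ∃ v : V, IsLWeightVector q d φ v ∧ (∀ (i : ZMod 2) (k : ℤ), QTA.E q d i k • v = 0) ∧
    Submodule.span (QTA q d) {v} = ⊤

end Modules

/-! ### Combinatorial data and the action on states -/

/-- The data `(S, Ψ)` in the case when all boxes are positive: a totally ordered set of boxes with
colors and coordinates, a set `S` of states (finite sets of boxes), and a pair `Ψ`. -/
structure BoxData where
  Box : Type
  order : LinearOrder Box
  color : Box → ZMod 2
  x : Box → ℂ
  y : Box → ℂ
  z : Box → ℂ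
  states : Set (Finset Box)
  Ψ : ZMod 2 → RatFunc ℂ

/-- The `j`-th component of `A_{i,a}(z)`. -/
def rootA (q d : ℂ) (i : ZMod 2) (a : ℂ) (j : ZMod 2) : RatFunc ℂ :=
  if i = j then
    (RatFunc.C (q₂ q) * RatFunc.X - RatFunc.C a) / (RatFunc.X - RatFunc.C (q₂ q * a))
  else
    ((RatFunc.C (q₁ q d) * RatFunc.X - RatFunc.C a) *
      (RatFunc.C (q₃ q d) * RatFunc.X - RatFunc.C a)) /
    ((RatFunc.X - RatFunc.C (q₁ q d * a)) * (RatFunc.X - RatFunc.C (q₃ q d * a)))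

namespace BoxData

instance (D : BoxData) : LinearOrder D.Box := D.order

variable (lq ld : ℂ) (D : BoxData)

/-- The position `p(□) = q₁^{-x} q₂^{-y} q₃^{-z}`, where `log q₁ = -log q + log d`,
`log q₂ = 2 log q`, `log q₃ = -log q - log d`. -/
def position (b : D.Box) : ℂ :=
  Complex.exp (-(D.x b * (-lq + ld) + D.y b * (2 * lq) + D.z b * (-lq - ld)))

/-- The `ℓ`-weight of a box: `A⁻¹_{c(□), p(□)}(z)`. -/
def boxWeight (b : D.Box) (j : ZMod 2) : RatFunc ℂ :=
  (rootA (Complex.exp lq) (Complex.exp ld) (D.color b) (D.position lq ld b) j)⁻¹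

/-- The `ℓ`-weight `φ_λ` of a state. -/
def weight (s : Finset D.Box) (j : ZMod 2) : RatFunc ℂ :=
  D.Ψ j * ∏ b ∈ s, D.boxWeight lq ld b j

/-- `φ_{λ,<□}`. -/
def weightBelow (s : Finset D.Box) (b : D.Box) (j : ZMod 2) : RatFunc ℂ :=
  D.Ψ j * ∏ b' ∈ s with b' < b, D.boxWeight lq ld b' j

/-- `φ_{λ,>□}`. -/
def weightAbove (s : Finset D.Box) (b : D.Box) (j : ZMod 2) : RatFunc ℂ :=
  ∏ b' ∈ s with b < b', D.boxWeight lq ld b' j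

/-- `CC_i(λ)`: the boxes of color `i` which can be added to the state `λ`. -/
def concave (s : Finset D.Box) (i : ZMod 2) : Set D.Box :=
  {b | D.color b = i ∧ b ∉ s ∧ insert b s ∈ D.states}

/-- `CV_i(λ)`: the boxes of color `i` which can be removed from the state `λ`. -/
def convex (s : Finset D.Box) (i : ZMod 2) : Set D.Box :=
  {b | D.color b = i ∧ b ∈ s ∧ s.erase b ∈ D.states}

/-- The coefficient `a^i_{λ,□} = φ^i_{λ,>□}(p(□))`. -/
def coeffA (s : Finset D.Box) (i : ZMod 2) (b : D.Box) : ℂ :=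
  value (D.weightAbove lq ld s b i) (D.position lq ld b)

/-- The coefficient `b^i_{λ,□} = (q - q⁻¹)⁻¹ res_{z = p(□)} φ^i_{λ,<□}(z) dz / z`. -/
def coeffB (s : Finset D.Box) (i : ZMod 2) (b : D.Box) : ℂ :=
  1 / (Complex.exp lq - (Complex.exp lq)⁻¹) *
    residue (D.weightBelow lq ld s b i / RatFunc.X) (D.position lq ld b)

/-- The space with a basis `|λ⟩` labeled by the states. -/
abbrev Space : Type := D.states →₀ ℂ

variable {D} in
/-- The basis vector `|λ⟩`. -/
def ket (s : Finset D.Box) (hs : s ∈ D.states) : D.Space := Finsupp.single ⟨s, hs⟩ 1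

/-- The given `𝓔`-module structure on the space with basis `|λ⟩` is the one of `V(S, Ψ)`:
* `K_i^±(z) |λ⟩ = φ_λ^i(z) |λ⟩`;
* `F_i(z) |λ⟩ = ∑_{□ ∈ CC_i(λ)} a^i_{λ,□} δ(z/p(□)) |λ ⊔ □⟩`;
* `E_i(z) |λ⟩ = ∑_{□ ∈ CV_i(λ)} b^i_{λ,□} δ(z/p(□)) |λ \ □⟩`;
* `t` acts as `1`.

The coefficient of `z^{-k}` in `δ(z/p)` is `p^k`. The first two fields say that the sums are finite
and the values `a^i_{λ,□}` are well defined. -/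
structure IsCombinatorialModule
    [Module (QTA (Complex.exp lq) (Complex.exp ld)) D.Space] : Prop where
  finite_concave : ∀ s ∈ D.states, ∀ i, (D.concave s i).Finite
  regular : ∀ s ∈ D.states, ∀ i, ∀ b ∈ D.concave s i,
    RegularAt (D.weightAbove lq ld s b i) (D.position lq ld b)
  K_smul : ∀ (s) (hs : s ∈ D.states),
    IsLWeightVector (Complex.exp lq) (Complex.exp ld) (D.weight lq ld s) (ket s hs)
  F_smul : ∀ (s) (hs : s ∈ D.states) (i : ZMod 2) (k : ℤ),
    QTA.F (Complex.exp lq) (Complex.exp ld) i k • ket s hs =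
      ∑ᶠ b : D.concave s i,
        (D.coeffA lq ld s i b * D.position lq ld b ^ k) • ket (insert b.1 s) b.2.2.2
  E_smul : ∀ (s) (hs : s ∈ D.states) (i : ZMod 2) (k : ℤ),
    QTA.E (Complex.exp lq) (Complex.exp ld) i k • ket s hs =
      ∑ᶠ b : D.convex s i,
        (D.coeffB lq ld s i b * D.position lq ld b ^ k) • ket (s.erase b.1) b.2.2.2
  t_smul : ∀ v : D.Space, QTA.t (Complex.exp lq) (Complex.exp ld) • v = v

end BoxData

/-! ### The data of the evaluation Verma module -/

/-- The highest `ℓ`-weight `Ψ(G_0^μ)`; here `q^c = exp (c log q)` and `q₂^{-μ} = q^{-2μ}`. -/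
def vermaWeight (lq ld μ : ℂ) (j : ZMod 2) : RatFunc ℂ :=
  let q3 : ℂ := q₃ (Complex.exp lq) (Complex.exp ld)
  if j = 0 then
    RatFunc.C (q3 * Complex.exp (-μ * lq)) * (RatFunc.X - RatFunc.C (q3⁻¹ ^ 2)) /
      (RatFunc.X - RatFunc.C (Complex.exp (-μ * (2 * lq))))
  else
    RatFunc.C (Complex.exp (μ * lq)) *
      (RatFunc.X - RatFunc.C (q3⁻¹ * Complex.exp (-μ * (2 * lq)))) /
      (RatFunc.X - RatFunc.C q3⁻¹)

/-- The data of `G_0^μ`. A box is a triple `(z, k, i)` with `z ∈ {0, 1}`, `i, k ≥ 0`, ordered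
lexicographically: the triple `(1, k, i)` is the box with coordinates `(i, k, 1)` and color `i + 1`,
and `(0, k, i)` is the box with coordinates `(i, k + μ, 0)` and color `i`. The states are the pairs
of partitions placed vertically (in the plane `z = 1` and in the plane `z = 0`). -/
def vermaData (lq ld μ : ℂ) : BoxData where
  Box := Fin 2 ×ₗ ℕ ×ₗ ℕ
  order := inferInstance
  color b := (ofLex (ofLex b).2).2 + (ofLex b).1.val
  x b := (ofLex (ofLex b).2).2
  y b := (ofLex (ofLex b).2).1 + (if (ofLex b).1 = 0 then μ else 0)
  z b := (ofLex b).1.val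
  states := {s | ∃ Y : Fin 2 → YoungDiagram,
    ∀ (z : Fin 2) (k i : ℕ), toLex (z, toLex (k, i)) ∈ s ↔ (i, k) ∈ Y z}
  Ψ := vermaWeight lq ld μ

end ToroidalGL2

end

/-! Everything is reduced to orders and leading coefficients of the weights at positions of boxes.
Each box weight is a ratio of linear factors whose zeros and poles lie at positions of neighbouring
boxes. Its value at another box is, up to sign, a ratio of two functions g, the same functions that
occur in the quadratic relations.

Relations among the `F` (or among the `E`) alone. A current is a locally finite sum of operators
`up`, one for each box, so each relation can be checked on finite partial sums (`Approx`) and then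
box by box. For boxes added together without a diagonal pair, `Frame.Raising.up_perm` shows that all
orders of adding them give multiples of one vector, the multiple being a product of functions g and
signs over ordered pairs. An order passing through a non-state gives zero, and so does the product.
The quadratic relations follow at once, and the Serre relations become a polynomial identity,
`serre_polynomial`. The operators `down` are transposes of operators of the form `up`, so the
relations for `E` come by reversing words.

Relations between `E` and `F`. For distinct boxes, removing and adding commute (`Rep.down_comm_up`).
For the same box, the product of the coefficients is a residue of the full weight
(`Geometry.coeffF_mul_coeffE`), and the sum of these residues over the corners is the difference of
the expansions at infinity and at zero by partial fractions (`coeffInfty_sub_coeffZero`). This needs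
the weight of a state to have simple poles exactly at its corners.

That pole structure is combinatorial. On the lattice of positions the order of the weight is
`cornerOrder` of the indicator of the filled cells, where the highest weight accounts for regarding
everything outside the quadrant as filled (`cornerOrder_sum`). Since the filled set is closed
downwards, this order is -1 at the corners and nonnegative elsewhere (`cornerOrder_filled`).
Genericity of q, d and the condition on μ keep different lattice points of the same color apart
(`latticePos_eq_iff`).

Tameness: at the position diagonally above the largest box on which two states differ, no smaller
box has a zero or a pole, so the weights differ there (`Geometry.weight_injective`). Irreducibility:
an invariant subspace therefore contains a basis vector, and since all coefficients are nonzero,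
removing boxes leads to the empty state and adding them leads everywhere. The highest weight
property follows from irreducibility, and the level is constant because q₁q₂q₃ = 1. -/

noncomputable section

namespace ToroidalGL2

open scoped RatFunc

/-! ### Orders and leading coefficients of rational functions -/

/-- The Laurent expansion at zero. -/
def toLaurent (K : Type) [Field K] : RatFunc K →+* LaurentSeries K :=
  algebraMap (RatFunc K) (LaurentSeries K)

lemma toLaurent_X (K : Type) [Field K] : toLaurent K RatFunc.X = HahnSeries.single 1 1 :=
  RatFunc.coe_X

lemma toLaurent_algebraMap (K : Type) [Field K] (P : Polynomial K) :
    toLaurent K (algebraMap _ _ P) = ((P : PowerSeries K) : LaurentSeries K) := by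
  rw [RatFunc.coe_coe]
  simp [toLaurent]

lemma toLaurent_C (K : Type) [Field K] (a : K) :
    toLaurent K (RatFunc.C a) = HahnSeries.C a := by
  rw [← RatFunc.algebraMap_C, toLaurent_algebraMap, Polynomial.coe_C, PowerSeries.coe_C]

/-- The Laurent expansion at `p`. -/
def expand (p : ℂ) : RatFunc ℂ →+* LaurentSeries ℂ :=
  (toLaurent ℂ).comp (RatFunc.laurent p : RatFunc ℂ →ₐ[ℂ] RatFunc ℂ).toRingHom

/-- `RatFunc.eval` respects sums and products only when the denominators do not vanish at the chosen
point; transcendence of the inverse variable guarantees this, so `flip` is a ring homomorphism. -/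
lemma evalInv_ne_zero {P : Polynomial ℂ} (hP : P ≠ 0) :
    P.eval₂ RatFunc.C (RatFunc.X : RatFunc ℂ)⁻¹ ≠ 0 := by
  have h : Transcendental ℂ (RatFunc.X : RatFunc ℂ)⁻¹ := by
    have := RatFunc.transcendental_X (K := ℂ)
    rwa [Transcendental, IsAlgebraic.inv_iff]
  intro h0
  exact hP ((transcendental_iff.1 h) P (by
    rwa [Polynomial.aeval_def, RatFunc.algebraMap_eq_C]))

/-- The substitution `f(z) ↦ f(z⁻¹)`. -/
def flip : RatFunc ℂ →+* RatFunc ℂ where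
  toFun f := RatFunc.eval RatFunc.C (RatFunc.X : RatFunc ℂ)⁻¹ f
  map_zero' := RatFunc.eval_zero ..
  map_one' := RatFunc.eval_one ..
  map_add' f g := RatFunc.eval_add _ _ (evalInv_ne_zero (RatFunc.denom_ne_zero f))
    (evalInv_ne_zero (RatFunc.denom_ne_zero g))
  map_mul' f g := RatFunc.eval_mul _ _ (evalInv_ne_zero (RatFunc.denom_ne_zero f))
    (evalInv_ne_zero (RatFunc.denom_ne_zero g))

lemma flip_apply (f : RatFunc ℂ) :
    flip f = RatFunc.eval RatFunc.C (RatFunc.X : RatFunc ℂ)⁻¹ f := rfl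

@[simp] lemma flip_C (a : ℂ) : flip (RatFunc.C a) = RatFunc.C a := by
  rw [flip_apply, RatFunc.eval_C]

@[simp] lemma flip_X : flip RatFunc.X = RatFunc.X⁻¹ := by
  rw [flip_apply, RatFunc.eval_X]

/-- The expansion at infinity, in powers of `z⁻¹`. -/
def expandInfty : RatFunc ℂ →+* LaurentSeries ℂ :=
  (toLaurent ℂ).comp flip

lemma coeffZero_def (f : RatFunc ℂ) (k : ℤ) : coeffZero f k = (toLaurent ℂ f).coeff k := rfl

lemma coeffZero_eq (f : RatFunc ℂ) (k : ℤ) : coeffZero f k = (expand 0 f).coeff k := by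
  rw [coeffZero_def, expand, RingHom.comp_apply]
  exact congrArg (fun g => (toLaurent ℂ g).coeff k) (RatFunc.laurent_at_zero f).symm

lemma coeffInfty_eq (f : RatFunc ℂ) (k : ℤ) : coeffInfty f k = (expandInfty f).coeff k := rfl

lemma residue_eq (f : RatFunc ℂ) (p : ℂ) : residue f p = (expand p f).coeff (-1) := rfl

@[simp] lemma expand_C (p a : ℂ) : expand p (RatFunc.C a) = HahnSeries.C a :=
  (congrArg (toLaurent ℂ) (RatFunc.laurent_C p a)).trans (toLaurent_C ℂ a)

@[simp] lemma expand_X (p : ℂ) :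
    expand p RatFunc.X = HahnSeries.single 1 1 + HahnSeries.C p :=
  (congrArg (toLaurent ℂ) (RatFunc.laurent_X p)).trans (by
    rw [map_add, toLaurent_X, toLaurent_C])

@[simp] lemma expandInfty_C (a : ℂ) : expandInfty (RatFunc.C a) = HahnSeries.C a := by
  rw [expandInfty, RingHom.comp_apply, flip_C, toLaurent_C]

@[simp] lemma expandInfty_X : expandInfty RatFunc.X = HahnSeries.single (-1) 1 := by
  rw [expandInfty, RingHom.comp_apply, flip_X, map_inv₀, toLaurent_X, HahnSeries.inv_single,
    inv_one]

/-! ### Multiplicativity of orders and leading coefficients under an expansion -/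

section Valuation

variable (Φ : RatFunc ℂ →+* LaurentSeries ℂ)

lemma order_hom_mul {f g : RatFunc ℂ} (hf : f ≠ 0) (hg : g ≠ 0) :
    (Φ (f * g)).order = (Φ f).order + (Φ g).order := by
  rw [map_mul, HahnSeries.order_mul ((map_ne_zero Φ).2 hf) ((map_ne_zero Φ).2 hg)]

lemma order_hom_inv (f : RatFunc ℂ) : (Φ f⁻¹).order = -(Φ f).order := by
  by_cases hf : f = 0
  · simp [hf]
  have := order_hom_mul Φ hf (inv_ne_zero hf)
  rw [mul_inv_cancel₀ hf, map_one, HahnSeries.order_one] at this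
  linarith

lemma order_hom_div {f g : RatFunc ℂ} (hf : f ≠ 0) (hg : g ≠ 0) :
    (Φ (f / g)).order = (Φ f).order - (Φ g).order := by
  rw [div_eq_mul_inv, order_hom_mul Φ hf (inv_ne_zero hg), order_hom_inv, sub_eq_add_neg]

lemma order_hom_prod {ι : Type*} (s : Finset ι) (f : ι → RatFunc ℂ) (hf : ∀ i ∈ s, f i ≠ 0) :
    (Φ (∏ i ∈ s, f i)).order = ∑ i ∈ s, (Φ (f i)).order := by
  classical
  induction s using Finset.induction_on with
  | empty => simp
  | insert a s ha ih =>
    rw [Finset.prod_insert ha, Finset.sum_insert ha, order_hom_mul, ih]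
    · exact fun i hi => hf i (Finset.mem_insert_of_mem hi)
    · exact hf a (Finset.mem_insert_self _ _)
    · exact Finset.prod_ne_zero_iff.2 fun i hi => hf i (Finset.mem_insert_of_mem hi)

/-- The leading coefficient, as a multiplicative map. -/
def lead : RatFunc ℂ →*₀ ℂ where
  toFun f := (Φ f).leadingCoeff
  map_zero' := by simp
  map_one' := by simp
  map_mul' f g := by rw [map_mul, HahnSeries.leadingCoeff_mul]

lemma lead_eq_coeff (f : RatFunc ℂ) : lead Φ f = (Φ f).coeff (Φ f).order :=
  HahnSeries.leadingCoeff_eq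

lemma lead_ne_zero {f : RatFunc ℂ} (hf : f ≠ 0) : lead Φ f ≠ 0 := (map_ne_zero (lead Φ)).2 hf

lemma coeff_eq_zero_of_lt {f : RatFunc ℂ} {n : ℤ} (h : n < (Φ f).order) : (Φ f).coeff n = 0 :=
  HahnSeries.coeff_eq_zero_of_lt_order h

end Valuation

/-- The order of vanishing at `p`. -/
def ordAt (p : ℂ) (f : RatFunc ℂ) : ℤ := (expand p f).order

/-- The leading coefficient of the expansion at `p`. -/
def leadAt (p : ℂ) : RatFunc ℂ →*₀ ℂ := lead (expand p)

lemma laurent_order_leading {x : LaurentSeries ℂ} {n : ℤ} (h0 : ∀ m < n, x.coeff m = 0)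
    (hn : x.coeff n ≠ 0) : x.order = n ∧ x.leadingCoeff = x.coeff n := by
  have : x.order = n := le_antisymm (HahnSeries.order_le_of_coeff_ne_zero hn) (by
    by_contra h
    push Not at h
    have h1 := h0 _ h
    rw [HahnSeries.coeff_order_eq_zero] at h1
    simp [h1] at hn)
  exact ⟨this, by rw [HahnSeries.leadingCoeff_eq, this]⟩

lemma expand_linear (p u v : ℂ) :
    expand p (RatFunc.C u * RatFunc.X - RatFunc.C v)
      = HahnSeries.single 1 u + HahnSeries.single 0 (u * p - v) := by
  rw [map_sub, map_mul, expand_C, expand_X, expand_C]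
  simp only [HahnSeries.C_apply, mul_add, HahnSeries.single_mul_single, HahnSeries.single_sub]
  simp [add_sub_assoc]

lemma order_leading_linear (p : ℂ) {u : ℂ} (hu : u ≠ 0) (v : ℂ) :
    ordAt p (RatFunc.C u * RatFunc.X - RatFunc.C v) = (if u * p = v then 1 else 0) ∧
    leadAt p (RatFunc.C u * RatFunc.X - RatFunc.C v) = (if u * p = v then u else u * p - v) := by
  rw [ordAt, leadAt, lead]
  simp only [MonoidWithZeroHom.coe_mk, ZeroHom.coe_mk, expand_linear]
  split_ifs with h
  · have := laurent_order_leading (x := HahnSeries.single 1 u + HahnSeries.single 0 (u * p - v))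
      (n := 1) (by intro m hm; rw [h]; simp [HahnSeries.coeff_single_of_ne hm.ne]) (by simpa [h])
    rw [this.1, this.2]; simp
  · have := laurent_order_leading (x := HahnSeries.single 1 u + HahnSeries.single 0 (u * p - v))
      (n := 0) (by
        intro m hm
        rw [HahnSeries.coeff_add, HahnSeries.coeff_single_of_ne (by lia),
          HahnSeries.coeff_single_of_ne hm.ne, add_zero]) (by simpa [sub_eq_zero])
    rw [this.1, this.2]; simp

lemma order_leading_linear_infty {u : ℂ} (hu : u ≠ 0) (v : ℂ) :
    (expandInfty (RatFunc.C u * RatFunc.X - RatFunc.C v)).order = -1 ∧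
    lead expandInfty (RatFunc.C u * RatFunc.X - RatFunc.C v) = u := by
  have e : expandInfty (RatFunc.C u * RatFunc.X - RatFunc.C v)
      = HahnSeries.single (-1) u - HahnSeries.single 0 v := by
    rw [map_sub, map_mul, expandInfty_C, expandInfty_X, expandInfty_C]
    simp only [HahnSeries.C_apply, HahnSeries.single_mul_single]
    simp
  have := laurent_order_leading (x := HahnSeries.single (-1) u - HahnSeries.single 0 v) (n := -1)
    (by intro m hm
        rw [HahnSeries.coeff_sub, HahnSeries.coeff_single_of_ne hm.ne,
          HahnSeries.coeff_single_of_ne (by lia), sub_zero]) (by simpa)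
  refine ⟨by rw [e, this.1], ?_⟩
  rw [lead]
  simp only [MonoidWithZeroHom.coe_mk, ZeroHom.coe_mk]
  rw [e, this.2]
  simp

lemma linear_ne_zero {u : ℂ} (hu : u ≠ 0) (v : ℂ) :
    (RatFunc.C u * RatFunc.X - RatFunc.C v : RatFunc ℂ) ≠ 0 := by
  intro h
  have := (order_leading_linear_infty hu v).2
  rw [h, map_zero] at this
  exact hu this.symm

lemma expand_algebraMap (p : ℂ) (P : Polynomial ℂ) :
    expand p (algebraMap _ _ P) = ((Polynomial.taylor p P : PowerSeries ℂ) : LaurentSeries ℂ) :=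
  (congrArg (toLaurent ℂ) (RatFunc.laurent_algebraMap p P)).trans (toLaurent_algebraMap ℂ _)

lemma coeff_expand_algebraMap_of_neg (p : ℂ) (P : Polynomial ℂ) {m : ℤ} (hm : m < 0) :
    (expand p (algebraMap _ _ P)).coeff m = 0 := by
  rw [expand_algebraMap]
  exact PowerSeries.coeff_coe .. |>.trans (if_pos hm)

lemma coeff_expand_algebraMap_zero (p : ℂ) (P : Polynomial ℂ) :
    (expand p (algebraMap _ _ P)).coeff 0 = P.eval p := by
  rw [expand_algebraMap]
  refine (PowerSeries.coeff_coe ..).trans ?_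
  simp

lemma ordAt_algebraMap_of_eval_ne {p : ℂ} {P : Polynomial ℂ} (h : P.eval p ≠ 0) :
    ordAt p (algebraMap _ _ P) = 0 ∧ leadAt p (algebraMap _ _ P) = P.eval p := by
  have := laurent_order_leading (fun m hm => coeff_expand_algebraMap_of_neg p P hm)
    (by rwa [coeff_expand_algebraMap_zero])
  exact ⟨this.1, by rw [← coeff_expand_algebraMap_zero]; exact this.2⟩

lemma ordAt_algebraMap_of_eval_eq {p : ℂ} {P : Polynomial ℂ} (h0 : P ≠ 0) (h : P.eval p = 0) :
    0 < ordAt p (algebraMap _ _ P) := by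
  by_contra hc
  have h1 : expand p (algebraMap _ (RatFunc ℂ) P) ≠ 0 := by simpa using h0
  have h2 := HahnSeries.coeff_order_eq_zero.not.2 h1
  rcases (not_lt.1 hc).lt_or_eq with h3 | h3
  · exact h2 (coeff_expand_algebraMap_of_neg p P h3)
  · rw [ordAt] at h3
    rw [h3, coeff_expand_algebraMap_zero] at h2
    exact h2 h

/-- A rational function of nonnegative order at `p` is regular at `p`. -/
lemma regularAt_of_ordAt_nonneg {p : ℂ} {f : RatFunc ℂ} (hf : f ≠ 0) (h : 0 ≤ ordAt p f) :
    RegularAt f p := by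
  intro hd
  -- Numerator and denominator are coprime, so a root of the denominator is not a root of the
  -- numerator, and the order would be negative.
  have hn : f.num.eval p ≠ 0 := by
    intro hn
    obtain ⟨a, b, hab⟩ := f.isCoprime_num_denom
    have := congrArg (Polynomial.eval p) hab
    simp [hn, hd] at this
  have hd0 := RatFunc.denom_ne_zero f
  have hn0 : f.num ≠ 0 := RatFunc.num_ne_zero hf
  have h1 := (ordAt_algebraMap_of_eval_ne hn).1
  have h2 := ordAt_algebraMap_of_eval_eq hd0 hd
  have h3 := order_hom_div (expand p) (f := algebraMap _ _ f.num) (g := algebraMap _ _ f.denom)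
    (by simpa using hn0) (by simpa using hd0)
  rw [RatFunc.num_div_denom] at h3
  unfold ordAt at h h1 h2
  lia

/-- At a point of order zero, the value is the leading coefficient. -/
lemma value_eq_leadAt {p : ℂ} {f : RatFunc ℂ} (hf : f ≠ 0) (h : ordAt p f = 0) :
    value f p = leadAt p f := by
  have hr := regularAt_of_ordAt_nonneg hf h.ge
  have hd := ordAt_algebraMap_of_eval_ne hr
  have hn0 : f.num ≠ 0 := RatFunc.num_ne_zero hf
  have hd0 := RatFunc.denom_ne_zero f
  have h3 := order_hom_div (expand p) (f := algebraMap _ _ f.num) (g := algebraMap _ _ f.denom)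
    (by simpa using hn0) (by simpa using hd0)
  rw [RatFunc.num_div_denom] at h3
  have hn : f.num.eval p ≠ 0 := by
    intro hn
    have := ordAt_algebraMap_of_eval_eq hn0 hn
    unfold ordAt at *
    lia
  conv_rhs => rw [← RatFunc.num_div_denom f, map_div₀, hd.2, (ordAt_algebraMap_of_eval_ne hn).2]
  simp [value, RatFunc.eval, Polynomial.eval₂_id]

lemma residue_eq_leadAt {p : ℂ} {f : RatFunc ℂ} (h : ordAt p f = -1) :
    residue f p = leadAt p f := by
  rw [residue_eq, leadAt, lead_eq_coeff]
  unfold ordAt at h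
  rw [h]

/-! ### Partial fractions -/

lemma coeff_neg_of_order_nonneg {x : LaurentSeries ℂ} (h : 0 ≤ x.order) {m : ℤ} (hm : m < 0) :
    x.coeff m = 0 := HahnSeries.coeff_eq_zero_of_lt_order (hm.trans_le h)

lemma order_nonneg_of_coeff {x : LaurentSeries ℂ} (h : ∀ m < 0, x.coeff m = 0) : 0 ≤ x.order := by
  by_contra hc
  push Not at hc
  have := h _ hc
  rw [HahnSeries.coeff_order_eq_zero] at this
  simp [this] at hc

/-- This turns the absence of a pole at infinity into a bound on the degree of a polynomial. -/
lemma coeff_expandInfty_algebraMap (P : Polynomial ℂ) (n : ℕ) :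
    (expandInfty (algebraMap _ _ P)).coeff (-n : ℤ) = P.coeff n := by
  induction P using Polynomial.induction_on' with
  | add p q hp hq => simp [hp, hq]
  | monomial k a =>
    rw [RatFunc.algebraMap_monomial, map_mul, map_pow, expandInfty_C, expandInfty_X,
      HahnSeries.single_pow, HahnSeries.C_apply, HahnSeries.single_mul_single,
      HahnSeries.coeff_single, Polynomial.coeff_monomial]
    simp only [one_pow, mul_one, zero_add, nsmul_eq_mul, mul_neg, neg_inj, Nat.cast_inj]
    simp [eq_comm]

/-- A rational function without poles on the projective line is constant. -/
lemma exists_eq_C {h : RatFunc ℂ} (hp : ∀ p, 0 ≤ ordAt p h) (hi : 0 ≤ (expandInfty h).order) :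
    ∃ c, h = RatFunc.C c := by
  by_cases h0 : h = 0
  · exact ⟨0, by simp [h0]⟩
  -- A nonconstant denominator has a root over ℂ, and that root would be a pole.
  have hd : h.denom = 1 := by
    by_contra hne
    obtain ⟨p, hp'⟩ := IsAlgClosed.exists_root h.denom (by
      intro hdeg
      exact hne ((RatFunc.monic_denom h).eq_one_of_isUnit
        (Polynomial.isUnit_iff_degree_eq_zero.2 hdeg)))
    exact regularAt_of_ordAt_nonneg h0 (hp p) hp'
  have he : h = algebraMap _ _ h.num := by
    conv_lhs => rw [← RatFunc.num_div_denom h, hd]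
    simp
  refine ⟨h.num.coeff 0, ?_⟩
  rw [← RatFunc.algebraMap_C, ← Polynomial.eq_C_of_natDegree_eq_zero]
  · exact he
  · rw [← Nat.le_zero, Polynomial.natDegree_le_iff_coeff_eq_zero]
    intro n hn
    rw [← coeff_expandInfty_algebraMap, ← he]
    exact coeff_neg_of_order_nonneg hi (by lia)

/-- The function `z / (z - p)`. -/
def simplePole (p : ℂ) : RatFunc ℂ := RatFunc.X / (RatFunc.X - RatFunc.C p)

lemma order_leading_X_sub_C (p a : ℂ) :
    ordAt p (RatFunc.X - RatFunc.C a) = (if p = a then 1 else 0) ∧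
    leadAt p (RatFunc.X - RatFunc.C a) = (if p = a then 1 else p - a) := by
  simpa using order_leading_linear p one_ne_zero a

lemma X_sub_C_ne_zero (a : ℂ) : (RatFunc.X - RatFunc.C a : RatFunc ℂ) ≠ 0 := by
  simpa using linear_ne_zero one_ne_zero a

lemma order_leading_X (p : ℂ) :
    ordAt p RatFunc.X = (if p = 0 then 1 else 0) ∧
    leadAt p RatFunc.X = (if p = 0 then 1 else p) := by
  simpa using order_leading_X_sub_C p 0

lemma simplePole_mul (p : ℂ) : simplePole p * (RatFunc.X - RatFunc.C p) = RatFunc.X :=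
  div_mul_cancel₀ _ (X_sub_C_ne_zero p)

lemma ordAt_simplePole {p : ℂ} {a : ℂ} (ha : a ≠ p) :
    0 ≤ ordAt a (simplePole p) := by
  rw [ordAt, simplePole, order_hom_div _ RatFunc.X_ne_zero (X_sub_C_ne_zero p)]
  have h1 := (order_leading_X_sub_C a p).1
  have h2 := (order_leading_X a).1
  unfold ordAt at h1 h2
  rw [h1, h2, if_neg ha]
  split_ifs <;> simp

lemma order_expandInfty_simplePole (p : ℂ) : 0 ≤ (expandInfty (simplePole p)).order := by
  rw [simplePole, order_hom_div _ RatFunc.X_ne_zero (X_sub_C_ne_zero p)]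
  have h1 := (order_leading_linear_infty one_ne_zero p).1
  have h2 := (order_leading_linear_infty one_ne_zero 0).1
  simp only [map_one, one_mul, map_zero, sub_zero] at h1 h2
  rw [h1, h2]
  simp

lemma coeff_expand_simplePole {p : ℂ} {m : ℤ} (hm : m < 0) :
    (expand p (simplePole p)).coeff m = if m = -1 then p else 0 := by
  have h : simplePole p = 1 + RatFunc.C p * (RatFunc.X - RatFunc.C p)⁻¹ := by
    rw [simplePole]
    have := X_sub_C_ne_zero p
    field_simp
    ring
  rw [h, map_add, map_one, map_mul, map_inv₀, map_sub, expand_X, expand_C, add_sub_cancel_right,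
    HahnSeries.inv_single, HahnSeries.C_apply, HahnSeries.single_mul_single, HahnSeries.coeff_add,
    HahnSeries.coeff_one, if_neg hm.ne, HahnSeries.coeff_single]
  simp

/-- The two expansions are the two halves of a geometric series, and their difference is the delta
function at p. The proof uses the recursion satisfied by both instead of the explicit series. -/
lemma coeff_simplePole {p : ℂ} (hp : p ≠ 0) (k : ℤ) :
    coeffInfty (simplePole p) k - coeffZero (simplePole p) (-k) = p ^ k := by
  have hI : ∀ k, coeffInfty (simplePole p) (k + 1) - p * coeffInfty (simplePole p) k
      = if k = -1 then 1 else 0 := by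
    intro k
    have := congrArg (fun f => (expandInfty f).coeff k) (simplePole_mul p)
    simp only [map_mul, map_sub, expandInfty_X, expandInfty_C, mul_sub] at this
    rw [HahnSeries.coeff_sub, show k = (k + 1) + (-1) by ring, HahnSeries.coeff_mul_single_add,
      mul_one, mul_comm, HahnSeries.C_mul_eq_smul, HahnSeries.coeff_smul, smul_eq_mul] at this
    rw [coeffInfty_eq, coeffInfty_eq, show k = k + 1 + -1 by ring]
    rw [show k + 1 + -1 + 1 = k + 1 by ring, this, HahnSeries.coeff_single]
    congr
  have hZ : ∀ k, coeffZero (simplePole p) (k - 1) - p * coeffZero (simplePole p) k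
      = if k = 1 then 1 else 0 := by
    intro k
    have := congrArg (fun f => (expand 0 f).coeff k) (simplePole_mul p)
    simp only [map_mul, map_sub, expand_X, expand_C, mul_sub, map_zero, add_zero] at this
    rw [HahnSeries.coeff_sub, show k = (k - 1) + 1 by ring, HahnSeries.coeff_mul_single_add,
      mul_one, mul_comm, HahnSeries.C_mul_eq_smul, HahnSeries.coeff_smul, smul_eq_mul] at this
    rw [coeffZero_eq, coeffZero_eq, show k = k - 1 + 1 by ring]
    rw [show k - 1 + 1 - 1 = k - 1 by ring, this, HahnSeries.coeff_single]
    congr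
  set D : ℤ → ℂ := fun k => coeffInfty (simplePole p) k - coeffZero (simplePole p) (-k) with hD
  -- Multiplication by z - p yields z in both expansions, so it kills the difference.
  have step : ∀ k, D (k + 1) = p * D k := by
    intro k
    have h1 := hI k
    have h2 := hZ (-k)
    simp only [show (-k = (1 : ℤ)) ↔ k = -1 by lia, show -k - 1 = -(k + 1) by ring] at h2
    simp only [hD]
    linear_combination h1 - h2
  -- The function has no pole at infinity or at zero, so the coefficients entering the recursions
  -- from the left vanish.
  have h0 : D 0 = 1 := by
    have h1 := hI (-1)
    have h2 := hZ 0
    have h3 : coeffInfty (simplePole p) (-1) = 0 :=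
      coeff_neg_of_order_nonneg (order_expandInfty_simplePole p) (by norm_num)
    have h4 : coeffZero (simplePole p) (-1) = 0 := by
      rw [coeffZero_eq]
      exact coeff_neg_of_order_nonneg (ordAt_simplePole hp.symm) (by norm_num)
    norm_num [h3] at h1
    norm_num [h4, hp] at h2
    simp [hD, h1, h2]
  change D k = p ^ k
  induction k with
  | zero => simpa using h0
  | succ n ih => rw [step, ih, zpow_add_one₀ hp, mul_comm]
  | pred n ih =>
    have := step (-n - 1)
    rw [sub_add_cancel, ih] at this
    rw [zpow_sub_one₀ hp, this]
    field_simp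

/-- Write z = (z - p) + p. The first summand brings in the coefficient of degree -2, which is zero
because the pole is at most simple. -/
lemma residue_div_X {p : ℂ} (hp : p ≠ 0) {f : RatFunc ℂ} (hf : f ≠ 0) (h : -1 ≤ ordAt p f) :
    (expand p f).coeff (-1) = p * residue (f / RatFunc.X) p := by
  have e : f = f / RatFunc.X * RatFunc.X := (div_mul_cancel₀ _ RatFunc.X_ne_zero).symm
  have ho : -1 ≤ (expand p (f / RatFunc.X)).order := by
    rw [order_hom_div _ hf RatFunc.X_ne_zero]
    have := (order_leading_X p).1
    rw [if_neg hp] at this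
    unfold ordAt at h this
    lia
  conv_lhs => rw [e, map_mul, expand_X, mul_add, show (-1 : ℤ) = -2 + 1 by norm_num,
    HahnSeries.coeff_add, HahnSeries.coeff_mul_single_add, mul_one, mul_comm (expand p _),
    HahnSeries.C_mul_eq_smul, HahnSeries.coeff_smul, smul_eq_mul,
    HahnSeries.coeff_eq_zero_of_lt_order (by lia : (-2 : ℤ) < _)]
  rw [zero_add, residue_eq]
  norm_num

/-- The difference of the expansions of a rational function at infinity and at zero is a sum of
delta functions at its poles. -/
theorem coeffInfty_sub_coeffZero {f : RatFunc ℂ} (hf : f ≠ 0) (P : Finset ℂ) (h0 : 0 ∉ P)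
    (h1 : ∀ p ∉ P, 0 ≤ ordAt p f) (h2 : ∀ p ∈ P, -1 ≤ ordAt p f)
    (hi : 0 ≤ (expandInfty f).order) (k : ℤ) :
    coeffInfty f k - coeffZero f (-k) = ∑ p ∈ P, residue (f / RatFunc.X) p * p ^ k := by
  -- This sum carries the principal parts of f. The difference has no poles on the projective line,
  -- so it is a constant, and the constant cancels between the two expansions.
  set g : RatFunc ℂ := ∑ p ∈ P, RatFunc.C (residue (f / RatFunc.X) p) * simplePole p with hg
  have hP0 : ∀ p ∈ P, p ≠ 0 := fun p hp h => h0 (h ▸ hp)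
  have cs : ∀ (Φ : RatFunc ℂ →+* LaurentSeries ℂ) (_ : ∀ a, Φ (RatFunc.C a) = HahnSeries.C a)
      (m : ℤ), (Φ g).coeff m
        = ∑ p ∈ P, residue (f / RatFunc.X) p * (Φ (simplePole p)).coeff m := by
    intro Φ hΦ m
    rw [hg, map_sum, HahnSeries.coeff_sum]
    refine Finset.sum_congr rfl fun p _ => ?_
    rw [map_mul, hΦ, HahnSeries.C_mul_eq_smul, HahnSeries.coeff_smul, smul_eq_mul]
  obtain ⟨c, hc⟩ : ∃ c, f - g = RatFunc.C c := by
    apply exists_eq_C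
    · intro a
      apply order_nonneg_of_coeff
      intro m hm
      rw [map_sub, HahnSeries.coeff_sub, cs _ (expand_C a)]
      by_cases ha : a ∈ P
      · rw [Finset.sum_eq_single_of_mem a ha, coeff_expand_simplePole hm]
        · split_ifs with h
          · rw [h, residue_div_X (hP0 a ha) hf (h2 a ha)]
            ring
          · rw [mul_zero, sub_zero]
            exact HahnSeries.coeff_eq_zero_of_lt_order
              (lt_of_lt_of_le (by lia : m < -1) (h2 a ha))
        · intro b hb hba
          rw [coeff_neg_of_order_nonneg (ordAt_simplePole hba.symm) hm, mul_zero]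
      · rw [coeff_neg_of_order_nonneg (h1 a ha) hm, Finset.sum_eq_zero, sub_zero]
        intro b hb
        rw [coeff_neg_of_order_nonneg (ordAt_simplePole (by rintro rfl; exact ha hb)) hm,
          mul_zero]
    · apply order_nonneg_of_coeff
      intro m hm
      rw [map_sub, HahnSeries.coeff_sub, cs _ expandInfty_C, coeff_neg_of_order_nonneg hi hm,
        Finset.sum_eq_zero, sub_zero]
      intro b hb
      rw [coeff_neg_of_order_nonneg (order_expandInfty_simplePole b) hm, mul_zero]
  have hfe : f = RatFunc.C c + g := by rw [← hc]; ring
  have e1 : coeffInfty f k = (if k = 0 then c else 0)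
      + ∑ p ∈ P, residue (f / RatFunc.X) p * coeffInfty (simplePole p) k := by
    conv_lhs => rw [coeffInfty_eq, hfe, map_add, expandInfty_C, HahnSeries.coeff_add,
      cs _ expandInfty_C, HahnSeries.C_apply, HahnSeries.coeff_single]
    simp only [coeffInfty_eq]
    congr
  have e2 : coeffZero f (-k) = (if k = 0 then c else 0)
      + ∑ p ∈ P, residue (f / RatFunc.X) p * coeffZero (simplePole p) (-k) := by
    conv_lhs => rw [coeffZero_eq, hfe, map_add, expand_C, HahnSeries.coeff_add,
      cs _ (expand_C 0), HahnSeries.C_apply, HahnSeries.coeff_single]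
    simp only [neg_eq_zero, coeffZero_eq]
  rw [e1, e2, add_sub_add_left_eq_sub, ← Finset.sum_sub_distrib]
  refine Finset.sum_congr rfl fun p hp => ?_
  rw [← mul_sub, coeff_simplePole (hP0 p hp)]

/-! ### The functions `g_{i,j}` and the weights of boxes -/

/-- The value `g_{i,j}(z, w)`. -/
def gVal (q d : ℂ) (i j : ZMod 2) (z w : ℂ) : ℂ :=
  if i = j then z - q₂ q * w else (z - q₁ q d * w) * (z - q₃ q d * w)

lemma sgn_comm (i j : ZMod 2) : sgn i j = sgn j i := by
  simp [sgn, eq_comm]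

lemma sgn_mul_self (i j : ZMod 2) : sgn i j * sgn i j = 1 := by
  unfold sgn; split_ifs <;> norm_num

lemma sgn_ne_zero (i j : ZMod 2) : sgn i j ≠ 0 := by
  unfold sgn; split_ifs <;> norm_num

/-- An expansion of rational functions into series in `z`, as sequences of coefficients
of `z^{-k}`. -/
structure Expansion where
  coeff : RatFunc ℂ → ℤ → ℂ
  coeff_add : ∀ f g k, coeff (f + g) k = coeff f k + coeff g k
  coeff_C_mul : ∀ a f k, coeff (RatFunc.C a * f) k = a * coeff f k
  coeff_X_mul : ∀ f k, coeff (RatFunc.X * f) k = coeff f (k + 1)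

lemma Expansion.coeff_zero (e : Expansion) (k : ℤ) : e.coeff 0 k = 0 := by
  simpa using e.coeff_C_mul 0 0 k

/-- The expansion at infinity. -/
def expansionInfty : Expansion where
  coeff := coeffInfty
  coeff_add f g k := by simp [coeffInfty_eq]
  coeff_C_mul a f k := by
    rw [coeffInfty_eq, map_mul, expandInfty_C, HahnSeries.C_mul_eq_smul, HahnSeries.coeff_smul,
      smul_eq_mul, coeffInfty_eq]
  coeff_X_mul f k := by
    rw [coeffInfty_eq, map_mul, expandInfty_X, mul_comm, show k = (k + 1) + (-1) by ring,
      HahnSeries.coeff_mul_single_add, mul_one, coeffInfty_eq]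
    congr 1
    ring

/-- The expansion at zero. -/
def expansionZero : Expansion where
  coeff f k := coeffZero f (-k)
  coeff_add f g k := by simp [coeffZero_eq]
  coeff_C_mul a f k := by
    rw [coeffZero_eq, map_mul, expand_C, HahnSeries.C_mul_eq_smul, HahnSeries.coeff_smul,
      smul_eq_mul, coeffZero_eq]
  coeff_X_mul f k := by
    rw [coeffZero_eq, map_mul, expand_X, map_zero, add_zero, mul_comm,
      show -k = -(k + 1) + 1 by ring, HahnSeries.coeff_mul_single_add, mul_one, coeffZero_eq]

section

variable {q d : ℂ}

lemma q₁_ne_zero (hq : q ≠ 0) (hd : d ≠ 0) : q₁ q d ≠ 0 := mul_ne_zero (inv_ne_zero hq) hd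

lemma q₂_ne_zero (hq : q ≠ 0) : q₂ q ≠ 0 := pow_ne_zero 2 hq

lemma q₃_ne_zero (hq : q ≠ 0) (hd : d ≠ 0) : q₃ q d ≠ 0 :=
  mul_ne_zero (inv_ne_zero hq) (inv_ne_zero hd)

lemma q₁_mul_q₂_mul_q₃ (hq : q ≠ 0) (hd : d ≠ 0) : q₁ q d * q₂ q * q₃ q d = 1 := by
  unfold q₁ q₂ q₃; field_simp

lemma rootA_ne_zero (hq : q ≠ 0) (hd : d ≠ 0) (i j : ZMod 2) (a : ℂ) : rootA q d i a j ≠ 0 := by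
  unfold rootA
  split_ifs
  · exact div_ne_zero (linear_ne_zero (q₂_ne_zero hq) a) (X_sub_C_ne_zero _)
  · exact div_ne_zero (mul_ne_zero (linear_ne_zero (q₁_ne_zero hq hd) a)
      (linear_ne_zero (q₃_ne_zero hq hd) a)) (mul_ne_zero (X_sub_C_ne_zero _) (X_sub_C_ne_zero _))

/-- The relation between `K_i(z)` and a current whose action multiplies the weight by
`A_{j,a}(z)^{-1}`. -/
lemma expansion_quadF (hq : q ≠ 0) (hd : d ≠ 0) (e : Expansion) (i j : ZMod 2) (a : ℂ)
    (φ : RatFunc ℂ) (k : ℤ) :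
    (if i = j then
      a * e.coeff (φ * (rootA q d j a i)⁻¹) k - q₂ q * e.coeff (φ * (rootA q d j a i)⁻¹) (k + 1)
        + (e.coeff φ (k + 1) - q₂ q * a * e.coeff φ k)
    else -(a ^ 2 * e.coeff (φ * (rootA q d j a i)⁻¹) k
        - (q₁ q d + q₃ q d) * a * e.coeff (φ * (rootA q d j a i)⁻¹) (k + 1)
        + q₁ q d * q₃ q d * e.coeff (φ * (rootA q d j a i)⁻¹) (k + 2))
        + (e.coeff φ (k + 2) - (q₁ q d + q₃ q d) * a * e.coeff φ (k + 1)
          + q₁ q d * q₃ q d * a ^ 2 * e.coeff φ k)) = 0 := by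
  set W := (rootA q d j a i)⁻¹ with hW
  have hX2 : ∀ f k, e.coeff f (k + 2) = e.coeff (RatFunc.X * (RatFunc.X * f)) k := by
    intro f k
    rw [e.coeff_X_mul, e.coeff_X_mul, add_assoc]
    rfl
  split_ifs with h
  -- Clearing the denominator of W gives an identity of rational functions that is linear with
  -- polynomial coefficients in z. Taking coefficients uses only the rules of `Expansion`, so one
  -- argument serves both at infinity and at zero.
  · have key : RatFunc.C a * (φ * W) + (RatFunc.C (-q₂ q) * (RatFunc.X * (φ * W))
        + (RatFunc.X * φ + RatFunc.C (-(q₂ q * a)) * φ)) = 0 := by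
      have hWD : W * (RatFunc.C (q₂ q) * RatFunc.X - RatFunc.C a)
          = RatFunc.X - RatFunc.C (q₂ q * a) := by
        rw [hW, rootA, if_pos h.symm, inv_div,
          div_mul_cancel₀ _ (linear_ne_zero (q₂_ne_zero hq) a)]
      simp only [map_neg, map_mul] at hWD ⊢
      linear_combination (-φ) * hWD
    have := congrArg (fun f => e.coeff f k) key
    simp only [e.coeff_add, e.coeff_C_mul, e.coeff_X_mul, e.coeff_zero] at this
    linear_combination this
  · have key : RatFunc.C (-a ^ 2) * (φ * W)
        + (RatFunc.C ((q₁ q d + q₃ q d) * a) * (RatFunc.X * (φ * W))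
        + (RatFunc.C (-(q₁ q d * q₃ q d)) * (RatFunc.X * (RatFunc.X * (φ * W)))
        + (RatFunc.X * (RatFunc.X * φ) + (RatFunc.C (-((q₁ q d + q₃ q d) * a)) * (RatFunc.X * φ)
          + RatFunc.C (q₁ q d * q₃ q d * a ^ 2) * φ)))) = 0 := by
      have hWD : W * ((RatFunc.C (q₁ q d) * RatFunc.X - RatFunc.C a) *
          (RatFunc.C (q₃ q d) * RatFunc.X - RatFunc.C a))
          = (RatFunc.X - RatFunc.C (q₁ q d * a)) * (RatFunc.X - RatFunc.C (q₃ q d * a)) := by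
        rw [hW, rootA, if_neg (Ne.symm h), inv_div, div_mul_cancel₀ _
          (mul_ne_zero (linear_ne_zero (q₁_ne_zero hq hd) a) (linear_ne_zero (q₃_ne_zero hq hd) a))]
      simp only [map_neg, map_mul, map_add, map_pow] at hWD ⊢
      linear_combination (-φ) * hWD
    have := congrArg (fun f => e.coeff f k) key
    simp only [e.coeff_add, e.coeff_C_mul, ← hX2, e.coeff_X_mul, e.coeff_zero] at this
    linear_combination this

lemma ordAt_rootA_inv (hq : q ≠ 0) (hd : d ≠ 0) (i j : ZMod 2) (a p : ℂ) :
    ordAt p (rootA q d i a j)⁻¹ =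
      if i = j then (if p = q₂ q * a then 1 else 0) - (if q₂ q * p = a then 1 else 0)
      else (if p = q₁ q d * a then 1 else 0) + (if p = q₃ q d * a then 1 else 0)
        - ((if q₁ q d * p = a then 1 else 0) + (if q₃ q d * p = a then 1 else 0)) := by
  rw [ordAt, order_hom_inv]
  have h1 := linear_ne_zero (q₁_ne_zero hq hd) a
  have h2 := linear_ne_zero (q₂_ne_zero hq) a
  have h3 := linear_ne_zero (q₃_ne_zero hq hd) a
  have o1 := (order_leading_linear p (q₁_ne_zero hq hd) a).1
  have o2 := (order_leading_linear p (q₂_ne_zero hq) a).1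
  have o3 := (order_leading_linear p (q₃_ne_zero hq hd) a).1
  have o := fun a => (order_leading_X_sub_C p a).1
  unfold ordAt at o o1 o2 o3
  by_cases h : i = j
  · rw [rootA, if_pos h, if_pos h, order_hom_div _ h2 (X_sub_C_ne_zero _), o, o2]
    ring
  · rw [rootA, if_neg h, if_neg h, order_hom_div _ (mul_ne_zero h1 h3)
      (mul_ne_zero (X_sub_C_ne_zero _) (X_sub_C_ne_zero _)), order_hom_mul _ h1 h3,
      order_hom_mul _ (X_sub_C_ne_zero _) (X_sub_C_ne_zero _), o, o, o1, o3]
    ring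

/-- The link between weights and relations: the factor gained by passing one box across another is
the structure function of the quadratic relations. -/
lemma leadAt_rootA_inv (hq : q ≠ 0) (hd : d ≠ 0) {i j : ZMod 2} {a p : ℂ}
    (h1 : gVal q d j i p a ≠ 0) (h2 : gVal q d i j a p ≠ 0) :
    leadAt p (rootA q d i a j)⁻¹ = gVal q d j i p a / (-sgn i j * gVal q d i j a p) := by
  have l1 := (order_leading_linear p (q₁_ne_zero hq hd) a).2
  have l2 := (order_leading_linear p (q₂_ne_zero hq) a).2
  have l3 := (order_leading_linear p (q₃_ne_zero hq hd) a).2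
  have l := fun a => (order_leading_X_sub_C p a).2
  rw [map_inv₀]
  unfold gVal sgn at *
  by_cases h : i = j
  · simp only [h, if_true] at *
    rw [rootA, if_pos rfl, map_div₀, l2, l, if_neg (fun e => h2 (by rw [e, sub_self])),
      if_neg (fun e => h1 (by rw [e, sub_self])), inv_div]
    congr 1
    ring
  · simp only [if_neg h, if_neg (Ne.symm h), mul_ne_zero_iff] at h1 h2 ⊢
    rw [rootA, if_neg h, map_div₀, map_mul, map_mul, l1, l3, l, l,
      if_neg (fun e => h2.1 (by rw [e, sub_self])), if_neg (fun e => h2.2 (by rw [e, sub_self])),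
      if_neg (fun e => h1.1 (by rw [e, sub_self])), if_neg (fun e => h1.2 (by rw [e, sub_self])),
      inv_div]
    congr 1
    ring

lemma ordAt_rootA_inv_of_ne (hq : q ≠ 0) (hd : d ≠ 0) {i j : ZMod 2} {a p : ℂ}
    (h1 : gVal q d j i p a ≠ 0) (h2 : gVal q d i j a p ≠ 0) :
    ordAt p (rootA q d i a j)⁻¹ = 0 := by
  rw [ordAt_rootA_inv hq hd]
  unfold gVal at h1 h2
  by_cases h : i = j
  · simp only [h, if_true] at *
    rw [if_neg (fun e => h1 (by rw [e, sub_self])), if_neg (fun e => h2 (by rw [e, sub_self])),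
      sub_zero]
  · simp only [if_neg h, if_neg (Ne.symm h), mul_ne_zero_iff] at h1 h2 ⊢
    rw [if_neg (fun e => h1.1 (by rw [e, sub_self])), if_neg (fun e => h1.2 (by rw [e, sub_self])),
      if_neg (fun e => h2.1 (by rw [e, sub_self])), if_neg (fun e => h2.2 (by rw [e, sub_self]))]
    simp

/-- The value is (a - q₂a)/(q₂a - a). This -1 accounts for the minus sign of the second term of the
commutator of `E` and `F` when a box is removed and put back. -/
lemma ordAt_leadAt_rootA_inv_self (hq : q ≠ 0) (hd : d ≠ 0) (h2 : q₂ q ≠ 1) (i : ZMod 2) {a : ℂ}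
    (ha : a ≠ 0) : ordAt a (rootA q d i a i)⁻¹ = 0 ∧ leadAt a (rootA q d i a i)⁻¹ = -1 := by
  have h : gVal q d i i a a ≠ 0 := by
    rw [gVal, if_pos rfl, ← one_sub_mul]
    exact mul_ne_zero (sub_ne_zero.2 h2.symm) ha
  refine ⟨ordAt_rootA_inv_of_ne hq hd h h, ?_⟩
  rw [leadAt_rootA_inv hq hd h h, sgn, if_pos rfl]
  field_simp

lemma order_rootA_inv_infty (hq : q ≠ 0) (hd : d ≠ 0) (i j : ZMod 2) (a : ℂ) :
    (expandInfty (rootA q d i a j)⁻¹).order = 0 ∧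
    lead expandInfty (rootA q d i a j)⁻¹ = if i = j then (q₂ q)⁻¹ else (q₁ q d * q₃ q d)⁻¹ := by
  have h1 := linear_ne_zero (q₁_ne_zero hq hd) a
  have h2 := linear_ne_zero (q₂_ne_zero hq) a
  have h3 := linear_ne_zero (q₃_ne_zero hq hd) a
  have o1 := order_leading_linear_infty (q₁_ne_zero hq hd) a
  have o2 := order_leading_linear_infty (q₂_ne_zero hq) a
  have o3 := order_leading_linear_infty (q₃_ne_zero hq hd) a
  have o := fun a => order_leading_linear_infty one_ne_zero a
  simp only [RatFunc.C.map_one, one_mul] at o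
  rw [order_hom_inv, map_inv₀, rootA]
  split_ifs with h
  · rw [order_hom_div _ h2 (X_sub_C_ne_zero _), map_div₀, (o _).1, (o _).2, o2.1, o2.2]
    simp
  · rw [order_hom_div _ (mul_ne_zero h1 h3)
      (mul_ne_zero (X_sub_C_ne_zero _) (X_sub_C_ne_zero _)), order_hom_mul _ h1 h3,
      order_hom_mul _ (X_sub_C_ne_zero _) (X_sub_C_ne_zero _), map_div₀, (lead _).map_mul,
      (lead _).map_mul, (o _).1, (o _).2, (o _).1, (o _).2, o1.1, o1.2, o3.1, o3.2]
    simp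

lemma order_rootA_inv_zero (hq : q ≠ 0) (hd : d ≠ 0) (i j : ZMod 2) {a : ℂ} (ha : a ≠ 0) :
    ordAt 0 (rootA q d i a j)⁻¹ = 0 ∧
    leadAt 0 (rootA q d i a j)⁻¹ = if i = j then q₂ q else q₁ q d * q₃ q d := by
  have e1 := q₁_ne_zero hq hd
  have e2 := q₂_ne_zero hq
  have e3 := q₃_ne_zero hq hd
  have hne : ∀ i j, gVal q d i j 0 a ≠ 0 := by
    intro i j
    unfold gVal
    split_ifs <;> simp [ha, e1, e2, e3]
  have hne' : ∀ i j, gVal q d i j a 0 ≠ 0 := by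
    intro i j
    unfold gVal
    split_ifs <;> simp [ha]
  refine ⟨ordAt_rootA_inv_of_ne hq hd (hne _ _) (hne' _ _), ?_⟩
  rw [leadAt_rootA_inv hq hd (hne _ _) (hne' _ _)]
  unfold gVal sgn
  by_cases h : i = j
  · simp only [h, if_true]
    simp
    field_simp
  · simp only [h, Ne.symm h, if_false]
    simp
    field_simp

end

/-! ### Raising operators on states -/

section PairProd

variable {B : Type}

/-- The product of `f u x` over the pairs where `u` stands to the right of `x`. -/
def pairProd (f : B → B → ℂ) : List B → ℂ
  | [] => 1
  | x :: L => (L.map fun u => f u x).prod * pairProd f L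

/-- Applied to the symmetric normalization `N`, this makes the normalizing factor independent of the
order in which boxes are added. -/
lemma pairProd_perm {f : B → B → ℂ} (hf : ∀ u x, f u x = f x u) {L L' : List B}
    (h : L.Perm L') : pairProd f L = pairProd f L' := by
  induction h with
  | nil => rfl
  | cons x h ih => rw [pairProd, pairProd, ih, (h.map _).prod_eq]
  | swap x y L =>
    simp only [pairProd, List.map_cons, List.prod_cons]
    rw [hf x y]
    ring
  | trans _ _ ih1 ih2 => rw [ih1, ih2]

lemma pairProd_ne_zero {f : B → B → ℂ} {L : List B}
    (hf : L.Pairwise fun x u => f u x ≠ 0) : pairProd f L ≠ 0 := by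
  induction hf with
  | nil => exact one_ne_zero
  | cons h _ ih =>
    refine mul_ne_zero ?_ ih
    rw [ne_eq, List.prod_eq_zero_iff, List.mem_map]
    rintro ⟨u, hu, h0⟩
    exact h u hu h0

end PairProd

section Raising

variable {B : Type} [LinearOrder B] (S : Set (Finset B))

open Classical in
/-- The operator adding the box `b`, with coefficients `α`. -/
def up (α : Finset B → B → ℂ) (b : B) : Module.End ℂ (S →₀ ℂ) :=
  Finsupp.linearCombination ℂ fun s : S =>
    if h : b ∉ s.1 ∧ insert b s.1 ∈ S then Finsupp.single ⟨insert b s.1, h.2⟩ (α s.1 b) else 0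

variable {S}

lemma up_of_mem (α : Finset B → B → ℂ) {b : B} {s : Finset B} (hs : s ∈ S) (hb : b ∉ s)
    (h : insert b s ∈ S) :
    up S α b (Finsupp.single ⟨s, hs⟩ 1) = α s b • Finsupp.single ⟨insert b s, h⟩ 1 := by
  rw [up, Finsupp.linearCombination_single, one_smul, dif_pos ⟨hb, h⟩, Finsupp.smul_single,
    smul_eq_mul, mul_one]

lemma up_of_not (α : Finset B → B → ℂ) {b : B} {s : Finset B} (hs : s ∈ S)
    (h : ¬(b ∉ s ∧ insert b s ∈ S)) : up S α b (Finsupp.single ⟨s, hs⟩ 1) = 0 := by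
  rw [up, Finsupp.linearCombination_single, one_smul, dif_neg h]

lemma mem_foldr_insert (L : List B) (s : Finset B) (y : B) :
    y ∈ L.foldr insert s ↔ y ∈ L ∨ y ∈ s := by
  induction L with
  | nil => simp
  | cons a L ih => simp [ih, or_assoc]

/-- The hypothesis mentions only the final set and not the intermediate ones, so it is invariant
under permutations of the list. -/
lemma up_list_eq_zero (α : Finset B → B → ℂ) {s : Finset B} (hs : s ∈ S) (L : List B)
    (h : ¬(L.Nodup ∧ (∀ x ∈ L, x ∉ s) ∧ L.foldr insert s ∈ S)) :
    (L.map (up S α)).prod (Finsupp.single ⟨s, hs⟩ 1) = 0 := by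
  -- Either some step is not allowed and the product vanishes, or every step was allowed and the
  -- result is a multiple of the expected basis vector.
  have main : ∀ L : List B, (L.map (up S α)).prod (Finsupp.single ⟨s, hs⟩ 1) = 0 ∨
      ∃ h : L.Nodup ∧ (∀ x ∈ L, x ∉ s) ∧ L.foldr insert s ∈ S, ∃ c : ℂ,
        (L.map (up S α)).prod (Finsupp.single ⟨s, hs⟩ 1) =
          c • Finsupp.single ⟨L.foldr insert s, h.2.2⟩ 1 := by
    intro L
    induction L with
    | nil => exact Or.inr ⟨⟨List.nodup_nil, by simp, hs⟩, 1, by simp⟩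
    | cons x L ih =>
      rw [List.map_cons, List.prod_cons, Module.End.mul_apply]
      rcases ih with ih | ⟨h, c, ih⟩
      · left; rw [ih, map_zero]
      · rw [ih, map_smul]
        by_cases hx : x ∉ L.foldr insert s ∧ insert x (L.foldr insert s) ∈ S
        · right
          rw [mem_foldr_insert, not_or] at hx
          refine ⟨⟨List.nodup_cons.2 ⟨hx.1.1, h.1⟩, ?_, hx.2⟩, c * α (L.foldr insert s) x, ?_⟩
          · intro y hy
            rcases List.mem_cons.1 hy with rfl | hy
            · exact hx.1.2
            · exact h.2.1 y hy
          · rw [up_of_mem α h.2.2 (by rw [mem_foldr_insert, not_or]; exact hx.1) hx.2, smul_smul]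
            rfl
        · left
          rw [up_of_not α h.2.2 hx, smul_zero]
  rcases main L with h' | ⟨h', -⟩
  · exact h'
  · exact absurd h' h

variable (S)

/-- Boxes with colors, positions and a relation `pred` such that the states are the sets closed
under `pred`, where the zeros of the functions `g_{i,j}` come from neighbouring boxes. -/
structure Frame (q d : ℂ) where
  col : B → ZMod 2
  pos : B → ℂ
  pred : B → B → Prop
  diag : B → B → Prop
  mem_iff : ∀ s, s ∈ S ↔ ∀ b ∈ s, ∀ a, pred a b → a ∈ s
  pos_ne_zero : ∀ b, pos b ≠ 0
  pred_lt : ∀ {a b}, pred a b → a < b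
  gVal_of_pred : ∀ {a b}, pred a b → gVal q d (col a) (col b) (pos a) (pos b) = 0
  of_gVal : ∀ {a b}, a ≠ b → gVal q d (col a) (col b) (pos a) (pos b) = 0 → pred a b ∨ diag b a
  diag_col : ∀ {a b}, diag a b → col a ≠ col b
  -- If a diagonal pair is added to a state and the result is a state, both boxes between them must
  -- be added too. There is one of each color, which is too many for the words in the quadratic and
  -- Serre relations.
  diag_between : ∀ {a b}, diag a b → ∃ c c', col c = col b ∧ pred a c ∧ pred c b ∧
    col c' = col a ∧ pred a c' ∧ pred c' b

variable {S} {q d : ℂ}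

namespace Frame

variable (fr : Frame S q d)

/-- The factor `g` for the box `u` added before the box `x`. -/
def G (u x : B) : ℂ := gVal q d (fr.col x) (fr.col u) (fr.pos x) (fr.pos u)

lemma inter_mem (fr : Frame S q d) {s t : Finset B} (hs : s ∈ S) (ht : t ∈ S) : s ∩ t ∈ S := by
  rw [fr.mem_iff] at hs ht ⊢
  intro b hb a hab
  rw [Finset.mem_inter] at hb ⊢
  exact ⟨hs b hb.1 a hab, ht b hb.2 a hab⟩

lemma union_mem (fr : Frame S q d) {s t : Finset B} (hs : s ∈ S) (ht : t ∈ S) : s ∪ t ∈ S := by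
  rw [fr.mem_iff] at hs ht ⊢
  intro b hb a hab
  rw [Finset.mem_union] at hb ⊢
  exact hb.imp (fun h => hs b h a hab) (fun h => ht b h a hab)

/-- Multiplicative behaviour of the coefficients of a family of raising operators. -/
structure Raising (α : Finset B → B → ℂ) where
  -- The number `ρ u x` is the change of the coefficient of x caused by an earlier box u. Multiplied
  -- by the symmetric `N` it becomes the function g up to the sign `ε`, which is antisymmetric for
  -- equal colors and symmetric for different ones. The identity is not required when x precedes u,
  -- because x is then never added after u.
  ρ : B → B → ℂ
  ε : B → B → ℂ
  N : B → B → ℂ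
  insert_eq : ∀ {s u x}, u ∉ s → x ∉ s → u ≠ x → α (insert u s) x = α s x * ρ u x
  N_comm : ∀ u x, N u x = N x u
  N_ne_zero : ∀ {u x}, u ≠ x → ¬fr.diag u x → ¬fr.diag x u → N u x ≠ 0
  N_mul : ∀ {u x}, u ≠ x → ¬fr.diag u x → ¬fr.diag x u → ¬fr.pred x u →
    N u x * ρ u x = ε u x * fr.G u x
  ε_comm : ∀ {u x}, u ≠ x → ε x u = -sgn (fr.col u) (fr.col x) * ε u x

variable {fr} {α : Finset B → B → ℂ}

lemma Raising.foldr_eq (R : fr.Raising α) {s : Finset B} {x : B} {L : List B}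
    (hn : (x :: L).Nodup) (hd : ∀ y ∈ x :: L, y ∉ s) :
    α (L.foldr insert s) x = α s x * (L.map fun u => R.ρ u x).prod := by
  induction L with
  | nil => simp
  | cons u L ih =>
    simp only [List.nodup_cons, List.mem_cons, not_or, forall_eq_or_imp] at hn hd ih
    rw [List.foldr_cons, R.insert_eq, ih]
    · simp only [List.map_cons, List.prod_cons]
      ring
    · exact ⟨hn.1.2, hn.2.2⟩
    · exact ⟨hd.1, hd.2.2⟩
    · rw [mem_foldr_insert, not_or]
      exact ⟨hn.2.1, hd.2.1⟩
    · rw [mem_foldr_insert, not_or]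
      exact ⟨hn.1.2, hd.1⟩
    · exact Ne.symm hn.1.1

/-- The action of a product of raising operators. -/
theorem Raising.up_list (R : fr.Raising α) {s : Finset B} (hs : s ∈ S) {L : List B}
    (hn : L.Nodup) (hd : ∀ y ∈ L, y ∉ s) (hg : ∀ u ∈ L, ∀ x ∈ L, ¬fr.diag u x)
    (h : L.foldr insert s ∈ S) :
    pairProd R.N L • (L.map (up S α)).prod (Finsupp.single ⟨s, hs⟩ 1) =
      ((L.map (α s)).prod * pairProd (fun u x => R.ε u x * fr.G u x) L) •
        Finsupp.single ⟨L.foldr insert s, h⟩ 1 := by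
  induction L with
  | nil => simp [pairProd]
  | cons x L ih =>
    have hn' := List.nodup_cons.1 hn
    have hd' : ∀ y ∈ L, y ∉ s := fun y hy => hd y (List.mem_cons_of_mem _ hy)
    have hx : x ∉ L.foldr insert s := by
      rw [mem_foldr_insert, not_or]
      exact ⟨hn'.1, hd x List.mem_cons_self⟩
    rw [List.map_cons, List.prod_cons, Module.End.mul_apply, pairProd, pairProd]
    by_cases ht : L.foldr insert s ∈ S
    · have ih' := ih hn'.2 hd' (fun u hu y hy => hg u (List.mem_cons_of_mem _ hu) y
        (List.mem_cons_of_mem _ hy)) ht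
      -- A box u already present in a state cannot have x as a missing predecessor, so the identity
      -- for `N` and `ρ` is available for every pair.
      have hN : (L.map fun u => R.N u x).prod * (L.map fun u => R.ρ u x).prod
          = (L.map fun u => R.ε u x * fr.G u x).prod := by
        rw [← List.prod_map_mul]
        congr 1
        apply List.map_congr_left
        intro u hu
        have hux : u ≠ x := fun e => hn'.1 (e ▸ hu)
        refine R.N_mul hux (hg _ (List.mem_cons_of_mem _ hu) _ List.mem_cons_self)
          (hg _ List.mem_cons_self _ (List.mem_cons_of_mem _ hu)) fun hp => hx ?_
        exact (fr.mem_iff _).1 ht u ((mem_foldr_insert _ _ _).2 (Or.inl hu)) x hp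
      rw [← smul_smul, ← map_smul, ih', map_smul, up_of_mem α ht hx h, R.foldr_eq hn hd, ← hN,
        smul_smul, smul_smul]
      congr 1
      simp only [List.map_cons, List.prod_cons]
      ring
    · rw [up_list_eq_zero α hs L (fun h' => ht h'.2.2), map_zero, smul_zero]
      -- The set before the last step is not a state, so the left side vanishes. The box it lacks is
      -- the last one added, a predecessor of some b in the list, and the factor g of this pair
      -- makes the right side vanish as well.
      obtain ⟨b, hb, a, hab, ha⟩ : ∃ b ∈ L.foldr insert s, ∃ a, fr.pred a b ∧
          a ∉ L.foldr insert s := by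
        by_contra hc
        push Not at hc
        exact ht ((fr.mem_iff _).2 hc)
      have h1 : a ∈ insert x (L.foldr insert s) :=
        (fr.mem_iff _).1 h b (Finset.mem_insert_of_mem hb) a hab
      have hax : a = x := (Finset.mem_insert.1 h1).resolve_right ha
      subst hax
      have hbL : b ∈ L := by
        refine ((mem_foldr_insert _ _ _).1 hb).resolve_right fun hbs => ?_
        exact hd a List.mem_cons_self ((fr.mem_iff _).1 hs b hbs a hab)
      have hz : (L.map fun u => R.ε u a * fr.G u a).prod = 0 := by
        rw [List.prod_eq_zero_iff, List.mem_map]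
        exact ⟨b, hbL, by rw [G, fr.gVal_of_pred hab, mul_zero]⟩
      rw [hz]
      simp

lemma foldr_insert_perm {L L' : List B} (h : L.Perm L') (s : Finset B) :
    L.foldr insert s = L'.foldr insert s := by
  ext y
  rw [mem_foldr_insert, mem_foldr_insert, h.mem_iff]

/-- For a list of boxes without diagonal pairs, the products in all orders are determined by the
functions `g`. -/
lemma Raising.up_perm (R : fr.Raising α) {s : Finset B} (hs : s ∈ S) {L₀ : List B}
    (hn : L₀.Nodup) (hd : ∀ y ∈ L₀, y ∉ s) (hg : ∀ u ∈ L₀, ∀ x ∈ L₀, ¬fr.diag u x)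
    (h : L₀.foldr insert s ∈ S) : ∃ v : S →₀ ℂ, ∀ L : List B, L.Perm L₀ →
      (L.map (up S α)).prod (Finsupp.single ⟨s, hs⟩ 1) =
        pairProd (fun u x => R.ε u x * fr.G u x) L • v := by
  -- All parts of the coefficient that do not depend on the order are collected in the vector.
  -- Without diagonal pairs the product of the `N` is invertible.
  refine ⟨((pairProd R.N L₀)⁻¹ * (L₀.map (α s)).prod) • Finsupp.single ⟨L₀.foldr insert s, h⟩ 1,
    fun L hL => ?_⟩
  have hN : pairProd R.N L₀ ≠ 0 := by
    apply pairProd_ne_zero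
    refine hn.imp_of_mem ?_
    intro u x hu hx hux
    exact R.N_ne_zero hux.symm (hg _ hx _ hu) (hg _ hu _ hx)
  have key := R.up_list hs (hL.nodup_iff.2 hn) (fun y hy => hd y (hL.mem_iff.1 hy))
    (fun u hu x hx => hg u (hL.mem_iff.1 hu) x (hL.mem_iff.1 hx))
    (by rwa [foldr_insert_perm hL])
  rw [pairProd_perm R.N_comm hL, (hL.map (α s)).prod_eq] at key
  have e : (⟨L.foldr insert s, by rwa [foldr_insert_perm hL]⟩ : S) = ⟨L₀.foldr insert s, h⟩ :=
    Subtype.ext (foldr_insert_perm hL s)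
  rw [e] at key
  rw [← inv_smul_smul₀ hN ((L.map (up S α)).prod _), key, smul_smul, smul_smul]
  congr 1
  ring

/-- The quadratic relation between raising operators. -/
theorem Raising.up_up (R : fr.Raising α) (x y : B) :
    (sgn (fr.col x) (fr.col y) * gVal q d (fr.col y) (fr.col x) (fr.pos y) (fr.pos x)) •
        (up S α x * up S α y)
      + gVal q d (fr.col x) (fr.col y) (fr.pos x) (fr.pos y) • (up S α y * up S α x) = 0 := by
  refine Finsupp.lhom_ext' fun ⟨s, hs⟩ => LinearMap.ext_ring ?_
  have e : ∀ a b : B, up S α a * up S α b = ([a, b].map (up S α)).prod := by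
    intro a b; simp
  have hp : [y, x].Perm [x, y] := List.Perm.swap _ _ _
  simp only [LinearMap.comp_apply, Finsupp.lsingle_apply, LinearMap.add_apply,
    LinearMap.smul_apply, LinearMap.zero_apply, e]
  by_cases h : [x, y].Nodup ∧ (∀ z ∈ [x, y], z ∉ s) ∧ [x, y].foldr insert s ∈ S
  -- A box strictly between u and z would have to be one of the two or belong to s, and in the
  -- latter case u would belong to s.
  · have hg1 : ∀ u ∈ [x, y], ∀ z ∈ [x, y], ¬fr.diag u z := by
      intro u hu z hz hdg
      obtain ⟨c, c', h1, h2, h3, h4, h5, h6⟩ := fr.diag_between hdg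
      have hc := (fr.mem_iff _).1 h.2.2 z ((mem_foldr_insert _ _ _).2 (Or.inl hz)) c h3
      have huc := fr.pred_lt h2
      have hcz := fr.pred_lt h3
      rcases (mem_foldr_insert _ _ _).1 hc with hc | hc
      · have huz : u ≠ z := (huc.trans hcz).ne
        simp only [List.mem_cons, List.not_mem_nil, or_false] at hu hz hc
        rcases hc with rfl | rfl <;> rcases hu with rfl | rfl <;> rcases hz with rfl | rfl <;>
          simp_all
      · exact h.2.1 u hu ((fr.mem_iff _).1 hs c hc u h2)
    obtain ⟨v, hv⟩ := R.up_perm hs h.1 h.2.1 hg1 h.2.2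
    have hxy : x ≠ y := by simpa using h.1
    rw [hv _ (List.Perm.refl _), hv _ hp]
    simp only [pairProd, List.map_cons, List.map_nil, List.prod_cons, List.prod_nil, mul_one, G]
    -- Both orders now carry the same product of two functions g, and the sign rule for `ε` makes
    -- them cancel.
    rw [R.ε_comm hxy, smul_smul, smul_smul, ← add_smul]
    convert zero_smul ℂ v using 2
    linear_combination (-(gVal q d (fr.col y) (fr.col x) (fr.pos y) (fr.pos x) * R.ε x y *
      gVal q d (fr.col x) (fr.col y) (fr.pos x) (fr.pos y))) *
      sgn_mul_self (fr.col x) (fr.col y)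
  · rw [up_list_eq_zero α hs _ h, up_list_eq_zero α hs _ (fun h' => h ⟨hp.nodup_iff.1 h'.1,
      fun z hz => h'.2.1 z (hp.mem_iff.2 hz), by rw [← foldr_insert_perm hp]; exact h'.2.2⟩)]
    simp

end Frame

end Raising

/-! ### Serre relations -/

lemma sum_perm_fin_three {M : Type*} [AddCommMonoid M] (f : Fin 3 → Fin 3 → Fin 3 → M) :
    ∑ π : Equiv.Perm (Fin 3), f (π 0) (π 1) (π 2) =
      f 0 1 2 + f 0 2 1 + f 1 0 2 + f 1 2 0 + f 2 0 1 + f 2 1 0 := by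
  have h : (Finset.univ : Finset (Equiv.Perm (Fin 3))) =
      {1, Equiv.swap 1 2, Equiv.swap 0 1, Equiv.swap 0 1 * Equiv.swap 1 2,
        Equiv.swap 0 2 * Equiv.swap 1 2, Equiv.swap 0 2} := by decide
  rw [h, Finset.sum_insert (by decide), Finset.sum_insert (by decide),
    Finset.sum_insert (by decide), Finset.sum_insert (by decide), Finset.sum_insert (by decide),
    Finset.sum_singleton]
  simp only [add_assoc]
  rfl

section

variable {A : Type} [Ring A] [Algebra ℂ A]

/-- `a b c y - [3] a b y c + [3] a y b c - y a b c`. -/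
def serreWord (t : ℂ) (a b c y : A) : A :=
  a * b * c * y - t • (a * b * y * c) + t • (a * y * b * c) - y * a * b * c

/-- The symmetrization of `serreWord`. -/
def serreSum (t : ℂ) (a b c y : A) : A :=
  serreWord t a b c y + serreWord t a c b y + serreWord t b a c y + serreWord t b c a y
    + serreWord t c a b y + serreWord t c b a y

/-- After symmetrization only the place of Y in the word matters. Each of the two inner places
collects the weights q², 1 and q⁻², whose sum is the quantum integer [3]. -/
lemma serre_eq {q : ℂ} (hq : q ≠ 0) (X Y : ℤ → A) (k : Fin 3 → ℤ) (l : ℤ) :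
    serre q X Y k l = (1 / 6 : ℂ) •
      serreSum (q ^ 2 + 1 + (q ^ 2)⁻¹) (X (k 0)) (X (k 1)) (X (k 2)) (Y l) := by
  rw [serre, sum_perm_fin_three (fun a b c =>
    brk ((q ^ 2)⁻¹) (X (k a)) (brk 1 (X (k b)) (brk (q ^ 2) (X (k c)) (Y l))))]
  congr 1
  generalize X (k 0) = a
  generalize X (k 1) = b
  generalize X (k 2) = c
  generalize Y l = y
  have hp : (q ^ 2)⁻¹ * q ^ 2 = 1 := inv_mul_cancel₀ (pow_ne_zero 2 hq)
  generalize (q ^ 2)⁻¹ = p' at *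
  generalize q ^ 2 = p at *
  simp only [brk, serreSum, serreWord, mul_sub, sub_mul, mul_smul_comm, smul_mul_assoc, smul_sub,
    smul_smul, mul_assoc, hp, one_smul, one_mul, add_smul]
  abel

/-- `serreWord` with the factors in the opposite order. -/
def serreWordRev (t : ℂ) (a b c y : A) : A :=
  y * (c * (b * a)) - t • (c * (y * (b * a))) + t • (c * (b * (y * a))) - c * (b * (a * y))

/-- Reversing a Serre word gives minus a Serre word with a and c exchanged, so transposition
preserves the vanishing of the symmetrized sum. -/
lemma serreSum_reverse (t : ℂ) (a b c y : A) :
    serreWordRev t a b c y + serreWordRev t a c b y + serreWordRev t b a c y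
      + serreWordRev t b c a y + serreWordRev t c a b y + serreWordRev t c b a y
      = (-1 : ℂ) • serreSum t a b c y := by
  simp only [serreSum, serreWord, serreWordRev, mul_assoc, neg_smul, one_smul]
  abel

/-- With this, additivity in the first argument gives additivity in each of the first three. -/
lemma serreSum_rotate (t : ℂ) (a b c y : A) : serreSum t a b c y = serreSum t b c a y := by
  unfold serreSum; abel

lemma serreSum_add (t : ℂ) (a a' b c y : A) :
    serreSum t (a + a') b c y = serreSum t a b c y + serreSum t a' b c y := by
  simp only [serreSum, serreWord, mul_add, add_mul, smul_add]
  abel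

lemma serreSum_add_right (t : ℂ) (a b c y y' : A) :
    serreSum t a b c (y + y') = serreSum t a b c y + serreSum t a b c y' := by
  simp only [serreSum, serreWord, mul_add, add_mul, smul_add]
  abel

lemma serreSum_zero (t : ℂ) (b c y : A) : serreSum t 0 b c y = 0 := by
  simp [serreSum, serreWord]

lemma serreSum_zero_right (t : ℂ) (a b c : A) : serreSum t a b c 0 = 0 := by
  simp [serreSum, serreWord]

lemma serreSum_smul (t r₁ r₂ r₃ r : ℂ) (a b c y : A) :
    serreSum t (r₁ • a) (r₂ • b) (r₃ • c) (r • y) = (r₁ * r₂ * r₃ * r) • serreSum t a b c y := by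
  simp only [serreSum, serreWord, mul_smul_comm, smul_mul_assoc, smul_smul, smul_add, smul_sub]
  ring_nf

lemma serreSum_sum {ι : Type} (t : ℂ) (s s' : Finset ι) (f₁ f₂ f₃ f : ι → A)
    (h : ∀ i₁ ∈ s, ∀ i₂ ∈ s, ∀ i₃ ∈ s, ∀ i ∈ s', serreSum t (f₁ i₁) (f₂ i₂) (f₃ i₃) (f i) = 0) :
    serreSum t (∑ i ∈ s, f₁ i) (∑ i ∈ s, f₂ i) (∑ i ∈ s, f₃ i) (∑ i ∈ s', f i) = 0 := by
  refine Finset.sum_induction _ (fun x => serreSum t x _ _ _ = 0)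
    (fun x y hx hy => by rw [serreSum_add, hx, hy, add_zero]) (serreSum_zero _ _ _ _)
    fun i₁ h₁ => ?_
  rw [serreSum_rotate]
  refine Finset.sum_induction _ (fun x => serreSum t x _ _ _ = 0)
    (fun x y hx hy => by rw [serreSum_add, hx, hy, add_zero]) (serreSum_zero _ _ _ _)
    fun i₂ h₂ => ?_
  rw [serreSum_rotate]
  refine Finset.sum_induction _ (fun x => serreSum t x _ _ _ = 0)
    (fun x y hx hy => by rw [serreSum_add, hx, hy, add_zero]) (serreSum_zero _ _ _ _)
    fun i₃ h₃ => ?_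
  rw [serreSum_rotate]
  exact Finset.sum_induction _ (fun x => serreSum t _ _ _ x = 0)
    (fun x y hx hy => by rw [serreSum_add_right, hx, hy, add_zero]) (serreSum_zero_right _ _ _ _)
    fun i hi => h i₁ h₁ i₂ h₂ i₃ h₃ i hi

end

/-- The polynomial identity behind the Serre relations. -/
lemma serre_polynomial (r s x y z w : ℂ) :
    let A : ℂ → ℂ := fun z => z ^ 2 - s * (z * w) + r * w ^ 2
    let C : ℂ → ℂ := fun z => w ^ 2 - s * (z * w) + r * z ^ 2
    let T : ℂ → ℂ → ℂ → ℂ := fun a b c => (r * b - c) * (r * a - c) * (r * a - b) *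
      (r * (A a * A b * A c) - (1 + r + r ^ 2) * (A a * A b * C c)
        + (1 + r + r ^ 2) * (A a * C b * C c) - r * (C a * C b * C c))
    T x y z - T x z y - T y x z + T y z x + T z x y - T z y x = 0 := by
  intro A C T
  simp only [T, A, C]
  ring

/-! ### The Serre relation for single boxes -/

section SerreRaising

variable {B : Type} [LinearOrder B] {S : Set (Finset B)} {q d : ℂ} {fr : Frame S q d}
  {α : Finset B → B → ℂ}

/-- Here r = q₁q₃ = q⁻² and s = q₁ + q₃ in `serre_polynomial`. Three same-color factors g and the
bracket each contribute a factor r⁻¹, so the two identities differ by r⁻⁴. -/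
lemma gVal_serre (hq : q ≠ 0) (hd : d ≠ 0) {i j : ZMod 2} (hij : i ≠ j) (x y z w : ℂ) :
    let t : ℂ := q ^ 2 + 1 + (q ^ 2)⁻¹
    let g : ℂ → ℂ → ℂ := fun a b => gVal q d i i b a
    let A : ℂ → ℂ := fun a => gVal q d i j a w
    let C : ℂ → ℂ := fun a => gVal q d j i w a
    let T : ℂ → ℂ → ℂ → ℂ := fun a b c => g c b * g c a * g b a *
      (A a * A b * A c - t * (A a * A b * C c) + t * (A a * C b * C c) - C a * C b * C c)
    T x y z - T x z y - T y x z + T y z x + T z x y - T z y x = 0 := by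
  intro t g A C T
  have h1 := q₁_ne_zero hq hd
  have h3 := q₃_ne_zero hq hd
  have h2 : q ^ 2 = (q₁ q d * q₃ q d)⁻¹ := by
    unfold q₁ q₃; field_simp
  have hr : q₁ q d * q₃ q d ≠ 0 := mul_ne_zero h1 h3
  have key := serre_polynomial (q₁ q d * q₃ q d) (q₁ q d + q₃ q d) x y z w
  have hA : ∀ a, A a = a ^ 2 - (q₁ q d + q₃ q d) * (a * w) + (q₁ q d * q₃ q d) * w ^ 2 := by
    intro a; simp only [A, gVal, if_neg hij]; ring
  have hC : ∀ a, C a = w ^ 2 - (q₁ q d + q₃ q d) * (a * w) + (q₁ q d * q₃ q d) * a ^ 2 := by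
    intro a; simp only [C, gVal, if_neg hij.symm]; ring
  have hg : ∀ a b, g a b = (q₁ q d * q₃ q d)⁻¹ * ((q₁ q d * q₃ q d) * b - a) := by
    intro a b; simp only [g, gVal, if_true, q₂, h2]; field_simp
  simp only at key
  simp only [← hA, ← hC] at key
  have ht : t = (q₁ q d * q₃ q d)⁻¹ * (1 + (q₁ q d * q₃ q d) + (q₁ q d * q₃ q d) ^ 2) := by
    simp only [t, h2]; field_simp
  simp only [T, hg, ht]
  generalize q₁ q d * q₃ q d = r at *
  have e : r⁻¹ * r = 1 := inv_mul_cancel₀ hr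
  generalize r⁻¹ = r' at *
  have e1 : ∀ a b c : ℂ, r' * (r * b - c) * (r' * (r * a - c)) * (r' * (r * a - b)) *
      (A a * A b * A c - r' * (1 + r + r ^ 2) * (A a * A b * C c)
        + r' * (1 + r + r ^ 2) * (A a * C b * C c) - C a * C b * C c) =
      r' ^ 4 * ((r * b - c) * (r * a - c) * (r * a - b) *
      (r * (A a * A b * A c) - (1 + r + r ^ 2) * (A a * A b * C c)
        + (1 + r + r ^ 2) * (A a * C b * C c) - r * (C a * C b * C c))) := by
    intro a b c
    linear_combination (-(r' ^ 3 * (r * b - c) * (r * a - c) * (r * a - b) *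
      (A a * A b * A c - C a * C b * C c))) * e
  simp only [e1]
  linear_combination r' ^ 4 * key

/-- The Serre relation between raising operators. -/
theorem Frame.Raising.serreSum_eq_zero (R : fr.Raising α) (hq : q ≠ 0) (hd : d ≠ 0)
    {x y z w : B} (hxy : fr.col x = fr.col y) (hxz : fr.col x = fr.col z)
    (hw : fr.col x ≠ fr.col w) :
    serreSum (q ^ 2 + 1 + (q ^ 2)⁻¹) (up S α x) (up S α y) (up S α z) (up S α w) = 0 := by
  refine Finsupp.lhom_ext' fun ⟨s, hs⟩ => LinearMap.ext_ring ?_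
  have e : ∀ a b c d : B, up S α a * up S α b * up S α c * up S α d
      = ([a, b, c, d].map (up S α)).prod := by
    intro a b c d; simp [mul_assoc]
  simp only [LinearMap.comp_apply, Finsupp.lsingle_apply, LinearMap.zero_apply, serreSum,
    serreWord, e]
  have hperm : ∀ L : List B, L.Perm [x, y, z, w] ↔ ∀ a, L.count a = [x, y, z, w].count a :=
    fun L => List.perm_iff_count
  have P : [x, y, z, w].Perm [x, y, z, w] ∧ [x, y, w, z].Perm [x, y, z, w] ∧
      [x, w, y, z].Perm [x, y, z, w] ∧ [w, x, y, z].Perm [x, y, z, w] ∧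
      [x, z, y, w].Perm [x, y, z, w] ∧ [x, z, w, y].Perm [x, y, z, w] ∧
      [x, w, z, y].Perm [x, y, z, w] ∧ [w, x, z, y].Perm [x, y, z, w] ∧
      [y, x, z, w].Perm [x, y, z, w] ∧ [y, x, w, z].Perm [x, y, z, w] ∧
      [y, w, x, z].Perm [x, y, z, w] ∧ [w, y, x, z].Perm [x, y, z, w] ∧
      [y, z, x, w].Perm [x, y, z, w] ∧ [y, z, w, x].Perm [x, y, z, w] ∧
      [y, w, z, x].Perm [x, y, z, w] ∧ [w, y, z, x].Perm [x, y, z, w] ∧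
      [z, x, y, w].Perm [x, y, z, w] ∧ [z, x, w, y].Perm [x, y, z, w] ∧
      [z, w, x, y].Perm [x, y, z, w] ∧ [w, z, x, y].Perm [x, y, z, w] ∧
      [z, y, x, w].Perm [x, y, z, w] ∧ [z, y, w, x].Perm [x, y, z, w] ∧
      [z, w, y, x].Perm [x, y, z, w] ∧ [w, z, y, x].Perm [x, y, z, w] := by
    simp only [hperm, List.count_cons, List.count_nil]
    refine ⟨?_, ?_, ?_, ?_, ?_, ?_, ?_, ?_, ?_, ?_, ?_, ?_, ?_, ?_, ?_, ?_, ?_, ?_, ?_, ?_, ?_, ?_,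
      ?_, ?_⟩ <;> intro a <;> first | trivial | ac_rfl
  obtain ⟨p1, p2, p3, p4, p5, p6, p7, p8, p9, p10, p11, p12, p13, p14, p15, p16, p17, p18, p19,
    p20, p21, p22, p23, p24⟩ := P
  obtain ⟨v, hv⟩ : ∃ v : S →₀ ℂ, ∀ L : List B, L.Perm [x, y, z, w] →
      (L.map (up S α)).prod (Finsupp.single ⟨s, hs⟩ 1) =
        (if [x, y, z, w].Nodup then pairProd (fun u x => R.ε u x * fr.G u x) L else 0) • v := by
    by_cases h : [x, y, z, w].Nodup ∧ (∀ a ∈ [x, y, z, w], a ∉ s) ∧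
        [x, y, z, w].foldr insert s ∈ S
    · simp only [if_pos h.1]
      refine R.up_perm hs h.1 h.2.1 (fun u hu b hb hdg => ?_) h.2.2
      -- A diagonal pair has two different colors, so it contains w. Together with the boxes between
      -- them the list would contain two boxes of the color of w, but it has only one.
      obtain ⟨c, c', h1, h2, h3, h4, h5, h6⟩ := fr.diag_between hdg
      have hcol := fr.diag_col hdg
      have hmem : ∀ c, fr.pred u c → fr.pred c b → c ∈ [x, y, z, w] := by
        intro c hc hc'
        have := (fr.mem_iff _).1 h.2.2 b ((mem_foldr_insert _ _ _).2 (Or.inl hb)) c hc'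
        refine ((mem_foldr_insert _ _ _).1 this).resolve_right fun hcs => ?_
        exact h.2.1 u hu ((fr.mem_iff _).1 hs c hcs u hc)
      have m1 := hmem c h2 h3
      have m2 := hmem c' h5 h6
      have n1 : c' ≠ u := (fr.pred_lt h5).ne'
      have n2 : c ≠ b := (fr.pred_lt h3).ne
      have huniq : ∀ a ∈ [x, y, z, w], fr.col a = fr.col x ∨ a = w := by
        intro a ha
        simp only [List.mem_cons, List.not_mem_nil, or_false] at ha
        rcases ha with rfl | rfl | rfl | rfl
        exacts [Or.inl rfl, Or.inl hxy.symm, Or.inl hxz.symm, Or.inr rfl]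
      rcases huniq u hu with e1 | e1
      · rcases huniq b hb with e2 | e2
        · exact hcol (e1.trans e2.symm)
        · rcases huniq c m1 with e3 | e3
          · exact hw (by rw [← e3, h1, e2])
          · exact n2 (e3.trans e2.symm)
      · rcases huniq c' m2 with e3 | e3
        · exact hw (by rw [← e3, h4, e1])
        · exact n1 (e3.trans e1.symm)
    · refine ⟨0, fun L hL => ?_⟩
      rw [smul_zero, up_list_eq_zero α hs L (fun h' => h ⟨hL.nodup_iff.1 h'.1,
        fun a ha => h'.2.1 a (hL.mem_iff.2 ha), by
          rw [← Frame.foldr_insert_perm hL]; exact h'.2.2⟩)]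
  simp only [LinearMap.add_apply, LinearMap.sub_apply, LinearMap.smul_apply]
  rw [hv _ p1, hv _ p2, hv _ p3, hv _ p4, hv _ p5, hv _ p6, hv _ p7, hv _ p8, hv _ p9, hv _ p10,
    hv _ p11, hv _ p12, hv _ p13, hv _ p14, hv _ p15, hv _ p16, hv _ p17, hv _ p18, hv _ p19,
    hv _ p20, hv _ p21, hv _ p22, hv _ p23, hv _ p24]
  by_cases hn : [x, y, z, w].Nodup
  swap
  · simp [hn]
  simp only [if_pos hn]
  simp only [smul_smul, ← sub_smul, ← add_smul]
  convert zero_smul ℂ v using 2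
  have key := gVal_serre hq hd hw (fr.pos x) (fr.pos y) (fr.pos z) (fr.pos w)
  simp only at key
  simp only [List.nodup_cons, List.mem_cons, List.not_mem_nil, or_false, not_or, not_false_eq_true,
    List.nodup_nil, and_true] at hn
  have s0 : ∀ a b, fr.col a = fr.col b → sgn (fr.col a) (fr.col b) = 1 := fun a b h => if_pos h
  have s1 : ∀ a b, fr.col a ≠ fr.col b → sgn (fr.col a) (fr.col b) = -1 := fun a b h => if_neg h
  -- The signs are antisymmetric among x, y, z and symmetric when w is involved. This produces the
  -- alternating sum of `gVal_serre`, times a common product of `ε`.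
  have c1 : R.ε y x = -R.ε x y := by rw [R.ε_comm hn.1.1, s0 _ _ hxy]; ring
  have c2 : R.ε z x = -R.ε x z := by rw [R.ε_comm hn.1.2.1, s0 _ _ hxz]; ring
  have c3 : R.ε z y = -R.ε y z := by rw [R.ε_comm hn.2.1.1, s0 _ _ (hxy.symm.trans hxz)]; ring
  have c4 : R.ε w x = R.ε x w := by rw [R.ε_comm hn.1.2.2, s1 _ _ hw]; ring
  have c5 : R.ε w y = R.ε y w := by rw [R.ε_comm hn.2.1.2, s1 _ _ (hxy ▸ hw)]; ring
  have c6 : R.ε w z = R.ε z w := by rw [R.ε_comm hn.2.2, s1 _ _ (hxz ▸ hw)]; ring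
  simp only [pairProd, List.map_cons, List.map_nil, List.prod_cons, List.prod_nil, mul_one,
    c1, c2, c3, c4, c5, c6, Frame.G, ← hxy, ← hxz]
  linear_combination (-(R.ε x y * R.ε x z * R.ε y z * R.ε x w * R.ε y w * R.ε z w)) * key

end SerreRaising

/-! ### Lowering operators -/

section Transpose

variable {ι : Type}

/-- The diagonal operator with eigenvalues `c`. -/
def diagonal (c : ι → ℂ) : Module.End ℂ (ι →₀ ℂ) :=
  Finsupp.linearCombination ℂ fun s : ι => Finsupp.single s (c s)

/-- The bilinear form for which the basis is orthonormal. -/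
def dot (ι : Type) : (ι →₀ ℂ) →ₗ[ℂ] (ι →₀ ℂ) →ₗ[ℂ] ℂ :=
  Finsupp.linearCombination ℂ fun s => Finsupp.lapply s

lemma diagonal_single (c : ι → ℂ) (s : ι) (a : ℂ) :
    diagonal c (Finsupp.single s a) = c s • Finsupp.single s a := by
  rw [diagonal, Finsupp.linearCombination_single, Finsupp.smul_single, Finsupp.smul_single,
    smul_eq_mul, smul_eq_mul, mul_comm]

lemma diagonal_mul (c c' : ι → ℂ) : diagonal c * diagonal c' = diagonal (c * c') := by
  refine Finsupp.lhom_ext fun s a => ?_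
  rw [Module.End.mul_apply, diagonal_single, map_smul, diagonal_single, diagonal_single, smul_smul,
    mul_comm]
  rfl

lemma dot_single_left (s : ι) (v : ι →₀ ℂ) : dot ι (Finsupp.single s 1) v = v s := by
  simp [dot]

lemma dot_single_right (s : ι) (v : ι →₀ ℂ) : dot ι v (Finsupp.single s 1) = v s := by
  classical
  induction v using Finsupp.induction_linear with
  | zero => simp
  | add u v hu hv => simp [hu, hv]
  | single t a =>
    simp only [dot, Finsupp.linearCombination_single, LinearMap.smul_apply, Finsupp.lapply_apply,
      Finsupp.single_apply, smul_eq_mul, mul_ite, mul_one, mul_zero]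
    simp [eq_comm]

/-- `A'` is the transpose of `A`. -/
def IsTransp (A A' : Module.End ℂ (ι →₀ ℂ)) : Prop := ∀ u v, dot ι (A u) v = dot ι u (A' v)

namespace IsTransp

variable {A A' C C' : Module.End ℂ (ι →₀ ℂ)}

lemma add (h : IsTransp A A') (h' : IsTransp C C') : IsTransp (A + C) (A' + C') := by
  intro u v; simp [h u v, h' u v]

lemma sub (h : IsTransp A A') (h' : IsTransp C C') : IsTransp (A - C) (A' - C') := by
  intro u v; simp [h u v, h' u v]

lemma smul (h : IsTransp A A') (c : ℂ) : IsTransp (c • A) (c • A') := by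
  intro u v; simp [h u v]

lemma mul (h : IsTransp A A') (h' : IsTransp C C') : IsTransp (A * C) (C' * A') := by
  intro u v; simp [h _ v, h' u _]

lemma eq_zero (h : IsTransp A A') (h' : A' = 0) : A = 0 := by
  ext u s
  have := h (Finsupp.single u 1) (Finsupp.single s 1)
  rw [dot_single_right, h'] at this
  simpa using this

end IsTransp

lemma isTransp_of_single {A A' : Module.End ℂ (ι →₀ ℂ)}
    (h : ∀ s t, (A (Finsupp.single s 1)) t = (A' (Finsupp.single t 1)) s) : IsTransp A A' := by
  intro u v
  have : (dot ι).compl₁₂ A LinearMap.id = (dot ι).compl₁₂ LinearMap.id A' := by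
    refine Finsupp.lhom_ext' fun s => LinearMap.ext_ring (Finsupp.lhom_ext' fun t =>
      LinearMap.ext_ring ?_)
    simp [dot_single_left, dot_single_right, h]
  exact congrArg (fun f => f u v) this

lemma isTransp_diagonal (c : ι → ℂ) : IsTransp (diagonal c) (diagonal c) := by
  classical
  apply isTransp_of_single
  intro s t
  simp only [diagonal_single, Finsupp.smul_single, Finsupp.single_apply]
  by_cases h : s = t
  · simp [h]
  · simp [h, Ne.symm h]

end Transpose

/-! ### Operators removing a box, as transposes -/

section Lowering

variable {B : Type} [LinearOrder B] (S : Set (Finset B))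

open Classical in
/-- The operator removing the box `b`, the transpose of `up S α b`. -/
def down (α : Finset B → B → ℂ) (b : B) : Module.End ℂ (S →₀ ℂ) :=
  Finsupp.linearCombination ℂ fun s : S =>
    if h : b ∈ s.1 ∧ s.1.erase b ∈ S then Finsupp.single ⟨s.1.erase b, h.2⟩ (α (s.1.erase b) b)
    else 0

variable {S}

lemma down_of_mem (α : Finset B → B → ℂ) {b : B} {s : Finset B} (hs : s ∈ S) (hb : b ∈ s)
    (h : s.erase b ∈ S) :
    down S α b (Finsupp.single ⟨s, hs⟩ 1) = α (s.erase b) b • Finsupp.single ⟨s.erase b, h⟩ 1 := by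
  rw [down, Finsupp.linearCombination_single, one_smul, dif_pos ⟨hb, h⟩, Finsupp.smul_single,
    smul_eq_mul, mul_one]

lemma down_of_not (α : Finset B → B → ℂ) {b : B} {s : Finset B} (hs : s ∈ S)
    (h : ¬(b ∈ s ∧ s.erase b ∈ S)) : down S α b (Finsupp.single ⟨s, hs⟩ 1) = 0 := by
  rw [down, Finsupp.linearCombination_single, one_smul, dif_neg h]

/-- Both operators use the coefficient attached to the smaller of the two states. So the
coefficients of `E`, read on the smaller state, can be treated as a family of raising coefficients.
-/
lemma isTransp_down (α : Finset B → B → ℂ) (b : B) : IsTransp (down S α b) (up S α b) := by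
  classical
  apply isTransp_of_single
  rintro ⟨s, hs⟩ ⟨t, ht⟩
  by_cases h1 : b ∈ s ∧ s.erase b ∈ S
  · rw [down_of_mem α hs h1.1 h1.2]
    by_cases h2 : b ∉ t ∧ insert b t ∈ S
    · rw [up_of_mem α ht h2.1 h2.2]
      simp only [Finsupp.smul_single, Finsupp.single_apply, Subtype.mk.injEq]
      by_cases h3 : s.erase b = t
      · subst h3
        simp [Finset.insert_erase h1.1]
      · rw [if_neg h3, if_neg]
        rintro rfl
        exact h3 (Finset.erase_insert h2.1)
    · rw [up_of_not α ht h2]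
      simp only [Finsupp.smul_single, Finsupp.single_apply, Subtype.mk.injEq, Finsupp.coe_zero,
        Pi.zero_apply]
      rw [if_neg]
      rintro rfl
      exact h2 ⟨Finset.notMem_erase _ _, by rwa [Finset.insert_erase h1.1]⟩
  · rw [down_of_not α hs h1]
    by_cases h2 : b ∉ t ∧ insert b t ∈ S
    · rw [up_of_mem α ht h2.1 h2.2]
      simp only [Finsupp.smul_single, Finsupp.single_apply, Subtype.mk.injEq, Finsupp.coe_zero,
        Pi.zero_apply]
      rw [if_neg]
      rintro rfl
      exact h1 ⟨Finset.mem_insert_self _ _, by rwa [Finset.erase_insert h2.1]⟩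
    · rw [up_of_not α ht h2]
      rfl

variable {q d : ℂ} {fr : Frame S q d} {α : Finset B → B → ℂ}

theorem Frame.Raising.down_down (R : fr.Raising α) (x y : B) :
    (sgn (fr.col x) (fr.col y) * gVal q d (fr.col x) (fr.col y) (fr.pos x) (fr.pos y)) •
        (down S α x * down S α y)
      + gVal q d (fr.col y) (fr.col x) (fr.pos y) (fr.pos x) • (down S α y * down S α x) = 0 := by
  have hx := isTransp_down (S := S) α x
  have hy := isTransp_down (S := S) α y
  refine (((hx.mul hy).smul _).add ((hy.mul hx).smul _)).eq_zero ?_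
  -- The sign squares to 1, so multiplying by it moves it to the other term, as the transposed
  -- relation requires.
  have := congrArg (fun A => sgn (fr.col x) (fr.col y) • A) (R.up_up x y)
  simp only [smul_add, smul_smul, smul_zero, ← mul_assoc, sgn_mul_self, one_mul] at this
  rwa [add_comm]

theorem Frame.Raising.serreSum_down (R : fr.Raising α) (hq : q ≠ 0) (hd : d ≠ 0)
    {x y z w : B} (hxy : fr.col x = fr.col y) (hxz : fr.col x = fr.col z)
    (hw : fr.col x ≠ fr.col w) :
    serreSum (q ^ 2 + 1 + (q ^ 2)⁻¹) (down S α x) (down S α y) (down S α z) (down S α w) = 0 := by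
  have hx := isTransp_down (S := S) α x
  have hy := isTransp_down (S := S) α y
  have hz := isTransp_down (S := S) α z
  have hw' := isTransp_down (S := S) α w
  have word : ∀ {a b c w a' b' c' w' : Module.End ℂ (S →₀ ℂ)} (t : ℂ), IsTransp a a' →
      IsTransp b b' → IsTransp c c' → IsTransp w w' →
      IsTransp (serreWord t a b c w) (serreWordRev t a' b' c' w') := by
    intro a b c w a' b' c' w' t ha hb hc hw
    exact ((((((ha.mul hb).mul hc).mul hw)).sub ((((ha.mul hb).mul hw).mul hc).smul t)).add
      ((((ha.mul hw).mul hb).mul hc).smul t)).sub (((hw.mul ha).mul hb).mul hc)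
  refine IsTransp.eq_zero ((((((word _ hx hy hz hw').add (word _ hx hz hy hw')).add
    (word _ hy hx hz hw')).add (word _ hy hz hx hw')).add (word _ hz hx hy hw')).add
    (word _ hz hy hx hw')) ?_
  rw [serreSum_reverse, R.serreSum_eq_zero hq hd hxy hxz hw, smul_zero]

end Lowering

/-! ### Locally finite sums -/

section Approx

variable {B : Type} {ι : Type} {A A' : Module.End ℂ (ι →₀ ℂ)}
  {a a' : Finset B → Module.End ℂ (ι →₀ ℂ)}

/-- On each vector, `A` agrees with `a T` for all sufficiently large `T`. -/
def Approx (A : Module.End ℂ (ι →₀ ℂ)) (a : Finset B → Module.End ℂ (ι →₀ ℂ)) : Prop :=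
  ∀ v, ∀ᶠ T in Filter.atTop, A v = a T v

namespace Approx

lemma const (A : Module.End ℂ (ι →₀ ℂ)) : Approx A (fun _ : Finset B => A) :=
  fun _ => Filter.Eventually.of_forall fun _ => rfl

lemma add (h : Approx A a) (h' : Approx A' a') : Approx (A + A') (fun T => a T + a' T) := by
  intro v
  filter_upwards [h v, h' v] with T h1 h2
  simp [h1, h2]

lemma sub (h : Approx A a) (h' : Approx A' a') : Approx (A - A') (fun T => a T - a' T) := by
  intro v
  filter_upwards [h v, h' v] with T h1 h2
  simp [h1, h2]

lemma smul (c : ℂ) (h : Approx A a) : Approx (c • A) (fun T => c • a T) := by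
  intro v
  filter_upwards [h v] with T h1
  simp [h1]

/-- The first approximation is used at the fixed vector A' v, which does not depend on T. -/
lemma mul (h : Approx A a) (h' : Approx A' a') : Approx (A * A') (fun T => a T * a' T) := by
  intro v
  filter_upwards [h (A' v), h' v] with T h1 h2
  simp [h1, ← h2]

/-- This is how a relation for infinite sums is deduced from its finite truncations. -/
lemma eq_zero (h : Approx A a) (he : ∀ T, a T = 0) : A = 0 := by
  refine LinearMap.ext fun v => ?_
  obtain ⟨T, h1⟩ := (h v).exists
  rw [h1, he]

variable {X Y : ℤ → Module.End ℂ (ι →₀ ℂ)} {x y : Finset B → ℤ → Module.End ℂ (ι →₀ ℂ)}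
  {P : ℤ → ℤ → Module.End ℂ (ι →₀ ℂ)} {p : Finset B → ℤ → ℤ → Module.End ℂ (ι →₀ ℂ)}

lemma gMul (q d : ℂ) (i j : ZMod 2) (h : ∀ k l, Approx (P k l) (fun T => p T k l)) (k l : ℤ) :
    Approx (ToroidalGL2.gMul q d i j P k l) (fun T => ToroidalGL2.gMul q d i j (p T) k l) := by
  unfold ToroidalGL2.gMul
  split_ifs
  · exact (h _ _).sub ((h _ _).smul _)
  · exact ((h _ _).sub ((h _ _).smul _)).add ((h _ _).smul _)

lemma gMulSwap (q d : ℂ) (i j : ZMod 2) (h : ∀ k l, Approx (P k l) (fun T => p T k l)) (k l : ℤ) :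
    Approx (ToroidalGL2.gMulSwap q d i j P k l)
      (fun T => ToroidalGL2.gMulSwap q d i j (p T) k l) :=
  gMul q d i j (P := fun l' k' => P k' l') (p := fun T l' k' => p T k' l') (fun k l => h l k) l k

lemma quadE (q d : ℂ) (i j : ZMod 2) (h : ∀ k, Approx (X k) (fun T => x T k))
    (h' : ∀ k, Approx (Y k) (fun T => y T k)) (k l : ℤ) :
    Approx (ToroidalGL2.quadE q d i j X Y k l)
      (fun T => ToroidalGL2.quadE q d i j (x T) (y T) k l) :=
  ((gMul q d i j (fun k l => (h k).mul (h' l)) k l).smul _).add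
    (gMulSwap q d j i (fun k l => (h' l).mul (h k)) k l)

lemma quadF (q d : ℂ) (i j : ZMod 2) (h : ∀ k, Approx (X k) (fun T => x T k))
    (h' : ∀ k, Approx (Y k) (fun T => y T k)) (k l : ℤ) :
    Approx (ToroidalGL2.quadF q d i j X Y k l)
      (fun T => ToroidalGL2.quadF q d i j (x T) (y T) k l) :=
  ((gMulSwap q d j i (fun k l => (h k).mul (h' l)) k l).smul _).add
    (gMul q d i j (fun k l => (h' l).mul (h k)) k l)

lemma serreSum (t : ℂ) {A₁ A₂ A₃ A₄ : Module.End ℂ (ι →₀ ℂ)}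
    {a₁ a₂ a₃ a₄ : Finset B → Module.End ℂ (ι →₀ ℂ)} (h₁ : Approx A₁ a₁) (h₂ : Approx A₂ a₂)
    (h₃ : Approx A₃ a₃) (h₄ : Approx A₄ a₄) :
    Approx (ToroidalGL2.serreSum t A₁ A₂ A₃ A₄)
      (fun T => ToroidalGL2.serreSum t (a₁ T) (a₂ T) (a₃ T) (a₄ T)) := by
  have word : ∀ {A₁ A₂ A₃ : Module.End ℂ (ι →₀ ℂ)} {a₁ a₂ a₃ : Finset B → Module.End ℂ (ι →₀ ℂ)},
      Approx A₁ a₁ → Approx A₂ a₂ → Approx A₃ a₃ →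
      Approx (serreWord t A₁ A₂ A₃ A₄) (fun T => serreWord t (a₁ T) (a₂ T) (a₃ T) (a₄ T)) := by
    intro A₁ A₂ A₃ a₁ a₂ a₃ h₁ h₂ h₃
    exact (((((h₁.mul h₂).mul h₃).mul h₄).sub ((((h₁.mul h₂).mul h₄).mul h₃).smul t)).add
      ((((h₁.mul h₄).mul h₂).mul h₃).smul t)).sub (((h₄.mul h₁).mul h₂).mul h₃)
  exact (((((word h₁ h₂ h₃).add (word h₁ h₃ h₂)).add (word h₂ h₁ h₃)).add (word h₂ h₃ h₁)).add
    (word h₃ h₁ h₂)).add (word h₃ h₂ h₁)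

end Approx

/-- The sum of a locally finite family of operators. -/
def total (f : B → Module.End ℂ (ι →₀ ℂ)) : Module.End ℂ (ι →₀ ℂ) :=
  Finsupp.linearCombination ℂ fun s => ∑ᶠ b, f b (Finsupp.single s 1)

lemma total_single (f : B → Module.End ℂ (ι →₀ ℂ)) (s : ι) :
    total f (Finsupp.single s 1) = ∑ᶠ b, f b (Finsupp.single s 1) := by
  rw [total, Finsupp.linearCombination_single, one_smul]

lemma approx_total {f : B → Module.End ℂ (ι →₀ ℂ)}
    (hf : ∀ s, {b | f b (Finsupp.single s 1) ≠ 0}.Finite) :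
    Approx (total f) (fun T => ∑ b ∈ T, f b) := by
  intro v
  induction v using Finsupp.induction_linear with
  | zero => simp
  | add u v hu hv =>
    filter_upwards [hu, hv] with T h1 h2
    rw [map_add, map_add, h1, h2]
  | single s c =>
    filter_upwards [Filter.eventually_ge_atTop (hf s).toFinset] with T hT
    have e : Finsupp.single s c = c • Finsupp.single s (1 : ℂ) := by simp
    rw [e, map_smul, map_smul, total_single, LinearMap.sum_apply,
      finsum_eq_sum_of_support_subset]
    intro b hb
    exact hT (by simpa using hb)

end Approx

/-! ### Currents -/

section Series

variable {A : Type} [Ring A] [Algebra ℂ A]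

lemma gMul_add (q d : ℂ) (i j : ZMod 2) (P Q : ℤ → ℤ → A) (k l : ℤ) :
    gMul q d i j (fun k l => P k l + Q k l) k l = gMul q d i j P k l + gMul q d i j Q k l := by
  unfold gMul
  split_ifs <;> simp only [smul_add] <;> abel

lemma gMulSwap_add (q d : ℂ) (i j : ZMod 2) (P Q : ℤ → ℤ → A) (k l : ℤ) :
    gMulSwap q d i j (fun k l => P k l + Q k l) k l
      = gMulSwap q d i j P k l + gMulSwap q d i j Q k l :=
  gMul_add q d i j (fun l' k' => P k' l') (fun l' k' => Q k' l') l k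

lemma quadE_add_left (q d : ℂ) (i j : ZMod 2) (X X' Y : ℤ → A) (k l : ℤ) :
    quadE q d i j (X + X') Y k l = quadE q d i j X Y k l + quadE q d i j X' Y k l := by
  simp only [quadE, Pi.add_apply, add_mul, mul_add, gMul_add, gMulSwap_add, smul_add]
  abel

lemma quadE_add_right (q d : ℂ) (i j : ZMod 2) (X Y Y' : ℤ → A) (k l : ℤ) :
    quadE q d i j X (Y + Y') k l = quadE q d i j X Y k l + quadE q d i j X Y' k l := by
  simp only [quadE, Pi.add_apply, add_mul, mul_add, gMul_add, gMulSwap_add, smul_add]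
  abel

lemma quadF_add_left (q d : ℂ) (i j : ZMod 2) (X X' Y : ℤ → A) (k l : ℤ) :
    quadF q d i j (X + X') Y k l = quadF q d i j X Y k l + quadF q d i j X' Y k l := by
  simp only [quadF, Pi.add_apply, add_mul, mul_add, gMul_add, gMulSwap_add, smul_add]
  abel

lemma quadF_add_right (q d : ℂ) (i j : ZMod 2) (X Y Y' : ℤ → A) (k l : ℤ) :
    quadF q d i j X (Y + Y') k l = quadF q d i j X Y k l + quadF q d i j X Y' k l := by
  simp only [quadF, Pi.add_apply, add_mul, mul_add, gMul_add, gMulSwap_add, smul_add]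
  abel

lemma gMul_zero (q d : ℂ) (i j : ZMod 2) (k l : ℤ) :
    gMul q d i j (fun _ _ => (0 : A)) k l = 0 := by
  simp [gMul]

lemma gMulSwap_zero (q d : ℂ) (i j : ZMod 2) (k l : ℤ) :
    gMulSwap q d i j (fun _ _ => (0 : A)) k l = 0 := by
  simp [gMulSwap, gMul]

lemma quadE_sum_right {ι : Type} (q d : ℂ) (i j : ZMod 2) (X : ℤ → A) (s : Finset ι)
    (f : ι → ℤ → A) (k l : ℤ) (h : ∀ b ∈ s, quadE q d i j X (f b) k l = 0) :
    quadE q d i j X (∑ b ∈ s, f b) k l = 0 :=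
  Finset.sum_induction _ (fun Y => quadE q d i j X Y k l = 0)
    (fun x y hx hy => by rw [quadE_add_right, hx, hy, add_zero])
    (by simp [quadE, gMul_zero, gMulSwap_zero]) h

lemma quadF_sum_right {ι : Type} (q d : ℂ) (i j : ZMod 2) (X : ℤ → A) (s : Finset ι)
    (f : ι → ℤ → A) (k l : ℤ) (h : ∀ b ∈ s, quadF q d i j X (f b) k l = 0) :
    quadF q d i j X (∑ b ∈ s, f b) k l = 0 :=
  Finset.sum_induction _ (fun Y => quadF q d i j X Y k l = 0)
    (fun x y hx hy => by rw [quadF_add_right, hx, hy, add_zero])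
    (by simp [quadF, gMul_zero, gMulSwap_zero]) h

lemma quadE_sum_left {ι : Type} (q d : ℂ) (i j : ZMod 2) (Y : ℤ → A) (s : Finset ι)
    (f : ι → ℤ → A) (k l : ℤ) (h : ∀ b ∈ s, quadE q d i j (f b) Y k l = 0) :
    quadE q d i j (∑ b ∈ s, f b) Y k l = 0 :=
  Finset.sum_induction _ (fun X => quadE q d i j X Y k l = 0)
    (fun x y hx hy => by rw [quadE_add_left, hx, hy, add_zero])
    (by simp [quadE, gMul_zero, gMulSwap_zero]) h

lemma quadF_sum_left {ι : Type} (q d : ℂ) (i j : ZMod 2) (Y : ℤ → A) (s : Finset ι)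
    (f : ι → ℤ → A) (k l : ℤ) (h : ∀ b ∈ s, quadF q d i j (f b) Y k l = 0) :
    quadF q d i j (∑ b ∈ s, f b) Y k l = 0 :=
  Finset.sum_induction _ (fun X => quadF q d i j X Y k l = 0)
    (fun x y hx hy => by rw [quadF_add_left, hx, hy, add_zero])
    (by simp [quadF, gMul_zero, gMulSwap_zero]) h

/-- Multiplying δ(z/p)δ(w/r) by a polynomial evaluates the polynomial at (p, r); so relations
between currents become relations between the operators of pairs of boxes. -/
lemma gMul_zpow (q d : ℂ) (i j : ZMod 2) {p r : ℂ} (hp : p ≠ 0) (hr : r ≠ 0) (c : A) (k l : ℤ) :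
    gMul q d i j (fun k l => (p ^ k * r ^ l) • c) k l
      = (p ^ k * r ^ l * gVal q d i j p r) • c := by
  have h2 : ∀ (p : ℂ), p ≠ 0 → ∀ k : ℤ, p ^ (k + 2) = p ^ k * p * p := by
    intro p hp k
    rw [show k + 2 = k + 1 + 1 by ring, zpow_add_one₀ hp, zpow_add_one₀ hp]
  unfold gMul gVal
  split_ifs
  · simp only [zpow_add_one₀ hp, zpow_add_one₀ hr, smul_smul, ← sub_smul]
    congr 1; ring
  · simp only [zpow_add_one₀ hp, zpow_add_one₀ hr, h2 p hp, h2 r hr, smul_smul, ← sub_smul,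
      ← add_smul]
    congr 1; ring

lemma gMulSwap_zpow (q d : ℂ) (i j : ZMod 2) {p r : ℂ} (hp : p ≠ 0) (hr : r ≠ 0) (c : A)
    (k l : ℤ) : gMulSwap q d i j (fun k l => (p ^ k * r ^ l) • c) k l
      = (p ^ k * r ^ l * gVal q d i j r p) • c := by
  have := gMul_zpow q d i j hr hp c l k
  simp only [gMulSwap]
  rw [mul_comm (p ^ k), ← this]
  simp only [mul_comm]

lemma quadE_zpow (q d : ℂ) (i j : ZMod 2) {p r : ℂ} (hp : p ≠ 0) (hr : r ≠ 0) (a b : A)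
    (k l : ℤ) : quadE q d i j (fun k => p ^ k • a) (fun l => r ^ l • b) k l =
      (p ^ k * r ^ l) • ((sgn i j * gVal q d i j p r) • (a * b) + gVal q d j i r p • (b * a)) := by
  have e : (fun k' l' : ℤ => (r ^ l' * p ^ k') • (b * a)) =
      fun k' l' => (p ^ k' * r ^ l') • (b * a) := by
    funext k' l'
    rw [mul_comm (r ^ l')]
  simp only [quadE, smul_mul_smul_comm]
  rw [e, gMul_zpow q d i j hp hr, gMulSwap_zpow q d j i hp hr, smul_add, smul_smul, smul_smul,
    smul_smul]
  congr 2
  ring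

lemma quadF_zpow (q d : ℂ) (i j : ZMod 2) {p r : ℂ} (hp : p ≠ 0) (hr : r ≠ 0) (a b : A)
    (k l : ℤ) : quadF q d i j (fun k => p ^ k • a) (fun l => r ^ l • b) k l =
      (p ^ k * r ^ l) • ((sgn i j * gVal q d j i r p) • (a * b) + gVal q d i j p r • (b * a)) := by
  have e : (fun k' l' : ℤ => (r ^ l' * p ^ k') • (b * a)) =
      fun k' l' => (p ^ k' * r ^ l') • (b * a) := by
    funext k' l'
    rw [mul_comm (r ^ l')]
  simp only [quadF, smul_mul_smul_comm]
  rw [e, gMul_zpow q d i j hp hr, gMulSwap_zpow q d j i hp hr, smul_add, smul_smul, smul_smul,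
    smul_smul]
  congr 2
  ring

variable {A' : Type} [Ring A'] [Algebra ℂ A'] (f : A →ₐ[ℂ] A')

lemma map_quadE (q d : ℂ) (i j : ZMod 2) (X Y : ℤ → A) (k l : ℤ) :
    f (quadE q d i j X Y k l) = quadE q d i j (fun k => f (X k)) (fun k => f (Y k)) k l := by
  unfold quadE gMulSwap gMul
  split_ifs <;> simp

lemma map_quadF (q d : ℂ) (i j : ZMod 2) (X Y : ℤ → A) (k l : ℤ) :
    f (quadF q d i j X Y k l) = quadF q d i j (fun k => f (X k)) (fun k => f (Y k)) k l := by
  unfold quadF gMulSwap gMul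
  split_ifs <;> simp

lemma map_serre (q : ℂ) (X Y : ℤ → A) (k : Fin 3 → ℤ) (l : ℤ) :
    f (serre q X Y k l) = serre q (fun k => f (X k)) (fun k => f (Y k)) k l := by
  simp [serre, brk]

end Series

/-- Only pairs of equal boxes survive, and for different colors there are none. -/
lemma sum_commutator {A B : Type} [Ring A] [Algebra ℂ A] (col : B → ZMod 2) {pos : B → ℂ}
    {f g : B → A} (hp : ∀ b, pos b ≠ 0) (h : ∀ x y, x ≠ y → f x * g y = g y * f x)
    (i j : ZMod 2) (k l : ℤ) (T : Finset B) :
    (if i = j then ∑ b ∈ T with col b = i, pos b ^ (k + l) • (f b * g b - g b * f b) else 0) =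
      (∑ b ∈ T with col b = i, pos b ^ k • f b) * (∑ b ∈ T with col b = j, pos b ^ l • g b) -
      (∑ b ∈ T with col b = j, pos b ^ l • g b) * (∑ b ∈ T with col b = i, pos b ^ k • f b) := by
  rw [Finset.sum_mul_sum, Finset.sum_mul_sum,
    Finset.sum_comm (s := T.filter fun b => col b = j), ← Finset.sum_sub_distrib]
  simp only [← Finset.sum_sub_distrib]
  split_ifs with hij
  · subst hij
    refine Finset.sum_congr rfl fun x hx => ?_
    rw [Finset.sum_eq_single_of_mem x hx]
    · rw [smul_mul_smul_comm, smul_mul_smul_comm, zpow_add₀ (hp x), smul_sub,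
        mul_comm (pos x ^ l)]
    · intro y _ hxy
      rw [smul_mul_smul_comm, smul_mul_smul_comm, h x y hxy.symm, mul_comm, sub_self]
  · symm
    refine Finset.sum_eq_zero fun x hx => Finset.sum_eq_zero fun y hy => ?_
    have : x ≠ y := by
      rintro rfl
      exact hij ((Finset.mem_filter.1 hx).2.symm.trans (Finset.mem_filter.1 hy).2)
    rw [smul_mul_smul_comm, smul_mul_smul_comm, h x y this, mul_comm, sub_self]

section Currents

variable {B : Type} {ι : Type} {q d : ℂ} (col : B → ZMod 2) (pos : B → ℂ)

/-- The contribution of the box `b` to the coefficient of `z^{-k}` in a current of color `i`. -/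
def currentTerm (f : B → Module.End ℂ (ι →₀ ℂ)) (i : ZMod 2) (k : ℤ) (b : B) :
    Module.End ℂ (ι →₀ ℂ) := if col b = i then pos b ^ k • f b else 0

/-- The coefficient of `z^{-k}` in the current `∑ δ(z / pos b) f b` of color `i`. -/
def current (f : B → Module.End ℂ (ι →₀ ℂ)) (i : ZMod 2) (k : ℤ) : Module.End ℂ (ι →₀ ℂ) :=
  total (currentTerm col pos f i k)

/-- The part of the current from the boxes in `T`. -/
def partialCurrent (f : B → Module.End ℂ (ι →₀ ℂ)) (i : ZMod 2) (T : Finset B) :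
    ℤ → Module.End ℂ (ι →₀ ℂ) :=
  ∑ b ∈ T with col b = i, fun k => pos b ^ k • f b

/-- The family `f` of operators is locally finite. -/
def LocFinite (f : B → Module.End ℂ (ι →₀ ℂ)) : Prop :=
  ∀ s, {b | f b (Finsupp.single s 1) ≠ 0}.Finite

variable {col pos} {f g : B → Module.End ℂ (ι →₀ ℂ)}

lemma approx_current (col : B → ZMod 2) (pos : B → ℂ) (hf : LocFinite f) (i : ZMod 2) (k : ℤ) :
    Approx (current col pos f i k) (fun T => partialCurrent col pos f i T k) := by
  have h : ∀ s, {b | currentTerm col pos f i k b (Finsupp.single s 1) ≠ 0}.Finite := by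
    intro s
    refine (hf s).subset fun b hb h0 => hb ?_
    unfold currentTerm
    split_ifs
    · simp [h0]
    · rfl
  have := approx_total h
  unfold current
  simpa only [partialCurrent, Finset.sum_apply, currentTerm, ← Finset.sum_filter] using this

lemma current_quadF (hf : LocFinite f) (hp : ∀ b, pos b ≠ 0)
    (h : ∀ x y, (sgn (col x) (col y) * gVal q d (col y) (col x) (pos y) (pos x)) • (f x * f y)
      + gVal q d (col x) (col y) (pos x) (pos y) • (f y * f x) = 0) (i j : ZMod 2) (k l : ℤ) :
    quadF q d i j (current col pos f i) (current col pos f j) k l = 0 := by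
  refine (Approx.quadF q d i j (approx_current col pos hf i) (approx_current col pos hf j)
    k l).eq_zero fun T => ?_
  refine quadF_sum_left q d i j _ _ _ k l fun x hx => quadF_sum_right q d i j _ _ _ k l
    fun y hy => ?_
  rw [quadF_zpow q d i j (hp x) (hp y), ← (Finset.mem_filter.1 hx).2, ← (Finset.mem_filter.1 hy).2,
    h, smul_zero]

lemma current_quadE (hf : LocFinite f) (hp : ∀ b, pos b ≠ 0)
    (h : ∀ x y, (sgn (col x) (col y) * gVal q d (col x) (col y) (pos x) (pos y)) • (f x * f y)
      + gVal q d (col y) (col x) (pos y) (pos x) • (f y * f x) = 0) (i j : ZMod 2) (k l : ℤ) :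
    quadE q d i j (current col pos f i) (current col pos f j) k l = 0 := by
  refine (Approx.quadE q d i j (approx_current col pos hf i) (approx_current col pos hf j)
    k l).eq_zero fun T => ?_
  refine quadE_sum_left q d i j _ _ _ k l fun x hx => quadE_sum_right q d i j _ _ _ k l
    fun y hy => ?_
  rw [quadE_zpow q d i j (hp x) (hp y), ← (Finset.mem_filter.1 hx).2, ← (Finset.mem_filter.1 hy).2,
    h, smul_zero]

lemma current_serre (hq : q ≠ 0) (hf : LocFinite f)
    (h : ∀ x y z w, col x = col y → col x = col z → col x ≠ col w →
      serreSum (q ^ 2 + 1 + (q ^ 2)⁻¹) (f x) (f y) (f z) (f w) = 0) {i j : ZMod 2} (hij : i ≠ j)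
    (k : Fin 3 → ℤ) (l : ℤ) :
    serre q (current col pos f i) (current col pos f j) k l = 0 := by
  rw [serre_eq hq]
  have := (Approx.serreSum (q ^ 2 + 1 + (q ^ 2)⁻¹) (approx_current col pos hf i
    (k 0)) (approx_current col pos hf i (k 1)) (approx_current col pos hf i (k 2))
    (approx_current col pos hf j l)).eq_zero fun T => by
      simp only [partialCurrent, Finset.sum_apply]
      refine serreSum_sum _ _ _ _ _ _ _ fun x hx y hy z hz w hw => ?_
      have hx' := (Finset.mem_filter.1 hx).2
      have hy' := (Finset.mem_filter.1 hy).2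
      have hz' := (Finset.mem_filter.1 hz).2
      have hw' := (Finset.mem_filter.1 hw).2
      rw [serreSum_smul, h x y z w (hx'.trans hy'.symm) (hx'.trans hz'.symm)
        (by rwa [hx', hw']), smul_zero]
  rw [this, smul_zero]

lemma current_quadF_diagonal (hf : LocFinite f) (X : ℤ → Module.End ℂ (ι →₀ ℂ))
    (i j : ZMod 2) (h : ∀ b, col b = j → ∀ k l, quadF q d i j X (fun l => pos b ^ l • f b) k l = 0)
    (k l : ℤ) : quadF q d i j X (current col pos f j) k l = 0 := by
  refine (Approx.quadF q d i j (fun k => Approx.const (X k)) (approx_current col pos hf j) k l).eq_zero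
    fun T => ?_
  exact quadF_sum_right q d i j _ _ _ k l fun b hb => h b (Finset.mem_filter.1 hb).2 k l

lemma current_quadE_diagonal (hf : LocFinite f) (X : ℤ → Module.End ℂ (ι →₀ ℂ))
    (i j : ZMod 2) (h : ∀ b, col b = j → ∀ k l, quadE q d i j X (fun l => pos b ^ l • f b) k l = 0)
    (k l : ℤ) : quadE q d i j X (current col pos f j) k l = 0 := by
  refine (Approx.quadE q d i j (fun k => Approx.const (X k)) (approx_current col pos hf j) k l).eq_zero
    fun T => ?_
  exact quadE_sum_right q d i j _ _ _ k l fun b hb => h b (Finset.mem_filter.1 hb).2 k l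

/-- The commutator of two currents whose operators commute for distinct boxes. -/
lemma current_commutator (hf : LocFinite f) (hg : LocFinite g) (hp : ∀ b, pos b ≠ 0)
    (h : ∀ x y, x ≠ y → f x * g y = g y * f x) (i j : ZMod 2) (k l : ℤ) :
    Approx (current col pos f i k * current col pos g j l
        - current col pos g j l * current col pos f i k)
      (fun T => if i = j then
        ∑ b ∈ T with col b = i, pos b ^ (k + l) • (f b * g b - g b * f b) else 0) := by
  have h1 := ((approx_current col pos hf i k).mul (approx_current col pos hg j l)).sub
    ((approx_current col pos hg j l).mul (approx_current col pos hf i k))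
  convert h1 using 2 with T
  simp only [partialCurrent, Finset.sum_apply]
  exact sum_commutator (A := Module.End ℂ (ι →₀ ℂ)) col hp h i j k l T

end Currents

/-! ### Representations with raising and lowering operators -/

lemma diagonal_comm {ι : Type} (c c' : ι → ℂ) :
    diagonal c * diagonal c' = diagonal c' * diagonal c := by
  rw [diagonal_mul, diagonal_mul, mul_comm]

lemma diagonal_one {ι : Type} : diagonal (1 : ι → ℂ) = 1 := by
  refine Finsupp.lhom_ext fun s a => ?_
  rw [diagonal_single, Pi.one_apply, one_smul, Module.End.one_apply]

/-! ### Relations between diagonal and shifting operators, on eigenvectors -/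

section Weights

variable {ι : Type} {q d : ℂ}

/-- The eigenvalues `c0` belong to the state without the box and `c` to the state with it. The
hypothesis has the form supplied by `expansion_quadF`. -/
lemma quadF_eigen (i j : ZMod 2) {p : ℂ} (hp : p ≠ 0) {X : ℤ → Module.End ℂ (ι →₀ ℂ)}
    {U : Module.End ℂ (ι →₀ ℂ)} {v : ι →₀ ℂ} {c c0 : ℤ → ℂ} (hv : ∀ k, X k v = c0 k • v)
    (hu : ∀ k, X k (U v) = c k • U v) (k l : ℤ)
    (h : (if i = j then p * c k - q₂ q * c (k + 1) + (c0 (k + 1) - q₂ q * p * c0 k)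
      else -(p ^ 2 * c k - (q₁ q d + q₃ q d) * p * c (k + 1) + q₁ q d * q₃ q d * c (k + 2))
        + (c0 (k + 2) - (q₁ q d + q₃ q d) * p * c0 (k + 1)
          + q₁ q d * q₃ q d * p ^ 2 * c0 k)) = 0) :
    quadF q d i j X (fun l => p ^ l • U) k l v = 0 := by
  have h2 : ∀ k : ℤ, p ^ (k + 2) = p ^ k * p * p := by
    intro k
    rw [show k + 2 = k + 1 + 1 by ring, zpow_add_one₀ hp, zpow_add_one₀ hp]
  unfold quadF gMulSwap gMul sgn
  split_ifs at h ⊢ with h1 h3 h3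
  · simp only [LinearMap.add_apply, LinearMap.sub_apply, LinearMap.smul_apply,
      Module.End.mul_apply, map_smul, hv, hu, smul_smul, ← sub_smul, ← add_smul,
      zpow_add_one₀ hp]
    convert zero_smul ℂ (U v) using 2
    linear_combination p ^ l * h
  · exact absurd h1.symm h3
  · exact absurd h3.symm h1
  · simp only [LinearMap.add_apply, LinearMap.sub_apply, LinearMap.smul_apply,
      Module.End.mul_apply, map_smul, hv, hu, smul_smul, ← sub_smul, ← add_smul,
      zpow_add_one₀ hp, h2]
    convert zero_smul ℂ (U v) using 2
    linear_combination p ^ l * h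

/-- Source and target exchange their roles: the state with the box is now the source. Hence the same
hypothesis serves for removal. -/
lemma quadE_eigen (i j : ZMod 2) {p : ℂ} (hp : p ≠ 0) {X : ℤ → Module.End ℂ (ι →₀ ℂ)}
    {U : Module.End ℂ (ι →₀ ℂ)} {v : ι →₀ ℂ} {c c0 : ℤ → ℂ} (hv : ∀ k, X k v = c k • v)
    (hu : ∀ k, X k (U v) = c0 k • U v) (k l : ℤ)
    (h : (if i = j then p * c k - q₂ q * c (k + 1) + (c0 (k + 1) - q₂ q * p * c0 k)
      else -(p ^ 2 * c k - (q₁ q d + q₃ q d) * p * c (k + 1) + q₁ q d * q₃ q d * c (k + 2))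
        + (c0 (k + 2) - (q₁ q d + q₃ q d) * p * c0 (k + 1)
          + q₁ q d * q₃ q d * p ^ 2 * c0 k)) = 0) :
    quadE q d i j X (fun l => p ^ l • U) k l v = 0 := by
  have h2 : ∀ k : ℤ, p ^ (k + 2) = p ^ k * p * p := by
    intro k
    rw [show k + 2 = k + 1 + 1 by ring, zpow_add_one₀ hp, zpow_add_one₀ hp]
  unfold quadE gMulSwap gMul sgn
  split_ifs at h ⊢ with h1 h3 h3
  · simp only [LinearMap.add_apply, LinearMap.sub_apply, LinearMap.smul_apply,
      Module.End.mul_apply, map_smul, hv, hu, smul_smul, ← sub_smul, ← add_smul,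
      zpow_add_one₀ hp]
    convert zero_smul ℂ (U v) using 2
    linear_combination p ^ l * h
  · exact absurd h1.symm h3
  · exact absurd h3.symm h1
  · simp only [LinearMap.add_apply, LinearMap.sub_apply, LinearMap.smul_apply,
      Module.End.mul_apply, map_smul, hv, hu, smul_smul, ← sub_smul, ← add_smul,
      zpow_add_one₀ hp, h2]
    convert zero_smul ℂ (U v) using 2
    linear_combination -p ^ l * h

end Weights

/-! ### From raising and lowering data to a module over the algebra -/

section Rep

variable {B : Type} [LinearOrder B]

open Classical in
/-- Raising and lowering operators together with weights, subject to the conditions under which they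
define a representation of the algebra. -/
structure Rep (S : Set (Finset B)) (q d : ℂ) where
  fr : Frame S q d
  α : Finset B → B → ℂ
  β : Finset B → B → ℂ
  RF : fr.Raising α
  RE : fr.Raising β
  φ : Finset B → ZMod 2 → RatFunc ℂ
  φ_insert : ∀ {s b}, b ∉ s → ∀ j, φ (insert b s) j = φ s j * (rootA q d (fr.col b) (fr.pos b) j)⁻¹
  finite_add : ∀ s ∈ S, {b | b ∉ s ∧ insert b s ∈ S}.Finite
  -- The presence of b changes the coefficient for adding b', and the presence of b' changes the one
  -- for removing b. The two changes must compensate for the two orders to agree.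
  cross : ∀ {b b'}, b ≠ b' → ¬fr.pred b b' → ¬fr.pred b' b → ¬fr.diag b b' → ¬fr.diag b' b →
    RF.ρ b b' * RE.ρ b' b = 1
  diagonal_EF : ∀ s ∈ S, ∀ (i : ZMod 2) (k : ℤ), ∀ᶠ T in Filter.atTop,
    ∑ b ∈ T with fr.col b = i, fr.pos b ^ k *
      ((if b ∉ s ∧ insert b s ∈ S then α s b * β s b else 0) -
        (if b ∈ s ∧ s.erase b ∈ S then α (s.erase b) b * β (s.erase b) b else 0)) =
      1 / (q - q⁻¹) * (coeffInfty (φ s i) k - coeffZero (φ s i) (-k))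
  coeffInfty_neg : ∀ s i (k : ℤ), k < 0 → coeffInfty (φ s i) k = 0
  coeffZero_neg : ∀ s i (k : ℤ), k < 0 → coeffZero (φ s i) k = 0
  coeff_mul : ∀ s i, coeffInfty (φ s i) 0 * coeffZero (φ s i) 0 = 1

namespace Rep

variable {S : Set (Finset B)} {q d : ℂ} (R : Rep S q d)

/-- The operators by which the generators act. -/
def opGen : Gen → Module.End ℂ (S →₀ ℂ)
  | .E i k => current R.fr.col R.fr.pos (down S R.β) i k
  | .F i k => current R.fr.col R.fr.pos (up S R.α) i k
  | .Kplus i r => diagonal fun s => coeffInfty (R.φ s i) r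
  | .Kminus i r => diagonal fun s => coeffZero (R.φ s i) r
  | .t => 1
  | .tinv => 1

/-- The action of the free algebra. -/
def op : Free →ₐ[ℂ] Module.End ℂ (S →₀ ℂ) := FreeAlgebra.lift ℂ R.opGen

lemma op_ι (x : Gen) : R.op (FreeAlgebra.ι ℂ x) = R.opGen x := FreeAlgebra.lift_ι_apply _ _

lemma op_E (i : ZMod 2) (k : ℤ) :
    R.op (Free.E i k) = current R.fr.col R.fr.pos (down S R.β) i k := R.op_ι _

lemma op_F (i : ZMod 2) (k : ℤ) :
    R.op (Free.F i k) = current R.fr.col R.fr.pos (up S R.α) i k := R.op_ι _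

lemma op_Kplus (i : ZMod 2) (k : ℤ) :
    R.op (Free.Kplus i k) = diagonal fun s : S => coeffInfty (R.φ s i) k := by
  unfold Free.Kplus
  split_ifs with h
  · rw [op_ι, opGen, Int.toNat_of_nonneg h]
  · rw [map_zero]
    refine Finsupp.lhom_ext fun s a => ?_
    rw [diagonal_single, R.coeffInfty_neg _ _ _ (not_le.1 h), zero_smul, LinearMap.zero_apply]

lemma op_Kminus (i : ZMod 2) (k : ℤ) :
    R.op (Free.Kminus i k) = diagonal fun s : S => coeffZero (R.φ s i) (-k) := by
  unfold Free.Kminus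
  split_ifs with h
  · rw [op_ι, opGen, Int.toNat_of_nonneg (by lia)]
  · rw [map_zero]
    refine Finsupp.lhom_ext fun s a => ?_
    rw [diagonal_single, R.coeffZero_neg _ _ _ (by lia), zero_smul, LinearMap.zero_apply]

lemma locFinite_up : LocFinite (up S R.α) := by
  rintro ⟨s, hs⟩
  refine (R.finite_add s hs).subset fun b hb => ?_
  by_contra h
  exact hb (up_of_not R.α hs h)

lemma locFinite_down : LocFinite (down S R.β) := by
  rintro ⟨s, hs⟩
  refine s.finite_toSet.subset fun b hb => ?_
  by_contra h
  exact hb (down_of_not R.β hs fun h' => h h'.1)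

/-- Raising and lowering operators for distinct boxes commute. -/
lemma down_comm_up {b b' : B} (hb : b ≠ b') :
    down S R.β b * up S R.α b' = up S R.α b' * down S R.β b := by
  refine Finsupp.lhom_ext' fun ⟨s, hs⟩ => LinearMap.ext_ring ?_
  simp only [LinearMap.comp_apply, Finsupp.lsingle_apply, Module.End.mul_apply]
  by_cases h1 : b ∈ s ∧ s.erase b ∈ S
  · obtain ⟨r, hr, rfl⟩ : ∃ r, b ∉ r ∧ s = insert b r :=
      ⟨s.erase b, Finset.notMem_erase _ _, (Finset.insert_erase h1.1).symm⟩
    have hrS : r ∈ S := by simpa [Finset.erase_insert hr] using h1.2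
    have e1 : (⟨(insert b r).erase b, h1.2⟩ : S) = ⟨r, hrS⟩ :=
      Subtype.ext (Finset.erase_insert hr)
    rw [down_of_mem R.β hs h1.1 h1.2, e1, map_smul, Finset.erase_insert hr]
    by_cases h2 : b' ∉ r ∧ insert b' r ∈ S
    · have h3 : b' ∉ insert b r := by simp [h2.1, hb.symm]
      -- States are closed under unions, so two boxes addable to r separately are addable together.
      have h4 : insert b' (insert b r) ∈ S := by
        convert R.fr.union_mem h2.2 hs using 1
        ext; simp; tauto
      have h5 : (insert b' (insert b r)).erase b = insert b' r := by
        rw [Finset.insert_comm, Finset.erase_insert (by simp [hr, hb])]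
      have h6 : (insert b' (insert b r)).erase b ∈ S := h5 ▸ h2.2
      rw [up_of_mem R.α hs h3 h4, map_smul, down_of_mem R.β h4 (by simp) h6,
        up_of_mem R.α hrS h2.1 h2.2]
      have e2 : (⟨(insert b' (insert b r)).erase b, h6⟩ : S) = ⟨insert b' r, h2.2⟩ :=
        Subtype.ext h5
      -- Both boxes can be added to r, so neither precedes the other and they do not form a diagonal
      -- pair.
      have hp1 : ¬R.fr.pred b b' := fun hp => hr (((Finset.mem_insert).1
        ((R.fr.mem_iff _).1 h2.2 b' (Finset.mem_insert_self _ _) b hp)).resolve_left hb)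
      have hp2 : ¬R.fr.pred b' b := fun hp => h2.1 (((Finset.mem_insert).1
        ((R.fr.mem_iff _).1 hs b (Finset.mem_insert_self _ _) b' hp)).resolve_left hb.symm)
      have hd1 : ¬R.fr.diag b b' := fun hp => by
        obtain ⟨c, -, -, h7, h8, -⟩ := R.fr.diag_between hp
        have hc := ((Finset.mem_insert).1 ((R.fr.mem_iff _).1 h2.2 b'
          (Finset.mem_insert_self _ _) c h8)).resolve_left (R.fr.pred_lt h8).ne
        exact hr ((R.fr.mem_iff _).1 hrS c hc b h7)
      have hd2 : ¬R.fr.diag b' b := fun hp => by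
        obtain ⟨c, -, -, h7, h8, -⟩ := R.fr.diag_between hp
        have hc := ((Finset.mem_insert).1 ((R.fr.mem_iff _).1 hs b
          (Finset.mem_insert_self _ _) c h8)).resolve_left (R.fr.pred_lt h8).ne
        exact h2.1 ((R.fr.mem_iff _).1 hrS c hc b' h7)
      rw [e2, h5, R.RF.insert_eq hr h2.1 hb, R.RE.insert_eq h2.1 hr hb.symm, smul_smul, smul_smul]
      congr 1
      linear_combination (R.α r b' * R.β r b) * R.cross hb hp1 hp2 hd1 hd2
    · rw [up_of_not R.α hrS h2, smul_zero]
      by_cases h3 : b' ∉ insert b r ∧ insert b' (insert b r) ∈ S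
      · rw [up_of_mem R.α hs h3.1 h3.2, map_smul, down_of_not R.β h3.2, smul_zero]
        rintro ⟨-, h4⟩
        rw [Finset.insert_comm, Finset.erase_insert (by simp [hr, hb])] at h4
        exact h2 ⟨fun h => h3.1 (Finset.mem_insert_of_mem h), h4⟩
      · rw [up_of_not R.α hs h3, map_zero]
  · rw [down_of_not R.β hs h1, map_zero]
    by_cases h3 : b' ∉ s ∧ insert b' s ∈ S
    · rw [up_of_mem R.α hs h3.1 h3.2, map_smul, down_of_not R.β h3.2, smul_zero]
      rintro ⟨h4, h5⟩
      have h6 : b ∈ s := (Finset.mem_insert.1 h4).resolve_left hb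
      refine h1 ⟨h6, ?_⟩
      -- If b can be removed after adding b', it can be removed before: intersect the result with s.
      convert R.fr.inter_mem h5 hs using 1
      ext x
      simp only [Finset.mem_erase, Finset.mem_inter, Finset.mem_insert]
      tauto
    · rw [up_of_not R.α hs h3, map_zero]

lemma quadF_diagonal (hq : q ≠ 0) (hd : d ≠ 0) (e : Expansion) (i : ZMod 2) (b : B) (k l : ℤ) :
    quadF q d i (R.fr.col b) (fun k => diagonal fun s : S => e.coeff (R.φ s i) k)
      (fun l => R.fr.pos b ^ l • up S R.α b) k l = 0 := by
  refine Finsupp.lhom_ext' fun ⟨s, hs⟩ => LinearMap.ext_ring ?_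
  simp only [LinearMap.comp_apply, Finsupp.lsingle_apply, LinearMap.zero_apply]
  refine quadF_eigen i (R.fr.col b) (R.fr.pos_ne_zero b) (c0 := fun k => e.coeff (R.φ s i) k)
    (c := fun k => e.coeff (R.φ s i * (rootA q d (R.fr.col b) (R.fr.pos b) i)⁻¹) k)
    (fun k => diagonal_single _ _ _) (fun k => ?_) k l
    (expansion_quadF hq hd e i (R.fr.col b) (R.fr.pos b) (R.φ s i) k)
  by_cases h : b ∉ s ∧ insert b s ∈ S
  · rw [up_of_mem R.α hs h.1 h.2, map_smul, diagonal_single, R.φ_insert h.1, smul_comm]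
  · rw [up_of_not R.α hs h, map_zero, smul_zero]

lemma quadE_diagonal (hq : q ≠ 0) (hd : d ≠ 0) (e : Expansion) (i : ZMod 2) (b : B) (k l : ℤ) :
    quadE q d i (R.fr.col b) (fun k => diagonal fun s : S => e.coeff (R.φ s i) k)
      (fun l => R.fr.pos b ^ l • down S R.β b) k l = 0 := by
  refine Finsupp.lhom_ext' fun ⟨s, hs⟩ => LinearMap.ext_ring ?_
  simp only [LinearMap.comp_apply, Finsupp.lsingle_apply, LinearMap.zero_apply]
  by_cases h : b ∈ s ∧ s.erase b ∈ S
  · have hφ : R.φ s i = R.φ (s.erase b) i * (rootA q d (R.fr.col b) (R.fr.pos b) i)⁻¹ := by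
      rw [← R.φ_insert (Finset.notMem_erase _ _), Finset.insert_erase h.1]
    refine quadE_eigen i (R.fr.col b) (R.fr.pos_ne_zero b)
      (c0 := fun k => e.coeff (R.φ (s.erase b) i) k)
      (c := fun k => e.coeff (R.φ (s.erase b) i * (rootA q d (R.fr.col b) (R.fr.pos b) i)⁻¹) k)
      (fun k => ?_) (fun k => ?_) k l
      (expansion_quadF hq hd e i (R.fr.col b) (R.fr.pos b) (R.φ (s.erase b) i) k)
    · rw [diagonal_single, hφ]
    · rw [down_of_mem R.β hs h.1 h.2, map_smul, diagonal_single, smul_comm]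
  · have h0 : ∀ c : ℂ, down S R.β b (Finsupp.single ⟨s, hs⟩ c) = 0 := by
      intro c
      rw [← mul_one c, ← smul_eq_mul, ← Finsupp.smul_single, map_smul, down_of_not R.β hs h,
        smul_zero]
    unfold quadE gMulSwap gMul
    split_ifs <;> simp [h0, diagonal_single]

lemma op_EF (i j : ZMod 2) (k l : ℤ) :
    R.op (Free.E i k * Free.F j l - Free.F j l * Free.E i k) =
      R.op (if i = j then (1 / (q - q⁻¹)) • (Free.Kplus i (k + l) - Free.Kminus i (k + l))
        else 0) := by
  rw [map_sub, map_mul, map_mul, op_E, op_F]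
  have key := current_commutator (col := R.fr.col) R.locFinite_down R.locFinite_up
    R.fr.pos_ne_zero (fun x y hxy => R.down_comm_up hxy) i j k l
  split_ifs at key ⊢ with hij
  · rw [map_smul, map_sub, op_Kplus, op_Kminus]
    refine Finsupp.lhom_ext' fun ⟨s, hs⟩ => LinearMap.ext_ring ?_
    simp only [LinearMap.comp_apply, Finsupp.lsingle_apply]
    -- One finite set T is chosen large enough both for the truncated commutator and for the sum of
    -- residues.
    obtain ⟨T, h1, h2⟩ := ((key (Finsupp.single ⟨s, hs⟩ 1)).and
      (R.diagonal_EF s hs i (k + l))).exists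
    rw [h1, LinearMap.smul_apply, LinearMap.sub_apply, diagonal_single, diagonal_single,
      ← sub_smul, smul_smul, ← h2, LinearMap.sum_apply, Finset.sum_smul]
    refine Finset.sum_congr rfl fun b _ => ?_
    rw [LinearMap.smul_apply, LinearMap.sub_apply, Module.End.mul_apply, Module.End.mul_apply,
      mul_smul, sub_smul]
    congr 2
    · split_ifs with h
      · have h3 : (insert b s).erase b ∈ S := by rwa [Finset.erase_insert h.1]
        have e : (⟨(insert b s).erase b, h3⟩ : S) = ⟨s, hs⟩ := Subtype.ext (Finset.erase_insert h.1)
        rw [up_of_mem R.α hs h.1 h.2, map_smul, down_of_mem R.β h.2 (by simp) h3, e,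
          Finset.erase_insert h.1, smul_smul]
      · rw [up_of_not R.α hs h, map_zero, zero_smul]
    · split_ifs with h
      · have h3 : insert b (s.erase b) ∈ S := by rwa [Finset.insert_erase h.1]
        have e : (⟨insert b (s.erase b), h3⟩ : S) = ⟨s, hs⟩ := Subtype.ext (Finset.insert_erase h.1)
        rw [down_of_mem R.β hs h.1 h.2, map_smul, up_of_mem R.α h.2 (by simp) h3, e, smul_smul,
          mul_comm]
      · rw [down_of_not R.β hs h, map_zero, zero_smul]
  · rw [map_zero]
    exact key.eq_zero fun _ => rfl

theorem op_rel (hq : q ≠ 0) (hd : d ≠ 0) {x y : Free} (h : Rel q d x y) : R.op x = R.op y := by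
  have hE : ∀ i, (fun k => R.op (Free.E i k)) = current R.fr.col R.fr.pos (down S R.β) i :=
    fun i => funext (R.op_E i)
  have hF : ∀ i, (fun k => R.op (Free.F i k)) = current R.fr.col R.fr.pos (up S R.α) i :=
    fun i => funext (R.op_F i)
  have hKp : ∀ i, (fun k => R.op (Free.Kplus i k))
      = fun k => diagonal fun s : S => expansionInfty.coeff (R.φ s i) k :=
    fun i => funext (R.op_Kplus i)
  have hKm : ∀ i, (fun k => R.op (Free.Kminus i k))
      = fun k => diagonal fun s : S => expansionZero.coeff (R.φ s i) k :=
    fun i => funext (R.op_Kminus i)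
  have hij : ∀ i : ZMod 2, i ≠ i + 1 := by decide
  cases h with
  | t_tinv => simp [op_ι, opGen]
  | tinv_t => simp [op_ι, opGen]
  | t_central x => simp [op_ι, opGen]
  | K_Kinv i =>
    rw [map_mul, op_Kplus, op_Kminus, diagonal_mul, map_one, ← diagonal_one]
    congr 1
    funext s
    exact R.coeff_mul s i
  | Kinv_K i =>
    rw [map_mul, op_Kplus, op_Kminus, diagonal_mul, map_one, ← diagonal_one]
    congr 1
    funext s
    exact (mul_comm _ _).trans (R.coeff_mul s i)
  | KpKp i j k l => rw [map_mul, map_mul, op_Kplus, op_Kplus, diagonal_comm]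
  | KmKm i j k l => rw [map_mul, map_mul, op_Kminus, op_Kminus, diagonal_comm]
  | KpKm i j k l => rw [map_mul, map_mul, op_Kplus, op_Kminus, diagonal_comm]
  | KpE i j k l =>
    refine (map_quadE (A := Free) (A' := Module.End ℂ (S →₀ ℂ)) R.op q d i j _ _ k l).trans ?_
    rw [map_zero, hE, hKp]
    refine current_quadE_diagonal R.locFinite_down _ i j (fun b hb => ?_) k l
    subst hb
    exact R.quadE_diagonal hq hd expansionInfty i b
  | KmE i j k l =>
    refine (map_quadE (A := Free) (A' := Module.End ℂ (S →₀ ℂ)) R.op q d i j _ _ k l).trans ?_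
    rw [map_zero, hE, hKm]
    refine current_quadE_diagonal R.locFinite_down _ i j (fun b hb => ?_) k l
    subst hb
    exact R.quadE_diagonal hq hd expansionZero i b
  | KpF i j k l =>
    refine (map_quadF (A := Free) (A' := Module.End ℂ (S →₀ ℂ)) R.op q d i j _ _ k l).trans ?_
    rw [map_zero, hF, hKp]
    refine current_quadF_diagonal R.locFinite_up _ i j (fun b hb => ?_) k l
    subst hb
    exact R.quadF_diagonal hq hd expansionInfty i b
  | KmF i j k l =>
    refine (map_quadF (A := Free) (A' := Module.End ℂ (S →₀ ℂ)) R.op q d i j _ _ k l).trans ?_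
    rw [map_zero, hF, hKm]
    refine current_quadF_diagonal R.locFinite_up _ i j (fun b hb => ?_) k l
    subst hb
    exact R.quadF_diagonal hq hd expansionZero i b
  | EF i j k l => exact R.op_EF i j k l
  | EE i j k l =>
    refine (map_quadE (A := Free) (A' := Module.End ℂ (S →₀ ℂ)) R.op q d i j _ _ k l).trans ?_
    rw [map_zero, hE, hE]
    exact current_quadE R.locFinite_down R.fr.pos_ne_zero R.RE.down_down i j k l
  | FF i j k l =>
    refine (map_quadF (A := Free) (A' := Module.End ℂ (S →₀ ℂ)) R.op q d i j _ _ k l).trans ?_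
    rw [map_zero, hF, hF]
    exact current_quadF R.locFinite_up R.fr.pos_ne_zero R.RF.up_up i j k l
  | serreE i k l =>
    refine (map_serre (A := Free) (A' := Module.End ℂ (S →₀ ℂ)) R.op q _ _ k l).trans ?_
    rw [map_zero, hE, hE]
    exact current_serre hq R.locFinite_down
      (fun x y z w hxy hxz hw => R.RE.serreSum_down hq hd hxy hxz hw) (hij i) k l
  | serreF i k l =>
    refine (map_serre (A := Free) (A' := Module.End ℂ (S →₀ ℂ)) R.op q _ _ k l).trans ?_
    rw [map_zero, hF, hF]
    exact current_serre hq R.locFinite_up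
      (fun x y z w hxy hxz hw => R.RF.serreSum_eq_zero hq hd hxy hxz hw) (hij i) k l

/-- The action of the algebra. -/
def action (hq : q ≠ 0) (hd : d ≠ 0) : QTA q d →ₐ[ℂ] Module.End ℂ (S →₀ ℂ) :=
  RingQuot.liftAlgHom ℂ ⟨R.op, fun _ _ h => R.op_rel hq hd h⟩

lemma action_mk (hq : q ≠ 0) (hd : d ≠ 0) (x : Free) :
    R.action hq hd (QTA.mk q d x) = R.op x := by
  unfold action QTA.mk
  exact RingQuot.liftAlgHom_mkAlgHom_apply _ _ _ _

/-- The module structure on the space with basis `S`. -/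
abbrev module (hq : q ≠ 0) (hd : d ≠ 0) : Module (QTA q d) (S →₀ ℂ) :=
  Module.compHom _ (R.action hq hd).toRingHom

end Rep

end Rep

/-! ### Coefficients from weights -/

section Geometry

variable {B : Type} [LinearOrder B] {S : Set (Finset B)} {q d : ℂ}

namespace Frame

variable (fr : Frame S q d)

/-- The `ℓ`-weight of a box. -/
def boxWeight (b : B) (j : ZMod 2) : RatFunc ℂ := (rootA q d (fr.col b) (fr.pos b) j)⁻¹

/-- The `ℓ`-weight of a state. -/
def weight (Ψ : ZMod 2 → RatFunc ℂ) (s : Finset B) (j : ZMod 2) : RatFunc ℂ :=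
  Ψ j * ∏ b ∈ s, fr.boxWeight b j

/-- The part of the `ℓ`-weight from the boxes below `b`. -/
def weightBelow (Ψ : ZMod 2 → RatFunc ℂ) (s : Finset B) (b : B) (j : ZMod 2) : RatFunc ℂ :=
  Ψ j * ∏ b' ∈ s with b' < b, fr.boxWeight b' j

/-- The part of the `ℓ`-weight from the boxes above `b`. -/
def weightAbove (s : Finset B) (b : B) (j : ZMod 2) : RatFunc ℂ :=
  ∏ b' ∈ s with b < b', fr.boxWeight b' j

end Frame

/-- The box `b` can be added to or removed from `s`. -/
def IsCorner (S : Set (Finset B)) (s : Finset B) (b : B) : Prop :=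
  (b ∉ s ∧ insert b s ∈ S) ∨ (b ∈ s ∧ s.erase b ∈ S)

/-- A frame together with a highest weight such that the weights of the states have simple poles
exactly at the corners. -/
structure Geometry (S : Set (Finset B)) (q d : ℂ) extends Frame S q d where
  Ψ : ZMod 2 → RatFunc ℂ
  hq : q ≠ 0
  hd : d ≠ 0
  q₂_ne_one : q₂ q ≠ 1
  pos_inj : ∀ {a b}, col a = col b → pos a = pos b → a = b
  finite_add : ∀ s ∈ S, {b | b ∉ s ∧ insert b s ∈ S}.Finite
  Ψ_ne_zero : ∀ j, Ψ j ≠ 0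
  order_infty : ∀ j, (expandInfty (Ψ j)).order = 0
  order_zero : ∀ j, ordAt 0 (Ψ j) = 0
  lead_mul : ∀ j, lead expandInfty (Ψ j) * leadAt 0 (Ψ j) = 1
  ord_corner : ∀ s ∈ S, ∀ b, IsCorner S s b →
    ordAt (pos b) (toFrame.weight Ψ s (col b)) = -1
  ord_nonneg : ∀ s ∈ S, ∀ i p, (∀ b, IsCorner S s b → col b = i → pos b ≠ p) →
    0 ≤ ordAt p (toFrame.weight Ψ s i)
  exists_ord : ∀ b, ∃ i p, ordAt p (toFrame.boxWeight b i) ≠ 0 ∧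
    ∀ b' < b, ordAt p (toFrame.boxWeight b' i) = 0

namespace Frame

variable (fr : Frame S q d)

/-- The leading coefficient of the weight of the box `u` at the position of the box `x`. -/
def γ (u x : B) : ℂ := leadAt (fr.pos x) (fr.boxWeight u (fr.col x))

variable {fr}

lemma boxWeight_ne_zero (hq : q ≠ 0) (hd : d ≠ 0) (b : B) (j : ZMod 2) :
    fr.boxWeight b j ≠ 0 := inv_ne_zero (rootA_ne_zero hq hd _ _ _)

lemma γ_ne_zero (hq : q ≠ 0) (hd : d ≠ 0) (u x : B) : fr.γ u x ≠ 0 :=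
  lead_ne_zero _ (boxWeight_ne_zero hq hd _ _)

lemma diag_lt {a b : B} (h : fr.diag a b) : a < b := by
  obtain ⟨c, -, -, h1, h2, -⟩ := fr.diag_between h
  exact (fr.pred_lt h1).trans (fr.pred_lt h2)

lemma G_ne_zero {u x : B} (h : u ≠ x) (h1 : ¬fr.pred x u) (h2 : ¬fr.diag u x) :
    fr.G u x ≠ 0 := fun h0 => (fr.of_gVal h.symm h0).elim h1 h2

lemma γ_eq (hq : q ≠ 0) (hd : d ≠ 0) {u x : B} (h1 : fr.G u x ≠ 0) (h2 : fr.G x u ≠ 0) :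
    fr.γ u x = fr.G u x / (-sgn (fr.col u) (fr.col x) * fr.G x u) :=
  leadAt_rootA_inv hq hd h1 h2

lemma ordAt_boxWeight_of_ne (hq : q ≠ 0) (hd : d ≠ 0) {u x : B} (h1 : fr.G u x ≠ 0)
    (h2 : fr.G x u ≠ 0) : ordAt (fr.pos x) (fr.boxWeight u (fr.col x)) = 0 :=
  ordAt_rootA_inv_of_ne hq hd h1 h2

end Frame

namespace Geometry

variable (g : Geometry S q d)

/-- The coefficients of the raising operators. -/
def coeffF (s : Finset B) (b : B) : ℂ := leadAt (g.pos b) (g.weightAbove s b (g.col b))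

/-- The coefficients of the lowering operators. -/
def coeffE (s : Finset B) (b : B) : ℂ :=
  1 / (q - q⁻¹) * leadAt (g.pos b) (g.weightBelow g.Ψ s b (g.col b) / RatFunc.X)

/-- The raising operators `F`. -/
def raisingF : g.toFrame.Raising g.coeffF where
  -- The coefficient of x sees only boxes above x. In the other case no factor appears, and `N` is
  -- arranged to supply g itself.
  ρ u x := if x < u then g.γ u x else 1
  ε u x := if x < u then 1 else -sgn (g.col u) (g.col x)
  N u x := -sgn (g.col u) (g.col x) * if u < x then g.G u x else g.G x u
  insert_eq {s u x} hu hx hux := by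
    unfold coeffF Frame.weightAbove
    rw [Finset.filter_insert]
    split_ifs with h
    · rw [Finset.prod_insert (by simp [hu]), map_mul, mul_comm]
      rfl
    · rw [mul_one]
  N_comm u x := by
    rw [sgn_comm]
    rcases lt_trichotomy u x with h | rfl | h <;> simp [*, not_lt_of_gt]
  N_ne_zero {u x} h h1 h2 := by
    refine mul_ne_zero (neg_ne_zero.2 (sgn_ne_zero _ _)) ?_
    split_ifs with h3
    · exact Frame.G_ne_zero h (fun hp => h3.not_gt (g.pred_lt hp)) h1
    · exact Frame.G_ne_zero h.symm (fun hp => h3 (g.pred_lt hp)) h2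
  N_mul {u x} h h1 h2 h3 := by
    have hs := sgn_ne_zero (g.col u) (g.col x)
    rcases lt_or_gt_of_ne h with h4 | h4
    · simp [h4, h4.not_gt]
    · have h5 := Frame.G_ne_zero (fr := g.toFrame) h h3 h1
      have h6 := Frame.G_ne_zero (fr := g.toFrame) h.symm (fun hp => h4.not_gt (g.pred_lt hp)) h2
      rw [if_pos h4, if_pos h4, if_neg h4.not_gt, Frame.γ_eq g.hq g.hd h5 h6]
      field_simp
  ε_comm {u x} h := by
    have hs := sgn_mul_self (g.col u) (g.col x)
    rw [sgn_comm (g.col x)]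
    rcases lt_or_gt_of_ne h with h4 | h4
    · simp [h4, h4.not_gt, hs]
    · simp [h4, h4.not_gt]

/-- The lowering operators `E`. -/
def raisingE : g.toFrame.Raising g.coeffE where
  ρ u x := if u < x then g.γ u x else 1
  ε u x := if u < x then 1 else -sgn (g.col u) (g.col x)
  -- The number γ is a leading coefficient, so it is nonzero even where the box weight has a zero or
  -- a pole, which happens when u precedes x.
  N u x := if u < x then g.G u x / g.γ u x else g.G x u / g.γ x u
  insert_eq {s u x} hu hx hux := by
    unfold coeffE Frame.weightBelow
    rw [Finset.filter_insert]
    split_ifs with h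
    · rw [Finset.prod_insert (by simp [hu]), mul_left_comm, mul_div_assoc, map_mul]
      unfold Frame.γ
      ring
    · rw [mul_one]
  N_comm u x := by
    rcases lt_trichotomy u x with h | rfl | h <;> simp [*, not_lt_of_gt]
  N_ne_zero {u x} h h1 h2 := by
    split_ifs with h3
    · exact div_ne_zero (Frame.G_ne_zero h (fun hp => h3.not_gt (g.pred_lt hp)) h1)
        (Frame.γ_ne_zero g.hq g.hd _ _)
    · exact div_ne_zero (Frame.G_ne_zero h.symm (fun hp => h3 (g.pred_lt hp)) h2)
        (Frame.γ_ne_zero g.hq g.hd _ _)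
  N_mul {u x} h h1 h2 h3 := by
    have hs := sgn_ne_zero (g.col u) (g.col x)
    rcases lt_or_gt_of_ne h with h4 | h4
    · rw [if_pos h4, if_pos h4, if_pos h4, one_mul,
        div_mul_cancel₀ _ (Frame.γ_ne_zero g.hq g.hd _ _)]
    · have h5 := Frame.G_ne_zero (fr := g.toFrame) h h3 h1
      have h6 := Frame.G_ne_zero (fr := g.toFrame) h.symm (fun hp => h4.not_gt (g.pred_lt hp)) h2
      rw [if_neg h4.not_gt, if_neg h4.not_gt, if_neg h4.not_gt, mul_one,
        Frame.γ_eq g.hq g.hd h6 h5, sgn_comm]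
      field_simp
  ε_comm {u x} h := by
    have hs := sgn_mul_self (g.col u) (g.col x)
    rw [sgn_comm (g.col x)]
    rcases lt_or_gt_of_ne h with h4 | h4
    · simp [h4, h4.not_gt]
    · simp [h4, h4.not_gt, hs]

lemma weight_ne_zero (s : Finset B) (j : ZMod 2) : g.weight g.Ψ s j ≠ 0 :=
  mul_ne_zero (g.Ψ_ne_zero j)
    (Finset.prod_ne_zero_iff.2 fun _ _ => Frame.boxWeight_ne_zero g.hq g.hd _ _)

lemma weightAbove_ne_zero (s : Finset B) (b : B) (j : ZMod 2) : g.weightAbove s b j ≠ 0 :=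
  Finset.prod_ne_zero_iff.2 fun _ _ => Frame.boxWeight_ne_zero g.hq g.hd _ _

lemma weightBelow_ne_zero (s : Finset B) (b : B) (j : ZMod 2) : g.weightBelow g.Ψ s b j ≠ 0 :=
  mul_ne_zero (g.Ψ_ne_zero j)
    (Finset.prod_ne_zero_iff.2 fun _ _ => Frame.boxWeight_ne_zero g.hq g.hd _ _)

lemma weight_order_infty (s : Finset B) (j : ZMod 2) :
    (expandInfty (g.weight g.Ψ s j)).order = 0 := by
  have h : ∀ b ∈ s, g.boxWeight b j ≠ 0 := fun b _ => Frame.boxWeight_ne_zero g.hq g.hd b j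
  rw [Frame.weight, order_hom_mul _ (g.Ψ_ne_zero j) (Finset.prod_ne_zero_iff.2 h),
    order_hom_prod _ _ _ h, g.order_infty, zero_add]
  exact Finset.sum_eq_zero fun b _ => (order_rootA_inv_infty g.hq g.hd _ _ _).1

lemma weight_order_zero (s : Finset B) (j : ZMod 2) : ordAt 0 (g.weight g.Ψ s j) = 0 := by
  have h : ∀ b ∈ s, g.boxWeight b j ≠ 0 := fun b _ => Frame.boxWeight_ne_zero g.hq g.hd b j
  have h0 := g.order_zero j
  unfold ordAt at h0 ⊢
  rw [Frame.weight, order_hom_mul _ (g.Ψ_ne_zero j) (Finset.prod_ne_zero_iff.2 h),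
    order_hom_prod _ _ _ h, h0, zero_add]
  exact Finset.sum_eq_zero fun b _ => (order_rootA_inv_zero g.hq g.hd _ _ (g.pos_ne_zero b)).1

lemma weight_lead_mul (s : Finset B) (j : ZMod 2) :
    lead expandInfty (g.weight g.Ψ s j) * leadAt 0 (g.weight g.Ψ s j) = 1 := by
  rw [Frame.weight, map_mul, map_mul, map_prod, map_prod, mul_mul_mul_comm, g.lead_mul, one_mul,
    ← Finset.prod_mul_distrib]
  refine Finset.prod_eq_one fun b _ => ?_
  rw [Frame.boxWeight, (order_rootA_inv_infty g.hq g.hd _ _ _).2,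
    (order_rootA_inv_zero g.hq g.hd _ _ (g.pos_ne_zero b)).2]
  have h1 := q₁_ne_zero g.hq g.hd
  have h2 := q₂_ne_zero g.hq
  have h3 := q₃_ne_zero g.hq g.hd
  split_ifs <;> field_simp

lemma coeffInfty_weight_zero (s : Finset B) (j : ZMod 2) :
    coeffInfty (g.weight g.Ψ s j) 0 = lead expandInfty (g.weight g.Ψ s j) := by
  rw [coeffInfty_eq, lead_eq_coeff, weight_order_infty]

lemma coeffZero_weight_zero (s : Finset B) (j : ZMod 2) :
    coeffZero (g.weight g.Ψ s j) 0 = leadAt 0 (g.weight g.Ψ s j) := by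
  have h := g.weight_order_zero s j
  unfold ordAt at h
  rw [coeffZero_eq, leadAt, lead_eq_coeff, h]

/-- A box contributes q₂⁻¹ to one component and (q₁q₃)⁻¹ to the other; their product is 1, so the
level does not depend on the state. -/
lemma lead_weight_mul (s : Finset B) :
    lead expandInfty (g.weight g.Ψ s 0) * lead expandInfty (g.weight g.Ψ s 1) =
      lead expandInfty (g.Ψ 0) * lead expandInfty (g.Ψ 1) := by
  rw [Frame.weight, Frame.weight, map_mul, map_mul, map_prod, map_prod, mul_mul_mul_comm,
    ← Finset.prod_mul_distrib]
  convert mul_one _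
  refine Finset.prod_eq_one fun b _ => ?_
  rw [Frame.boxWeight, Frame.boxWeight, (order_rootA_inv_infty g.hq g.hd _ _ _).2,
    (order_rootA_inv_infty g.hq g.hd _ _ _).2]
  have h := q₁_mul_q₂_mul_q₃ g.hq g.hd
  have h1 := q₁_ne_zero g.hq g.hd
  have h2 := q₂_ne_zero g.hq
  have h3 := q₃_ne_zero g.hq g.hd
  have hc : ∀ i : ZMod 2, (i = 0 ∧ i ≠ 1) ∨ (i ≠ 0 ∧ i = 1) := by decide
  rcases hc (g.col b) with hc | hc
  · rw [if_pos hc.1, if_neg hc.2]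
    field_simp
    linear_combination -h
  · rw [if_neg hc.1, if_pos hc.2]
    field_simp
    linear_combination -h

/-- A box of s that has the corner b as a predecessor, or as the lower box of a diagonal pair, would
prevent b from being added or removed. The opposite relations contradict the order on boxes, so
neither g vanishes. -/
lemma ordAt_above_term {s : Finset B} (hs : s ∈ S) {b b' : B} (hb : IsCorner S s b) (hb' : b' ∈ s)
    (hlt : b < b') : ordAt (g.pos b) (g.boxWeight b' (g.col b)) = 0 := by
  have hp : ¬g.pred b b' := by
    intro hp
    rcases hb with hb | hb
    · exact hb.1 ((g.mem_iff _).1 hs b' hb' b hp)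
    · exact Finset.notMem_erase b s ((g.mem_iff _).1 hb.2 b'
        (Finset.mem_erase.2 ⟨hlt.ne', hb'⟩) b hp)
  have hdg : ¬g.diag b b' := by
    intro hdg
    obtain ⟨c, -, -, h1, h2, -⟩ := g.diag_between hdg
    have hc := (g.mem_iff _).1 hs b' hb' c h2
    rcases hb with hb | hb
    · exact hb.1 ((g.mem_iff _).1 hs c hc b h1)
    · exact Finset.notMem_erase b s ((g.mem_iff _).1 hb.2 c
        (Finset.mem_erase.2 ⟨(g.pred_lt h1).ne', hc⟩) b h1)
  exact Frame.ordAt_boxWeight_of_ne g.hq g.hd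
    (Frame.G_ne_zero hlt.ne' hp fun h => hlt.not_gt (Frame.diag_lt h))
    (Frame.G_ne_zero hlt.ne (fun h => hlt.not_gt (g.pred_lt h)) hdg)

lemma ordAt_weightAbove {s : Finset B} (hs : s ∈ S) {b : B} (hb : IsCorner S s b) :
    ordAt (g.pos b) (g.weightAbove s b (g.col b)) = 0 := by
  rw [ordAt, Frame.weightAbove, order_hom_prod _ _ _
    (fun b _ => Frame.boxWeight_ne_zero g.hq g.hd b _)]
  refine Finset.sum_eq_zero fun b' hb' => ?_
  rw [Finset.mem_filter] at hb'
  exact g.ordAt_above_term hs hb hb'.1 hb'.2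

lemma ordAt_boxWeight_self (b : B) : ordAt (g.pos b) (g.boxWeight b (g.col b)) = 0 :=
  (ordAt_leadAt_rootA_inv_self g.hq g.hd g.q₂_ne_one _ (g.pos_ne_zero b)).1

lemma leadAt_boxWeight_self (b : B) : leadAt (g.pos b) (g.boxWeight b (g.col b)) = -1 :=
  (ordAt_leadAt_rootA_inv_self g.hq g.hd g.q₂_ne_one _ (g.pos_ne_zero b)).2

lemma weight_of_notMem {s : Finset B} {b : B} (hb : b ∉ s) (j : ZMod 2) :
    g.weight g.Ψ s j = g.weightBelow g.Ψ s b j * g.weightAbove s b j := by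
  have h : (s.filter fun b' => ¬b' < b) = s.filter fun b' => b < b' := by
    refine Finset.filter_congr fun x hx => ?_
    rw [not_lt, le_iff_lt_or_eq, or_iff_left]
    rintro rfl
    exact hb hx
  rw [Frame.weight, Frame.weightBelow, Frame.weightAbove,
    ← Finset.prod_filter_mul_prod_filter_not s (fun b' => b' < b), h, mul_assoc]

lemma weightBelow_erase (s : Finset B) (b : B) (j : ZMod 2) :
    g.weightBelow g.Ψ (s.erase b) b j = g.weightBelow g.Ψ s b j := by
  unfold Frame.weightBelow
  congr 2
  ext x
  simp only [Finset.mem_filter, Finset.mem_erase]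
  exact ⟨fun h => ⟨h.1.2, h.2⟩, fun h => ⟨⟨h.2.ne, h.1⟩, h.2⟩⟩

lemma weightAbove_erase (s : Finset B) (b : B) (j : ZMod 2) :
    g.weightAbove (s.erase b) b j = g.weightAbove s b j := by
  unfold Frame.weightAbove
  congr 1
  ext x
  simp only [Finset.mem_filter, Finset.mem_erase]
  exact ⟨fun h => ⟨h.1.2, h.2⟩, fun h => ⟨⟨h.2.ne', h.1⟩, h.2⟩⟩

lemma weight_of_mem {s : Finset B} {b : B} (hb : b ∈ s) (j : ZMod 2) :
    g.weight g.Ψ s j =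
      g.boxWeight b j * (g.weightBelow g.Ψ s b j * g.weightAbove s b j) := by
  rw [← weightBelow_erase, ← weightAbove_erase, ← weight_of_notMem g (Finset.notMem_erase _ _),
    Frame.weight, Frame.weight, ← Finset.mul_prod_erase s _ hb, mul_left_comm]

/-- The boxes above and the box itself have order zero at this point, so the whole simple pole sits
in the lower part. Thus the leading coefficient defining `coeffE` is a residue. -/
lemma ordAt_weightBelow {s : Finset B} (hs : s ∈ S) {b : B} (hb : IsCorner S s b) :
    ordAt (g.pos b) (g.weightBelow g.Ψ s b (g.col b)) = -1 := by
  have h := g.ord_corner s hs b hb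
  have h1 := g.ordAt_weightAbove hs hb
  have h2 := g.ordAt_boxWeight_self b
  unfold ordAt at h h1 h2 ⊢
  have h3 := g.weightBelow_ne_zero s b (g.col b)
  have h4 := g.weightAbove_ne_zero s b (g.col b)
  by_cases hbs : b ∈ s
  · rw [g.weight_of_mem hbs, order_hom_mul _ (Frame.boxWeight_ne_zero g.hq g.hd _ _)
      (mul_ne_zero h3 h4), order_hom_mul _ h3 h4, h1, h2] at h
    lia
  · rw [g.weight_of_notMem hbs, order_hom_mul _ h3 h4, h1] at h
    lia

lemma ordAt_div_X {f : RatFunc ℂ} (hf : f ≠ 0) {p : ℂ} (hp : p ≠ 0) :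
    ordAt p (f / RatFunc.X) = ordAt p f := by
  have := (order_leading_X p).1
  unfold ordAt at this ⊢
  rw [order_hom_div _ hf RatFunc.X_ne_zero, this, if_neg hp, sub_zero]

lemma residue_weight {s : Finset B} (hs : s ∈ S) {b : B} (hb : IsCorner S s b) :
    residue (g.weight g.Ψ s (g.col b) / RatFunc.X) (g.pos b) =
      leadAt (g.pos b) (g.weight g.Ψ s (g.col b) / RatFunc.X) := by
  apply residue_eq_leadAt
  rw [ordAt_div_X (g.weight_ne_zero _ _) (g.pos_ne_zero b), g.ord_corner s hs b hb]

lemma coeffE_eq_residue {s : Finset B} (hs : s ∈ S) {b : B} (hb : IsCorner S s b) :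
    g.coeffE s b = 1 / (q - q⁻¹) *
      residue (g.weightBelow g.Ψ s b (g.col b) / RatFunc.X) (g.pos b) := by
  rw [coeffE, residue_eq_leadAt]
  rw [ordAt_div_X (g.weightBelow_ne_zero _ _ _) (g.pos_ne_zero b), g.ordAt_weightBelow hs hb]

lemma coeffF_eq_value {s : Finset B} (hs : s ∈ S) {b : B} (hb : IsCorner S s b) :
    g.coeffF s b = value (g.weightAbove s b (g.col b)) (g.pos b) :=
  (value_eq_leadAt (g.weightAbove_ne_zero _ _ _) (g.ordAt_weightAbove hs hb)).symm

/-- The full weight splits into the part above and the part below the box, and leading coefficients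
are multiplicative. -/
lemma coeffF_mul_coeffE {s : Finset B} {b : B} (hb : b ∉ s) : g.coeffF s b * g.coeffE s b =
    1 / (q - q⁻¹) * leadAt (g.pos b) (g.weight g.Ψ s (g.col b) / RatFunc.X) := by
  rw [coeffF, coeffE, g.weight_of_notMem hb, mul_comm (g.weightBelow _ _ _ _), mul_div_assoc,
    map_mul]
  ring

lemma coeffF_ne_zero (s : Finset B) (b : B) : g.coeffF s b ≠ 0 :=
  lead_ne_zero _ (g.weightAbove_ne_zero s b _)

lemma coeffE_ne_zero (s : Finset B) (b : B) : g.coeffE s b ≠ 0 := by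
  refine mul_ne_zero (one_div_ne_zero fun h => g.q₂_ne_one ?_)
    (lead_ne_zero _ (div_ne_zero (g.weightBelow_ne_zero s b _) RatFunc.X_ne_zero))
  have hq := g.hq
  field_simp at h
  rw [q₂]
  linear_combination h

lemma finite_corners (g : Geometry S q d) {s : Finset B} (hs : s ∈ S) :
    {b | IsCorner S s b}.Finite :=
  ((g.finite_add s hs).union s.finite_toSet).subset fun _ hb => hb.imp id And.left

-- Each corner contributes the residue of the full weight at its position, and these are all its
-- poles away from zero and infinity, where it has order zero. The partial fraction theorem then
-- gives both Cartan series at once.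
open Classical in
lemma diagonal_EF {s : Finset B} (hs : s ∈ S) (i : ZMod 2) (k : ℤ) : ∀ᶠ T in Filter.atTop,
    ∑ b ∈ T with g.col b = i, g.pos b ^ k *
      ((if b ∉ s ∧ insert b s ∈ S then g.coeffF s b * g.coeffE s b else 0) -
        (if b ∈ s ∧ s.erase b ∈ S then g.coeffF (s.erase b) b * g.coeffE (s.erase b) b else 0)) =
      1 / (q - q⁻¹) * (coeffInfty (g.weight g.Ψ s i) k - coeffZero (g.weight g.Ψ s i) (-k)) := by
  set C := (g.finite_corners hs).toFinset with hC
  have hmem : ∀ b, b ∈ C ↔ IsCorner S s b := fun b => by simp [hC]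
  filter_upwards [Filter.eventually_ge_atTop C] with T hT
  -- Corners of one color have distinct positions, so the sum over poles is a sum over boxes.
  have hinj : Set.InjOn g.pos ↑(C.filter fun b => g.col b = i) := by
    intro a ha b hb hab
    exact g.pos_inj ((Finset.mem_filter.1 ha).2.trans (Finset.mem_filter.1 hb).2.symm) hab
  rw [coeffInfty_sub_coeffZero (g.weight_ne_zero s i)
    ((C.filter fun b => g.col b = i).image g.pos) ?_ ?_ ?_ (g.weight_order_infty s i).ge,
    Finset.sum_image hinj, Finset.mul_sum]
  · have hsub : (C.filter fun b => g.col b = i) ⊆ T.filter fun b => g.col b = i :=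
      Finset.filter_subset_filter _ hT
    rw [← Finset.sum_subset hsub]
    · refine Finset.sum_congr rfl fun b hb => ?_
      rw [Finset.mem_filter, hmem] at hb
      obtain ⟨hb, rfl⟩ := hb
      rw [g.residue_weight hs hb]
      rcases hb with hb | hb
      · rw [if_pos hb, if_neg fun h => hb.1 h.1, g.coeffF_mul_coeffE hb.1]
        ring
      -- For a removable box the coefficients refer to the state without it. The extra box weight
      -- has the value -1 here, which cancels the minus sign of the second term.
      · have e : g.weight g.Ψ s (g.col b) =
            g.boxWeight b (g.col b) * g.weight g.Ψ (s.erase b) (g.col b) := by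
          rw [g.weight_of_mem hb.1, g.weight_of_notMem (Finset.notMem_erase b s),
            weightBelow_erase, weightAbove_erase]
        rw [if_neg fun h => h.1 hb.1, if_pos hb, g.coeffF_mul_coeffE (Finset.notMem_erase b s), e,
          mul_div_assoc, map_mul, leadAt_boxWeight_self]
        ring
    · intro b hbT hbC
      have hb : ¬IsCorner S s b := fun h => hbC (Finset.mem_filter.2
        ⟨(hmem b).2 h, (Finset.mem_filter.1 hbT).2⟩)
      rw [IsCorner, not_or] at hb
      rw [if_neg hb.1, if_neg hb.2, sub_zero, mul_zero]
  · rw [Finset.mem_image]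
    rintro ⟨b, -, hb⟩
    exact g.pos_ne_zero b hb
  · intro p hp
    refine g.ord_nonneg s hs i p fun b hb hbi hbp => hp ?_
    exact Finset.mem_image.2 ⟨b, Finset.mem_filter.2 ⟨(hmem b).2 hb, hbi⟩, hbp⟩
  · intro p hp
    obtain ⟨b, hb, rfl⟩ := Finset.mem_image.1 hp
    rw [Finset.mem_filter, hmem] at hb
    rw [← hb.2, g.ord_corner s hs b hb.1]

/-- The representation on the states. -/
def rep : Rep S q d where
  fr := g.toFrame
  α := g.coeffF
  β := g.coeffE
  RF := g.raisingF
  RE := g.raisingE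
  φ := g.weight g.Ψ
  φ_insert hb j := by
    rw [Frame.weight, Frame.weight, Finset.prod_insert hb, mul_comm (g.boxWeight _ j), ← mul_assoc]
    rfl
  finite_add := g.finite_add
  cross {b b'} h h1 h2 h3 h4 := by
    simp only [raisingF, raisingE]
    split_ifs with hlt
    · have h5 := Frame.G_ne_zero (fr := g.toFrame) h h2 h3
      have h6 := Frame.G_ne_zero (fr := g.toFrame) h.symm h1 h4
      have hs := sgn_mul_self (g.col b) (g.col b')
      have hs0 := sgn_ne_zero (g.col b) (g.col b')
      rw [Frame.γ_eq g.hq g.hd h5 h6, Frame.γ_eq g.hq g.hd h6 h5, sgn_comm (g.col b')]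
      field_simp
      linear_combination -hs
    · rw [mul_one]
  diagonal_EF s hs i k := g.diagonal_EF hs i k
  coeffInfty_neg s i k hk := by
    rw [coeffInfty_eq]
    exact coeff_eq_zero_of_lt _ (by rwa [g.weight_order_infty])
  coeffZero_neg s i k hk := by
    rw [coeffZero_eq]
    have h := g.weight_order_zero s i
    unfold ordAt at h
    exact coeff_eq_zero_of_lt _ (by rwa [h])
  coeff_mul s i := by
    rw [coeffInfty_weight_zero, coeffZero_weight_zero, weight_lead_mul]

end Geometry

end Geometry

/-! ### Properties of the module -/

/-- A coefficient of a current to which only the box `b` contributes. -/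
lemma current_single_apply {B ι : Type} {col : B → ZMod 2} {pos : B → ℂ}
    {f : B → Module.End ℂ (ι →₀ ℂ)} (hf : LocFinite f) (k : ℤ) (s t : ι) (b : B)
    (h : ∀ b', b' ≠ b → (f b' (Finsupp.single s 1)) t = 0) :
    (current col pos f (col b) k (Finsupp.single s 1)) t =
      pos b ^ k * (f b (Finsupp.single s 1)) t := by
  obtain ⟨T, h1, h2⟩ := ((approx_current col pos hf (col b) k
    (Finsupp.single s 1)).and (Filter.eventually_ge_atTop {b})).exists
  rw [h1]
  simp only [partialCurrent, Finset.sum_apply, LinearMap.sum_apply, Finsupp.finsetSum_apply]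
  rw [Finset.sum_eq_single_of_mem b]
  · rfl
  · exact Finset.mem_filter.2 ⟨h2 (Finset.mem_singleton_self b), rfl⟩
  · intro b' _ hb'
    rw [LinearMap.smul_apply, Finsupp.smul_apply, h b' hb', smul_zero]

section Geometry

variable {B : Type} [LinearOrder B] {S : Set (Finset B)} {q d : ℂ}

lemma down_single_apply (α : Finset B → B → ℂ) {s t : Finset B} (hs : s ∈ S) (ht : t ∈ S) (b : B) :
    (down S α b (Finsupp.single ⟨s, hs⟩ 1)) ⟨t, ht⟩ =
      if b ∈ s ∧ s.erase b = t then α t b else 0 := by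
  by_cases h : b ∈ s ∧ s.erase b ∈ S
  · rw [down_of_mem α hs h.1 h.2, Finsupp.smul_apply, Finsupp.single_apply]
    by_cases h1 : s.erase b = t
    · subst h1
      simp [h.1]
    · simp [h1]
  · rw [down_of_not α hs h, Finsupp.zero_apply, if_neg]
    rintro ⟨h1, rfl⟩
    exact h ⟨h1, ht⟩

lemma up_single_apply (α : Finset B → B → ℂ) {s t : Finset B} (hs : s ∈ S) (ht : t ∈ S) (b : B) :
    (up S α b (Finsupp.single ⟨s, hs⟩ 1)) ⟨t, ht⟩ =
      if b ∉ s ∧ insert b s = t then α s b else 0 := by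
  by_cases h : b ∉ s ∧ insert b s ∈ S
  · rw [up_of_mem α hs h.1 h.2, Finsupp.smul_apply, Finsupp.single_apply]
    by_cases h1 : insert b s = t
    · subst h1
      simp [h.1]
    · simp [h1]
  · rw [up_of_not α hs h, Finsupp.zero_apply, if_neg]
    rintro ⟨h1, rfl⟩
    exact h ⟨h1, ht⟩

namespace Geometry

variable (g : Geometry S q d)

/-- Common boxes cancel in the orders at the separating point, and all other boxes on which the
states differ are smaller than b, so only b contributes. -/
lemma weight_ne_of_top {s t : Finset B} {b : B} (hs : b ∈ s) (ht : b ∉ t)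
    (h : ∀ x ∈ s \ t ∪ t \ s, x ≤ b) : g.weight g.Ψ s ≠ g.weight g.Ψ t := by
  intro hst
  obtain ⟨i, p, h1, h2⟩ := g.exists_ord b
  have e := congrFun hst i
  rw [Frame.weight, Frame.weight] at e
  have e1 := congrArg (ordAt p) (mul_left_cancel₀ (g.Ψ_ne_zero i) e)
  have hne : ∀ x, g.boxWeight x i ≠ 0 := fun x => Frame.boxWeight_ne_zero g.hq g.hd _ _
  unfold ordAt at e1 h1 h2
  rw [order_hom_prod _ _ _ fun x _ => hne x, order_hom_prod _ _ _ fun x _ => hne x,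
    ← Finset.sum_inter_add_sum_sdiff s t, ← Finset.sum_inter_add_sum_sdiff t s,
    Finset.inter_comm t s, add_right_inj, Finset.sum_eq_single_of_mem b (Finset.mem_sdiff.2 ⟨hs, ht⟩),
    Finset.sum_eq_zero (s := t \ s)] at e1
  · exact h1 e1
  · intro x hx
    refine h2 x (lt_of_le_of_ne (h x (Finset.mem_union_right _ hx)) ?_)
    rintro rfl
    exact ht (Finset.mem_sdiff.1 hx).1
  · intro x hx hxb
    exact h2 x (lt_of_le_of_ne (h x (Finset.mem_union_left _ hx)) hxb)

/-- Distinct states have distinct weights. -/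
theorem weight_injective : Function.Injective (g.weight g.Ψ) := by
  intro s t hst
  by_contra hne
  have hD : (s \ t ∪ t \ s).Nonempty := by
    rw [Finset.nonempty_iff_ne_empty]
    intro h0
    rw [Finset.union_eq_empty, Finset.sdiff_eq_empty_iff_subset,
      Finset.sdiff_eq_empty_iff_subset] at h0
    exact hne (h0.1.antisymm h0.2)
  have hb := Finset.max'_mem _ hD
  have hmax : ∀ x ∈ s \ t ∪ t \ s, x ≤ (s \ t ∪ t \ s).max' hD := fun x hx => Finset.le_max' _ x hx
  rcases Finset.mem_union.1 hb with h | h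
  · exact g.weight_ne_of_top (Finset.mem_sdiff.1 h).1 (Finset.mem_sdiff.1 h).2 hmax hst
  · exact g.weight_ne_of_top (Finset.mem_sdiff.1 h).1 (Finset.mem_sdiff.1 h).2
      (fun x hx => hmax x (by simpa only [Finset.union_comm] using hx)) hst.symm

/-- A rational function is determined by its expansion at infinity, so the coefficients of the K⁺
series alone separate the states. -/
lemma exists_coeffInfty_ne {s t : Finset B} (h : s ≠ t) :
    ∃ i k, coeffInfty (g.weight g.Ψ s i) k ≠ coeffInfty (g.weight g.Ψ t i) k := by
  by_contra hc
  push Not at hc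
  refine h (g.weight_injective (funext fun i => expandInfty.injective ?_))
  exact HahnSeries.ext (funext fun k => hc i k)

/-- Predecessors are smaller in the order, so the largest box precedes no box of the state. -/
lemma erase_max'_mem (fr : Frame S q d) {s : Finset B} (hs : s ∈ S) (h : s.Nonempty) :
    s.erase (s.max' h) ∈ S := by
  rw [fr.mem_iff] at hs ⊢
  intro b hb a hab
  have hb' := Finset.mem_erase.1 hb
  refine Finset.mem_erase.2 ⟨?_, hs b hb'.2 a hab⟩
  exact ((fr.pred_lt hab).trans_le (Finset.le_max' s b hb'.2)).ne

lemma empty_mem (fr : Frame S q d) : ∅ ∈ S :=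
  (fr.mem_iff _).2 fun _ hb => absurd hb (Finset.notMem_empty _)

/-! ### Invariant subspaces -/

section Invariant

variable {N : Submodule ℂ (S →₀ ℂ)} (hN : ∀ (x : Free), ∀ v ∈ N, g.rep.op x v ∈ N)

include hN

/-- An invariant subspace is spanned by basis vectors. -/
lemma single_mem {v : S →₀ ℂ} (hv : v ∈ N) {s : S} (hs : v s ≠ 0) : Finsupp.single s 1 ∈ N := by
  induction hn : v.support.card using Nat.strong_induction_on generalizing v with
  | _ n ih =>
    by_cases h : ∃ t, t ≠ s ∧ v t ≠ 0
    · obtain ⟨t, hts, ht⟩ := h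
      obtain ⟨i, k, hk⟩ := g.exists_coeffInfty_ne (fun h => hts (Subtype.ext h))
      have hap : ∀ r, (g.rep.op (Free.Kplus i k) v) r = coeffInfty (g.weight g.Ψ r i) k * v r := by
        intro r
        rw [g.rep.op_Kplus, ← dot_single_right, isTransp_diagonal, diagonal_single, map_smul,
          dot_single_right]
        rfl
      -- Subtracting the eigenvalue at t removes t from the support and keeps s, and the support
      -- never grows.
      have hw : g.rep.op (Free.Kplus i k) v - coeffInfty (g.weight g.Ψ t i) k • v ∈ N :=
        N.sub_mem (hN _ _ hv) (N.smul_mem _ hv)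
      have hwr : ∀ r, (g.rep.op (Free.Kplus i k) v - coeffInfty (g.weight g.Ψ t i) k • v) r =
          (coeffInfty (g.weight g.Ψ r i) k - coeffInfty (g.weight g.Ψ t i) k) * v r := by
        intro r
        rw [Finsupp.sub_apply, hap, Finsupp.smul_apply, smul_eq_mul, sub_mul]
      refine ih _ ?_ hw ?_ rfl
      · rw [← hn]
        apply Finset.card_lt_card
        refine (Finset.ssubset_iff_of_subset fun r hr => ?_).2 ⟨t, ?_, ?_⟩
        · rw [Finsupp.mem_support_iff, hwr] at hr
          exact Finsupp.mem_support_iff.2 (right_ne_zero_of_mul hr)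
        · exact Finsupp.mem_support_iff.2 ht
        · rw [Finsupp.mem_support_iff, hwr, sub_self, zero_mul, not_not]
      · rw [hwr]
        exact mul_ne_zero (sub_ne_zero.2 hk.symm) hs
    · push Not at h
      have e : Finsupp.single s 1 = (v s)⁻¹ • v := by
        ext t
        by_cases ht : t = s
        · subst ht
          simp [hs]
        · simp [Ne.symm ht, h t ht]
      rw [e]
      exact N.smul_mem _ hv

/-- One mode of the lowering current suffices: its result has a nonzero component at the smaller
state, and `single_mem` isolates that component. -/
lemma single_erase_mem {s : Finset B} (hs : s ∈ S) {b : B} (hb : b ∈ s) (h : s.erase b ∈ S)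
    (hsN : Finsupp.single ⟨s, hs⟩ 1 ∈ N) : Finsupp.single ⟨s.erase b, h⟩ 1 ∈ N := by
  refine g.single_mem hN (hN (Free.E (g.col b) 0) _ hsN) ?_
  rw [g.rep.op_E]
  change (current g.rep.fr.col _ _ (g.rep.fr.col b) _ _) _ ≠ 0
  rw [current_single_apply g.rep.locFinite_down 0 _ _ b, down_single_apply,
    if_pos ⟨hb, rfl⟩]
  · exact mul_ne_zero (zpow_ne_zero _ (g.pos_ne_zero b)) (g.coeffE_ne_zero _ _)
  · intro b' hb'
    rw [down_single_apply, if_neg]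
    rintro ⟨h1, h2⟩
    have : b' ∈ s.erase b := Finset.mem_erase.2 ⟨hb', h1⟩
    rw [← h2] at this
    exact Finset.notMem_erase _ _ this

lemma single_insert_mem {s : Finset B} (hs : s ∈ S) {b : B} (hb : b ∉ s) (h : insert b s ∈ S)
    (hsN : Finsupp.single ⟨s, hs⟩ 1 ∈ N) : Finsupp.single ⟨insert b s, h⟩ 1 ∈ N := by
  refine g.single_mem hN (hN (Free.F (g.col b) 0) _ hsN) ?_
  rw [g.rep.op_F]
  change (current g.rep.fr.col _ _ (g.rep.fr.col b) _ _) _ ≠ 0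
  rw [current_single_apply g.rep.locFinite_up 0 _ _ b, up_single_apply,
    if_pos ⟨hb, rfl⟩]
  · exact mul_ne_zero (zpow_ne_zero _ (g.pos_ne_zero b)) (g.coeffF_ne_zero _ _)
  · intro b' hb'
    rw [up_single_apply, if_neg]
    rintro ⟨h1, h2⟩
    have : b' ∈ insert b s := h2 ▸ Finset.mem_insert_self _ _
    exact h1 ((Finset.mem_insert.1 this).resolve_left hb')

lemma single_empty_mem {s : Finset B} (hs : s ∈ S) (hsN : Finsupp.single ⟨s, hs⟩ 1 ∈ N) :
    Finsupp.single ⟨∅, empty_mem g.toFrame⟩ 1 ∈ N := by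
  induction hn : s.card generalizing s with
  | zero =>
    obtain rfl := Finset.card_eq_zero.1 hn
    exact hsN
  | succ n ih =>
    have hne : s.Nonempty := Finset.card_pos.1 (by lia)
    have h := erase_max'_mem g.toFrame hs hne
    refine ih h (g.single_erase_mem hN hs (Finset.max'_mem _ _) h hsN) ?_
    rw [Finset.card_erase_of_mem (Finset.max'_mem _ _), hn]
    rfl

lemma single_mem_of_empty (h0 : Finsupp.single ⟨∅, empty_mem g.toFrame⟩ 1 ∈ N) {s : Finset B}
    (hs : s ∈ S) : Finsupp.single ⟨s, hs⟩ 1 ∈ N := by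
  induction hn : s.card generalizing s with
  | zero =>
    obtain rfl := Finset.card_eq_zero.1 hn
    exact h0
  | succ n ih =>
    have hne : s.Nonempty := Finset.card_pos.1 (by lia)
    have h := erase_max'_mem g.toFrame hs hne
    have hm := Finset.max'_mem s hne
    have h1 := ih h (by rw [Finset.card_erase_of_mem hm, hn]; rfl)
    have h2 := g.single_insert_mem hN h (Finset.notMem_erase _ _)
      (by rwa [Finset.insert_erase hm]) h1
    convert h2 using 3
    exact (Finset.insert_erase hm).symm

theorem eq_top_of_invariant {v : S →₀ ℂ} (hv : v ∈ N) (h0 : v ≠ 0) : N = ⊤ := by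
  obtain ⟨⟨s, hs⟩, hvs⟩ := Finsupp.ne_iff.1 h0
  have h1 := g.single_empty_mem hN hs (g.single_mem hN hv hvs)
  refine (Submodule.eq_top_iff').2 fun w => ?_
  induction w using Finsupp.induction_linear with
  | zero => exact N.zero_mem
  | add u v hu hv => exact N.add_mem hu hv
  | single t c =>
    rw [← mul_one c, ← smul_eq_mul, ← Finsupp.smul_single]
    exact N.smul_mem _ (g.single_mem_of_empty hN h1 t.2)

end Invariant

/-- The module structure on the space with a basis labeled by the states. -/
abbrev module : Module (QTA q d) (S →₀ ℂ) := g.rep.module g.hq g.hd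

lemma isScalarTower : letI := g.module; IsScalarTower ℂ (QTA q d) (S →₀ ℂ) := by
  let := g.module
  refine ⟨fun c x v => ?_⟩
  change g.rep.action g.hq g.hd (c • x) v = c • g.rep.action g.hq g.hd x v
  rw [map_smul, LinearMap.smul_apply]

lemma mk_smul (x : Free) (v : S →₀ ℂ) :
    letI := g.module; QTA.mk q d x • v = g.rep.op x v := by
  change g.rep.action g.hq g.hd (QTA.mk q d x) v = _
  rw [g.rep.action_mk]

theorem isSimpleModule : letI := g.module; IsSimpleModule (QTA q d) (S →₀ ℂ) := by
  let := g.module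
  have := g.isScalarTower
  have : Nontrivial (Submodule (QTA q d) (S →₀ ℂ)) := by
    rw [Submodule.nontrivial_iff]
    have : Nonempty S := ⟨⟨∅, empty_mem g.toFrame⟩⟩
    infer_instance
  refine { eq_bot_or_eq_top := fun N => or_iff_not_imp_left.2 fun hN => ?_ }
  obtain ⟨v, hv, h0⟩ := N.exists_mem_ne_zero_of_ne_bot hN
  have h := g.eq_top_of_invariant (N := N.restrictScalars ℂ)
    (fun x v hv => by rw [← g.mk_smul]; exact N.smul_mem _ hv) hv h0
  rwa [Submodule.restrictScalars_eq_top_iff] at h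

lemma isLWeightVector (s : S) : letI := g.module
    IsLWeightVector q d (g.weight g.Ψ s) (Finsupp.single s 1 : S →₀ ℂ) := by
  intro i k
  refine ⟨(g.mk_smul _ _).trans ?_, (g.mk_smul _ _).trans ?_⟩
  · rw [g.rep.op_Kplus, diagonal_single]
    rfl
  · rw [g.rep.op_Kminus, diagonal_single]
    rfl

theorem isTame : letI := g.module; IsTame q d (S →₀ ℂ) :=
  let := g.module
  ⟨S, Finsupp.basisSingleOne, fun s => g.weight g.Ψ s,
    g.weight_injective.comp Subtype.val_injective,
    fun s => by rw [Finsupp.coe_basisSingleOne]; exact g.isLWeightVector s⟩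

theorem isHighestLWeight : letI := g.module; IsHighestLWeight q d (S →₀ ℂ) g.Ψ := by
  let := g.module
  have := g.isSimpleModule
  refine ⟨Finsupp.single ⟨∅, empty_mem g.toFrame⟩ 1, ?_, fun i k => ?_, ?_⟩
  · convert g.isLWeightVector ⟨∅, empty_mem g.toFrame⟩
    funext j
    rw [Frame.weight, Finset.prod_empty, mul_one]
  · refine (g.mk_smul _ _).trans ?_
    rw [g.rep.op_E, current, total_single]
    refine finsum_eq_zero_of_forall_eq_zero fun b => ?_
    unfold currentTerm
    split_ifs
    · rw [LinearMap.smul_apply, down_of_not _ _ fun h => Finset.notMem_empty b h.1, smul_zero]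
    · rfl
  -- Generation is automatic in a simple module, since the highest weight vector is nonzero.
  · refine (IsSimpleOrder.eq_bot_or_eq_top _).resolve_left fun h => ?_
    rw [Submodule.span_singleton_eq_bot, Finsupp.single_eq_zero] at h
    exact one_ne_zero h

theorem hasLevel : letI := g.module
    HasLevel q d (S →₀ ℂ) (lead expandInfty (g.Ψ 0) * lead expandInfty (g.Ψ 1)) := by
  let := g.module
  intro v
  change (QTA.mk q d (Free.Kplus 0 0) * QTA.mk q d (Free.Kplus 1 0)) • v = _
  rw [← map_mul, g.mk_smul, map_mul, g.rep.op_Kplus, g.rep.op_Kplus, diagonal_mul]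
  induction v using Finsupp.induction_linear with
  | zero => simp
  | add u v hu hv => rw [map_add, hu, hv, smul_add]
  | single s c =>
    rw [diagonal_single, ← g.lead_weight_mul s, ← coeffInfty_weight_zero, ← coeffInfty_weight_zero]
    rfl

end Geometry

end Geometry

/-! ### Comparison with the combinatorial formulas -/

section Combinatorial

lemma finsum_subtype_eq {B M : Type} [AddCommMonoid M] (C : Set B) (f : C → M) (F : B → M)
    (h : ∀ b : C, f b = F b) (h0 : ∀ b ∉ C, F b = 0) : ∑ᶠ b, F b = ∑ᶠ b, f b := by
  rw [finsum_congr h, finsum_set_coe_eq_finsum_mem (f := F), finsum_mem_def,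
    Set.indicator_eq_self.2]
  intro b hb
  by_contra hC
  exact hb (h0 b hC)

open BoxData in
theorem Geometry.isCombinatorialModule {lq ld : ℂ} {D : BoxData}
    (g : Geometry D.states (Complex.exp lq) (Complex.exp ld)) (hcol : g.col = D.color)
    (hpos : g.pos = D.position lq ld) (hΨ : g.Ψ = D.Ψ) :
    letI := g.module; D.IsCombinatorialModule lq ld := by
  let := g.module
  have hw : ∀ s, g.weight g.Ψ s = D.weight lq ld s := by
    intro s
    funext j
    simp only [Frame.weight, BoxData.weight, Frame.boxWeight, BoxData.boxWeight, hcol, hpos, hΨ]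
  have ha : ∀ s b j, g.weightAbove s b j = D.weightAbove lq ld s b j := by
    intro s b j
    simp only [Frame.weightAbove, BoxData.weightAbove, Frame.boxWeight, BoxData.boxWeight, hcol,
      hpos]
  have hb : ∀ s b j, g.weightBelow g.Ψ s b j = D.weightBelow lq ld s b j := by
    intro s b j
    simp only [Frame.weightBelow, BoxData.weightBelow, Frame.boxWeight, BoxData.boxWeight, hcol,
      hpos, hΨ]
  refine ⟨fun s hs i => ?_, fun s hs i b hb => ?_, fun s hs => ?_, fun s hs i k => ?_,
    fun s hs i k => ?_, fun v => ?_⟩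
  · exact (g.finite_add s hs).subset fun b hb => hb.2
  · have h := g.ordAt_weightAbove hs (Or.inl hb.2)
    have h0 := g.weightAbove_ne_zero s b (g.col b)
    rw [hpos, hcol, hb.1, ha] at h
    rw [hcol, hb.1, ha] at h0
    exact regularAt_of_ordAt_nonneg h0 h.ge
  · rw [← hw]
    exact g.isLWeightVector ⟨s, hs⟩
  · refine (g.mk_smul _ _).trans ?_
    rw [g.rep.op_F, current, ket, total_single]
    apply finsum_subtype_eq
    · rintro ⟨b, hbi, hbs⟩
      change (D.coeffA lq ld s i b * D.position lq ld b ^ k) • ket (insert b s) hbs.2 =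
        currentTerm g.col g.pos (up D.states g.coeffF) i k b (Finsupp.single ⟨s, hs⟩ 1)
      rw [currentTerm, hcol, if_pos hbi, LinearMap.smul_apply, up_of_mem _ hs hbs.1 hbs.2,
        g.coeffF_eq_value hs (Or.inl hbs), smul_smul, hcol, hpos, ha, hbi, mul_comm]
      rfl
    · intro b hbC
      change currentTerm g.col g.pos (up D.states g.coeffF) i k b (Finsupp.single ⟨s, hs⟩ 1) = 0
      rw [currentTerm, hcol]
      split_ifs with h
      · rw [LinearMap.smul_apply, up_of_not _ hs fun h' => hbC ⟨h, h'⟩, smul_zero]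
      · rfl
  · refine (g.mk_smul _ _).trans ?_
    rw [g.rep.op_E, current, ket, total_single]
    apply finsum_subtype_eq
    · rintro ⟨b, hbi, hbs⟩
      change (D.coeffB lq ld s i b * D.position lq ld b ^ k) • ket (s.erase b) hbs.2 =
        currentTerm g.col g.pos (down D.states g.coeffE) i k b (Finsupp.single ⟨s, hs⟩ 1)
      rw [currentTerm, hcol, if_pos hbi, LinearMap.smul_apply, down_of_mem _ hs hbs.1 hbs.2,
        -- The operator uses the coefficient of the state without b and the formula that of the
        -- state with b. They agree because only boxes strictly below b enter.
        Geometry.coeffE, g.weightBelow_erase, ← Geometry.coeffE,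
        g.coeffE_eq_residue hs (Or.inr hbs), smul_smul, hcol, hpos, hb, hbi, mul_comm]
      rfl
    · intro b hbC
      change currentTerm g.col g.pos (down D.states g.coeffE) i k b (Finsupp.single ⟨s, hs⟩ 1) = 0
      rw [currentTerm, hcol]
      split_ifs with h
      · rw [LinearMap.smul_apply, down_of_not _ hs fun h' => hbC ⟨h, h'⟩, smul_zero]
      · rfl
  · refine (g.mk_smul _ _).trans ?_
    rw [g.rep.op_ι]
    rfl

end Combinatorial

/-! ### Pairs of partitions -/

section Planes

/-- The boxes in two planes. -/
abbrev PlaneBox : Type := Fin 2 ×ₗ ℕ ×ₗ ℕ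

namespace PlaneBox

/-- The box in the plane `z` with coordinates `(x, y)`. -/
def of (z : Fin 2) (x y : ℕ) : PlaneBox := toLex (z, toLex (y, x))

/-- The plane of a box. -/
def z (b : PlaneBox) : Fin 2 := (ofLex b).1

/-- The first coordinate of a box. -/
def x (b : PlaneBox) : ℕ := (ofLex (ofLex b).2).2

/-- The second coordinate of a box. -/
def y (b : PlaneBox) : ℕ := (ofLex (ofLex b).2).1

@[simp] lemma x_of (z : Fin 2) (x y : ℕ) : (of z x y).x = x := rfl

@[simp] lemma y_of (z : Fin 2) (x y : ℕ) : (of z x y).y = y := rfl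

lemma ext_iff' {a b : PlaneBox} : a = b ↔ a.z = b.z ∧ a.x = b.x ∧ a.y = b.y := by
  refine ⟨by rintro rfl; simp, fun ⟨h1, h2, h3⟩ => ?_⟩
  exact Prod.ext h1 (Prod.ext h3 h2)

lemma lt_iff' {a b : PlaneBox} :
    a < b ↔ a.z < b.z ∨ a.z = b.z ∧ (a.y < b.y ∨ a.y = b.y ∧ a.x < b.x) := by
  rw [Prod.Lex.lt_iff, Prod.Lex.lt_iff]
  rfl

/-- The box `a` lies immediately to the left of `b` or immediately below it. -/
def Pred (a b : PlaneBox) : Prop :=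
  a.z = b.z ∧ ((b.x = a.x + 1 ∧ b.y = a.y) ∨ (b.x = a.x ∧ b.y = a.y + 1))

/-- The box `b` is the diagonal neighbour of `a`. -/
def Diag (a b : PlaneBox) : Prop := a.z = b.z ∧ b.x = a.x + 1 ∧ b.y = a.y + 1

lemma Pred.lt {a b : PlaneBox} (h : Pred a b) : a < b := by
  rw [lt_iff']
  unfold Pred at h
  grind

/-- The box `b` has the integer coordinates `(x, y)` in the plane `z`. -/
def At (z : Fin 2) (x y : ℤ) (b : PlaneBox) : Prop := b.z = z ∧ (b.x : ℤ) = x ∧ (b.y : ℤ) = y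

lemma At.eq {z : Fin 2} {x y : ℤ} {a b : PlaneBox} (ha : At z x y a) (hb : At z x y b) : a = b := by
  unfold At at ha hb
  rw [ext_iff']
  grind

instance (z : Fin 2) (x y : ℤ) : DecidablePred (At z x y) :=
  fun _ => inferInstanceAs (Decidable (_ ∧ _ ∧ _))

end PlaneBox

open PlaneBox

/-- The pairs of partitions. -/
def partitionPairs : Set (Finset PlaneBox) :=
  {s | ∃ Y : Fin 2 → YoungDiagram,
    ∀ (z : Fin 2) (k i : ℕ), toLex (z, toLex (k, i)) ∈ s ↔ (i, k) ∈ Y z}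

/-- Steps to the left and down reach every smaller cell of the same plane, so closure under these
steps makes each plane a lower set. -/
lemma mem_partitionPairs (s : Finset PlaneBox) :
    s ∈ partitionPairs ↔ ∀ b ∈ s, ∀ a, Pred a b → a ∈ s := by
  constructor
  · rintro ⟨Y, hY⟩ b hb a hab
    have hb' : (b.x, b.y) ∈ Y b.z := (hY b.z b.y b.x).1 hb
    refine (hY a.z a.y a.x).2 ?_
    rw [hab.1]
    refine (Y b.z).isLowerSet (show (a.x, a.y) ≤ (b.x, b.y) from ?_) hb'
    rw [Prod.mk_le_mk]
    have := hab.2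
    lia
  · intro h
    have step : ∀ (z : Fin 2) (i k i' k' : ℕ), of z (i + i') (k + k') ∈ s → of z i k ∈ s := by
      intro z i k i' k'
      induction i' with
      | zero =>
        induction k' with
        | zero => exact id
        | succ n ih => exact fun hm => ih (h _ hm _ ⟨rfl, Or.inr ⟨rfl, rfl⟩⟩)
      | succ n ih => exact fun hm => ih (h _ hm _ ⟨rfl, Or.inl ⟨rfl, rfl⟩⟩)
    refine ⟨fun z => ⟨(s.filter fun b => b.z = z).image fun b => (b.x, b.y), ?_⟩, fun z k i => ?_⟩
    · rintro ⟨i, k⟩ ⟨i', k'⟩ hle hm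
      rw [Finset.mem_coe, Finset.mem_image] at hm ⊢
      obtain ⟨b, hb, he⟩ := hm
      obtain ⟨hbs, rfl⟩ := Finset.mem_filter.1 hb
      obtain ⟨h1, h2⟩ := Prod.mk_le_mk.1 hle
      obtain ⟨e1, e2⟩ := Prod.mk.inj he
      refine ⟨of b.z i' k', Finset.mem_filter.2 ⟨step _ _ _ (i - i') (k - k') ?_, rfl⟩, rfl⟩
      rw [Nat.add_sub_cancel' h1, Nat.add_sub_cancel' h2, ← e1, ← e2]
      exact hbs
    · rw [← YoungDiagram.mem_cells, Finset.mem_image]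
      constructor
      · intro hm
        exact ⟨of z i k, Finset.mem_filter.2 ⟨hm, rfl⟩, rfl⟩
      · rintro ⟨b, hb, he⟩
        obtain ⟨hbs, rfl⟩ := Finset.mem_filter.1 hb
        obtain ⟨rfl, rfl⟩ := Prod.mk.inj he
        exact hbs

/-- The position `(x, y)` in the plane `z` is outside the quadrant or occupied by a box of `s`. -/
def Filled (s : Finset PlaneBox) (z : Fin 2) (x y : ℤ) : Prop :=
  x < 0 ∨ y < 0 ∨ ∃ b ∈ s, At z x y b

lemma at_of (z : Fin 2) {x y : ℤ} (hx : 0 ≤ x) (hy : 0 ≤ y) :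
    At z x y (of z x.toNat y.toNat) := by
  refine ⟨rfl, ?_, ?_⟩ <;> simp [hx, hy]

lemma Filled.left {s : Finset PlaneBox} (hs : s ∈ partitionPairs) {z : Fin 2} {x y : ℤ}
    (h : Filled s z (x + 1) y) : Filled s z x y := by
  rcases h with h | h | ⟨b, hb, h⟩
  · exact Or.inl (by lia)
  · exact Or.inr (Or.inl h)
  · by_cases hx : x < 0
    · exact Or.inl hx
    · have ha := at_of z (not_lt.1 hx) (y := y) (by unfold At at h; lia)
      refine Or.inr (Or.inr ⟨_, (mem_partitionPairs s).1 hs b hb _ ?_, ha⟩)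
      unfold At at h ha
      unfold Pred
      lia

lemma Filled.down {s : Finset PlaneBox} (hs : s ∈ partitionPairs) {z : Fin 2} {x y : ℤ}
    (h : Filled s z x (y + 1)) : Filled s z x y := by
  rcases h with h | h | ⟨b, hb, h⟩
  · exact Or.inl h
  · exact Or.inr (Or.inl (by lia))
  · by_cases hy : y < 0
    · exact Or.inr (Or.inl hy)
    · have ha := at_of z (x := x) (by unfold At at h; lia) (not_lt.1 hy)
      refine Or.inr (Or.inr ⟨_, (mem_partitionPairs s).1 hs b hb _ ?_, ha⟩)
      unfold At at h ha
      unfold Pred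
      lia

/-- The combination of the occupation numbers around a position which gives the order of the weight
there. -/
def cornerOrder (f : ℤ → ℤ → ℤ) (x y : ℤ) : ℤ :=
  f x (y + 1) + f (x + 1) y + f (x - 1) (y - 1) - f x (y - 1) - f (x - 1) y - f (x + 1) (y + 1)

-- The highest weight contributes a zero at (-1, -1) and a pole at the origin. This is precisely
-- what `cornerOrder` gives for the complement of the quadrant, so the boundary needs no separate
-- treatment.
open Classical in
lemma cornerOrder_sum (s : Finset PlaneBox) (z : Fin 2) (x y : ℤ) :
    (if x = -1 ∧ y = -1 then 1 else 0) - (if x = 0 ∧ y = 0 then 1 else 0)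
      + ∑ b ∈ s, cornerOrder (fun x y => if At z x y b then 1 else 0) x y =
    cornerOrder (fun x y => if Filled s z x y then 1 else 0) x y := by
  have h : ∀ x y : ℤ, ∑ b ∈ s, (if At z x y b then (1 : ℤ) else 0) =
      (if Filled s z x y then 1 else 0) - if x < 0 ∨ y < 0 then 1 else 0 := by
    intro x y
    by_cases hxy : x < 0 ∨ y < 0
    · rw [if_pos hxy, if_pos (show Filled s z x y by unfold Filled; tauto), sub_self]
      refine Finset.sum_eq_zero fun b _ => if_neg ?_
      unfold At
      lia
    · rw [if_neg hxy, sub_zero]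
      by_cases hf : ∃ b ∈ s, At z x y b
      · rw [if_pos (show Filled s z x y from Or.inr (Or.inr hf))]
        obtain ⟨b, hb, hab⟩ := hf
        rw [Finset.sum_eq_single_of_mem b hb, if_pos hab]
        exact fun c _ hcb => if_neg fun hc => hcb (hc.eq hab)
      · rw [if_neg (show ¬Filled s z x y by rw [Filled, ← or_assoc, not_or]; exact ⟨hxy, hf⟩)]
        exact Finset.sum_eq_zero fun b hb => if_neg fun hab => hf ⟨b, hb, hab⟩
  simp only [cornerOrder, Finset.sum_sub_distrib, Finset.sum_add_distrib, h]
  have key : (if x = -1 ∧ y = -1 then (1 : ℤ) else 0) - (if x = 0 ∧ y = 0 then 1 else 0) =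
      (if x < 0 ∨ y + 1 < 0 then 1 else 0) + (if x + 1 < 0 ∨ y < 0 then 1 else 0)
      + (if x - 1 < 0 ∨ y - 1 < 0 then 1 else 0) - (if x < 0 ∨ y - 1 < 0 then 1 else 0)
      - (if x - 1 < 0 ∨ y < 0 then 1 else 0) - (if x + 1 < 0 ∨ y + 1 < 0 then 1 else 0) := by
    lia
  lia

/-- The position `(x, y)` in the plane `z` is a concave or a convex corner of `s`. -/
def CornerAt (s : Finset PlaneBox) (z : Fin 2) (x y : ℤ) : Prop :=
  (Filled s z x y ∧ ¬Filled s z (x + 1) y ∧ ¬Filled s z x (y + 1)) ∨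
    (¬Filled s z x y ∧ Filled s z (x - 1) y ∧ Filled s z x (y - 1))

-- The filled set is closed under steps to the left and down, so only the occupation of seven
-- neighbouring cells matters, subject to eight implications. The claim is then a finite check.
open Classical in
lemma cornerOrder_filled {s : Finset PlaneBox} (hs : s ∈ partitionPairs) (z : Fin 2) (x y : ℤ) :
    (CornerAt s z x y → cornerOrder (fun x y => if Filled s z x y then 1 else 0) x y = -1) ∧
    (¬CornerAt s z x y → 0 ≤ cornerOrder (fun x y => if Filled s z x y then 1 else 0) x y) := by
  have l : ∀ {x y}, Filled s z x y → Filled s z (x - 1) y := fun h =>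
    Filled.left hs (by rwa [sub_add_cancel])
  have dn : ∀ {x y}, Filled s z x y → Filled s z x (y - 1) := fun h =>
    Filled.down hs (by rwa [sub_add_cancel])
  have h1 : Filled s z (x + 1) y → Filled s z x y := Filled.left hs
  have h2 : Filled s z x (y + 1) → Filled s z x y := Filled.down hs
  have h3 : Filled s z (x + 1) (y + 1) → Filled s z x (y + 1) := Filled.left hs
  have h4 : Filled s z (x + 1) (y + 1) → Filled s z (x + 1) y := Filled.down hs
  have h5 : Filled s z x y → Filled s z (x - 1) y := l
  have h6 : Filled s z x y → Filled s z x (y - 1) := dn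
  have h7 : Filled s z (x - 1) y → Filled s z (x - 1) (y - 1) := dn
  have h8 : Filled s z x (y - 1) → Filled s z (x - 1) (y - 1) := l
  simp only [CornerAt, cornerOrder]
  clear l dn hs
  generalize Filled s z (x + 1) y = A1 at *
  generalize Filled s z x y = A2 at *
  generalize Filled s z x (y + 1) = A3 at *
  generalize Filled s z (x + 1) (y + 1) = A4 at *
  generalize Filled s z (x - 1) y = A5 at *
  generalize Filled s z x (y - 1) = A6 at *
  generalize Filled s z (x - 1) (y - 1) = A7 at *
  by_cases A1 <;> by_cases A2 <;> by_cases A3 <;> by_cases A4 <;> by_cases A5 <;> by_cases A6 <;>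
    by_cases A7 <;> simp_all

lemma IsCorner.cornerAt {s : Finset PlaneBox} {b : PlaneBox}
    (h : IsCorner partitionPairs s b) : CornerAt s b.z b.x b.y := by
  have hb : At b.z b.x b.y b := ⟨rfl, rfl, rfl⟩
  rcases h with ⟨h1, h2⟩ | ⟨h1, h2⟩
  · rw [mem_partitionPairs] at h2
    have hp : ∀ a, Pred a b → a ∈ s := fun a ha =>
      (Finset.mem_insert.1 (h2 b (Finset.mem_insert_self _ _) a ha)).resolve_left ha.lt.ne
    refine Or.inr ⟨?_, ?_, ?_⟩
    · rintro (h | h | ⟨c, hc, h⟩)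
      · lia
      · lia
      · exact h1 (h.eq hb ▸ hc)
    · by_cases hx : (b.x : ℤ) - 1 < 0
      · exact Or.inl hx
      · have ha := at_of b.z (y := b.y) (not_lt.1 hx) (by lia)
        refine Or.inr (Or.inr ⟨_, hp _ ?_, ha⟩)
        unfold At at ha
        unfold Pred
        lia
    · by_cases hy : (b.y : ℤ) - 1 < 0
      · exact Or.inr (Or.inl hy)
      · have ha := at_of b.z (x := b.x) (by lia) (not_lt.1 hy)
        refine Or.inr (Or.inr ⟨_, hp _ ?_, ha⟩)
        unfold At at ha
        unfold Pred
        lia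
  · rw [mem_partitionPairs] at h2
    have hp : ∀ a ∈ s, ¬Pred b a := fun a ha hba =>
      Finset.notMem_erase _ _ (h2 a (Finset.mem_erase.2 ⟨hba.lt.ne', ha⟩) b hba)
    refine Or.inl ⟨Or.inr (Or.inr ⟨b, h1, hb⟩), ?_, ?_⟩
    · rintro (h | h | ⟨c, hc, h⟩)
      · lia
      · lia
      · refine hp c hc ?_
        unfold At at h
        unfold Pred
        lia
    · rintro (h | h | ⟨c, hc, h⟩)
      · lia
      · lia
      · refine hp c hc ?_
        unfold At at h
        unfold Pred
        lia

lemma CornerAt.exists_box {s : Finset PlaneBox} (hs : s ∈ partitionPairs) {z : Fin 2} {x y : ℤ}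
    (h : CornerAt s z x y) : ∃ b, At z x y b ∧ IsCorner partitionPairs s b := by
  have hs' := (mem_partitionPairs s).1 hs
  rcases h with ⟨h1, h2, h3⟩ | ⟨h1, h2, h3⟩
  · obtain ⟨b, hb, hat⟩ : ∃ b ∈ s, At z x y b := by
      unfold Filled at h1 h2 h3
      tauto
    refine ⟨b, hat, Or.inr ⟨hb, (mem_partitionPairs _).2 fun c hc a hac => ?_⟩⟩
    have hc' := Finset.mem_erase.1 hc
    refine Finset.mem_erase.2 ⟨?_, hs' c hc'.2 a hac⟩
    rintro rfl
    unfold At at hat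
    rcases hac with ⟨hz, hxy | hxy⟩
    · exact h2 (Or.inr (Or.inr ⟨c, hc'.2, by unfold At; lia⟩))
    · exact h3 (Or.inr (Or.inr ⟨c, hc'.2, by unfold At; lia⟩))
  · have hx : 0 ≤ x := by
      by_contra hx
      exact h1 (Or.inl (not_le.1 hx))
    have hy : 0 ≤ y := by
      by_contra hy
      exact h1 (Or.inr (Or.inl (not_le.1 hy)))
    have hat := at_of z hx hy
    refine ⟨_, hat, Or.inl ⟨fun hm => h1 (Or.inr (Or.inr ⟨_, hm, hat⟩)),
      (mem_partitionPairs _).2 fun c hc a hac => ?_⟩⟩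
    refine Finset.mem_insert_of_mem ?_
    rcases Finset.mem_insert.1 hc with rfl | hc
    · rcases hac with ⟨hz, hxy | hxy⟩
      · rcases h2 with h | h | ⟨e, he, h⟩
        · unfold At at hat; lia
        · lia
        · have : At z (x - 1) y a := by unfold At at hat ⊢; lia
          exact this.eq h ▸ he
      · rcases h3 with h | h | ⟨e, he, h⟩
        · lia
        · unfold At at hat; lia
        · have : At z x (y - 1) a := by unfold At at hat ⊢; lia
          exact this.eq h ▸ he
    · exact hs' c hc a hac

/-- An addable box is the origin of its plane or lies directly to the right of or above a box of s.
-/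
lemma finite_concave_corners (s : Finset PlaneBox) :
    {b | b ∉ s ∧ insert b s ∈ partitionPairs}.Finite := by
  have h : {b | b ∉ s ∧ insert b s ∈ partitionPairs} ⊆
      ↑(s.image (fun b => of b.z (b.x + 1) b.y) ∪ s.image (fun b => of b.z b.x (b.y + 1)) ∪
        Finset.univ.image fun z => of z 0 0) := by
    intro b hb
    have hp : ∀ a, Pred a b → a ∈ s := fun a ha => (Finset.mem_insert.1 ((mem_partitionPairs _).1
      hb.2 b (Finset.mem_insert_self _ _) a ha)).resolve_left ha.lt.ne
    simp only [Finset.coe_union, Finset.coe_image, Set.mem_union, Set.mem_image]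
    by_cases hx : b.x = 0
    · by_cases hy : b.y = 0
      · exact Or.inr ⟨b.z, by simp, ext_iff'.2 ⟨rfl, hx.symm, hy.symm⟩⟩
      · refine Or.inl (Or.inr ⟨of b.z b.x (b.y - 1), hp _ ⟨rfl, Or.inr ⟨rfl, ?_⟩⟩,
          ext_iff'.2 ⟨rfl, rfl, ?_⟩⟩) <;> simp only [y_of] <;> lia
    · refine Or.inl (Or.inl ⟨of b.z (b.x - 1) b.y, hp _ ⟨rfl, Or.inl ⟨?_, rfl⟩⟩,
        ext_iff'.2 ⟨rfl, ?_, rfl⟩⟩) <;> simp only [x_of] <;> lia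
  exact (Finset.finite_toSet _).subset h

end Planes

/-! ### The evaluation Verma module -/

section Lattice

variable (lq ld μ : ℂ)

/-- The position with integer coordinates `(x, y)` in the plane `z`, the second coordinate being
shifted by `μ` in the plane `z = 0`. -/
def latticePos (z : Fin 2) (x y : ℤ) : ℂ :=
  Complex.exp (-(x * (-lq + ld) + (y + if z = 0 then μ else 0) * (2 * lq) + z.val * (-lq - ld)))

/-- The color of the position `(x, y)` in the plane `z`. -/
def latticeCol (z : Fin 2) (x : ℤ) : ZMod 2 := x + z.val

lemma latticePos_ne_zero (z : Fin 2) (x y : ℤ) : latticePos lq ld μ z x y ≠ 0 :=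
  Complex.exp_ne_zero _

lemma q₁_exp : q₁ (Complex.exp lq) (Complex.exp ld) = Complex.exp (-lq + ld) := by
  rw [q₁, Complex.exp_add, Complex.exp_neg]

lemma q₂_exp : q₂ (Complex.exp lq) = Complex.exp (2 * lq) := by
  rw [q₂, ← Complex.exp_nat_mul]
  rfl

lemma q₃_exp : q₃ (Complex.exp lq) (Complex.exp ld) = Complex.exp (-lq - ld) := by
  rw [q₃, sub_eq_add_neg, Complex.exp_add, Complex.exp_neg, Complex.exp_neg]

lemma q₁_mul_latticePos (z : Fin 2) (x y : ℤ) :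
    q₁ (Complex.exp lq) (Complex.exp ld) * latticePos lq ld μ z x y =
      latticePos lq ld μ z (x - 1) y := by
  rw [q₁_exp, latticePos, latticePos, ← Complex.exp_add]
  congr 1
  push_cast
  ring

lemma q₂_mul_latticePos (z : Fin 2) (x y : ℤ) :
    q₂ (Complex.exp lq) * latticePos lq ld μ z x y = latticePos lq ld μ z x (y - 1) := by
  rw [q₂_exp, latticePos, latticePos, ← Complex.exp_add]
  congr 1
  push_cast
  ring

lemma q₃_mul_latticePos (z : Fin 2) (x y : ℤ) :
    q₃ (Complex.exp lq) (Complex.exp ld) * latticePos lq ld μ z x y =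
      latticePos lq ld μ z (x + 1) (y + 1) := by
  rw [q₃_exp, latticePos, latticePos, ← Complex.exp_add]
  congr 1
  push_cast
  ring

lemma latticeCol_add_one_ne (z : Fin 2) (x : ℤ) : latticeCol z (x + 1) ≠ latticeCol z x := by
  unfold latticeCol
  push_cast
  generalize (x : ZMod 2) = a
  generalize (z.val : ZMod 2) = b
  revert a b
  decide

lemma latticeCol_add_one_eq_iff (z z' : Fin 2) (x x' : ℤ) :
    latticeCol z (x + 1) = latticeCol z' x' ↔ latticeCol z x ≠ latticeCol z' x' := by
  unfold latticeCol
  push_cast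
  generalize (x : ZMod 2) = a
  generalize (z.val : ZMod 2) = b
  generalize (x' : ZMod 2) = a'
  generalize (z'.val : ZMod 2) = b'
  revert a b a' b'
  decide

lemma latticeCol_sub_one_eq_iff (z z' : Fin 2) (x x' : ℤ) :
    latticeCol z (x - 1) = latticeCol z' x' ↔ latticeCol z x ≠ latticeCol z' x' := by
  have h := latticeCol_add_one_eq_iff z z' (x - 1) x'
  rw [sub_add_cancel] at h
  tauto

variable {lq ld μ}

/-- Since q₃⁻¹ = q₁q₂, equal positions in the two planes would express the μ-th power of q₂ as a
monomial in q₁ and q₂. Equal colors make the exponent x' - x - 1 of q₁ even, which is the case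
excluded by the condition on μ. -/
lemma latticePos_zero_ne_one (hμ : ∀ a b : ℤ, Complex.exp (μ * (2 * lq)) ≠
      q₁ (Complex.exp lq) (Complex.exp ld) ^ (2 * a) * q₂ (Complex.exp lq) ^ b) {x x' : ℤ}
    (hc : latticeCol 0 x = latticeCol 1 x') (y y' : ℤ) :
    latticePos lq ld μ 0 x y ≠ latticePos lq ld μ 1 x' y' := by
  intro h
  obtain ⟨a, ha⟩ : (2 : ℤ) ∣ x' - x - 1 := by
    refine (ZMod.intCast_zmod_eq_zero_iff_dvd _ 2).1 ?_
    unfold latticeCol at hc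
    push_cast
    simp only [Fin.val_zero, Fin.val_one, Nat.cast_zero, Nat.cast_one, add_zero] at hc
    rw [hc]
    generalize (x' : ZMod 2) = a
    revert a
    decide
  refine hμ a (y' - y - 1) ?_
  rw [← ha, q₁_exp, q₂_exp, ← Complex.exp_int_mul, ← Complex.exp_int_mul, ← Complex.exp_add]
  unfold latticePos at h
  rw [if_pos rfl, if_neg one_ne_zero] at h
  have e : ∀ A B C D : ℂ, Complex.exp A = Complex.exp B → C - A = D - B →
      Complex.exp C = Complex.exp D := by
    intro A B C D h1 h2
    rw [← sub_add_cancel C A, ← sub_add_cancel D B, Complex.exp_add, Complex.exp_add, h1, h2]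
  refine e _ _ _ _ h.symm ?_
  simp only [Fin.val_zero, Fin.val_one, Nat.cast_zero, Nat.cast_one]
  push_cast
  ring

lemma latticePos_eq_iff (hgen : IsGeneric lq ld) (hμ : ∀ a b : ℤ, Complex.exp (μ * (2 * lq)) ≠
      q₁ (Complex.exp lq) (Complex.exp ld) ^ (2 * a) * q₂ (Complex.exp lq) ^ b) {z z' : Fin 2}
    {x x' : ℤ} (hc : latticeCol z x = latticeCol z' x') (y y' : ℤ) :
    latticePos lq ld μ z x y = latticePos lq ld μ z' x' y' ↔ z = z' ∧ x = x' ∧ y = y' := by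
  refine ⟨fun h => ?_, by rintro ⟨rfl, rfl, rfl⟩; rfl⟩
  by_cases hz : z = z'
  · subst hz
    refine ⟨rfl, ?_⟩
    have h0 : latticePos lq ld μ z x y / latticePos lq ld μ z x' y' = 1 := by
      rw [h, div_self (latticePos_ne_zero lq ld μ z x' y')]
    rw [latticePos, latticePos, ← Complex.exp_sub] at h0
    -- The two numbers are the exponents of q and d in the ratio of the positions.
    have h1 := hgen ((x - x' + 2 * (y' - y) : ℤ) : ℚ) ((x' - x : ℤ) : ℚ) (by
      refine (congrArg Complex.exp ?_).trans h0
      push_cast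
      ring)
    rw [Int.cast_eq_zero, Int.cast_eq_zero] at h1
    lia
  · exfalso
    have h01 : ∀ z z' : Fin 2, z ≠ z' → (z = 0 ∧ z' = 1) ∨ (z = 1 ∧ z' = 0) := by decide
    rcases h01 z z' hz with ⟨rfl, rfl⟩ | ⟨rfl, rfl⟩
    · exact latticePos_zero_ne_one hμ hc y y' h
    · exact latticePos_zero_ne_one hμ hc.symm y' y h.symm

variable (lq ld μ)

lemma position_eq (b : PlaneBox) :
    (vermaData lq ld μ).position lq ld b = latticePos lq ld μ b.z b.x b.y := by
  rw [latticePos, Int.cast_natCast, Int.cast_natCast]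
  rfl

lemma color_eq (b : PlaneBox) : (vermaData lq ld μ).color b = latticeCol b.z b.x := by
  rw [latticeCol, Int.cast_natCast]
  rfl

end Lattice

open PlaneBox

/-! ### Neighbouring boxes and zeros of g on the lattice -/

section Frame

variable {lq ld μ : ℂ}

lemma gVal_lattice (i : Fin 2 × ℤ × ℤ) (j : Fin 2 × ℤ × ℤ) :
    gVal (Complex.exp lq) (Complex.exp ld) (latticeCol i.1 i.2.1) (latticeCol j.1 j.2.1)
      (latticePos lq ld μ i.1 i.2.1 i.2.2) (latticePos lq ld μ j.1 j.2.1 j.2.2) =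
    if latticeCol i.1 i.2.1 = latticeCol j.1 j.2.1 then
      latticePos lq ld μ i.1 i.2.1 i.2.2 - latticePos lq ld μ j.1 j.2.1 (j.2.2 - 1)
    else (latticePos lq ld μ i.1 i.2.1 i.2.2 - latticePos lq ld μ j.1 (j.2.1 - 1) j.2.2) *
      (latticePos lq ld μ i.1 i.2.1 i.2.2 - latticePos lq ld μ j.1 (j.2.1 + 1) (j.2.2 + 1)) := by
  rw [gVal, q₁_mul_latticePos, q₂_mul_latticePos, q₃_mul_latticePos]

/-- The frame formed by the boxes in two planes. -/
def vermaFrame (hgen : IsGeneric lq ld) (hμ : ∀ a b : ℤ, Complex.exp (μ * (2 * lq)) ≠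
      q₁ (Complex.exp lq) (Complex.exp ld) ^ (2 * a) * q₂ (Complex.exp lq) ^ b) :
    Frame partitionPairs (Complex.exp lq) (Complex.exp ld) where
  col := (vermaData lq ld μ).color
  pos := (vermaData lq ld μ).position lq ld
  pred := Pred
  diag := Diag
  mem_iff := mem_partitionPairs
  pos_ne_zero b := Complex.exp_ne_zero _
  pred_lt := Pred.lt
  gVal_of_pred {a b} h := by
    rw [color_eq, color_eq, position_eq, position_eq,
      gVal_lattice (a.z, (a.x : ℤ), (a.y : ℤ)) (b.z, (b.x : ℤ), (b.y : ℤ))]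
    obtain ⟨hz, ⟨hx, hy⟩ | ⟨hx, hy⟩⟩ := h
    · have h1 : (b.x : ℤ) = a.x + 1 := by lia
      simp only [hz, h1, hy, if_neg (latticeCol_add_one_ne _ _).symm, add_sub_cancel_right,
        sub_self, zero_mul]
    · have h1 : (b.y : ℤ) = a.y + 1 := by lia
      simp only [hz, h1, hx, if_true, add_sub_cancel_right, sub_self]
  of_gVal {a b} hab h := by
    rw [color_eq, color_eq, position_eq, position_eq,
      gVal_lattice (a.z, (a.x : ℤ), (a.y : ℤ)) (b.z, (b.x : ℤ), (b.y : ℤ))] at h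
    dsimp only at h
    -- For equal colors the root q₂ is a vertical step. For different colors q₁ is a horizontal step
    -- and q₃ = (q₁q₂)⁻¹ is a diagonal step in the opposite direction, hence the reversed diagonal
    -- pair.
    split_ifs at h with hc
    · have := (latticePos_eq_iff hgen hμ hc _ _).1 (sub_eq_zero.1 h)
      left
      unfold Pred
      lia
    · rcases mul_eq_zero.1 h with h | h
      · have := (latticePos_eq_iff hgen hμ
          ((latticeCol_sub_one_eq_iff _ _ _ _).2 (Ne.symm hc)).symm _ _).1 (sub_eq_zero.1 h)
        left
        unfold Pred
        lia
      · have := (latticePos_eq_iff hgen hμ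
          ((latticeCol_add_one_eq_iff _ _ _ _).2 (Ne.symm hc)).symm _ _).1 (sub_eq_zero.1 h)
        right
        unfold Diag
        lia
  diag_col {a b} h := by
    obtain ⟨hz, hx, -⟩ := h
    have h1 : (b.x : ℤ) = a.x + 1 := by lia
    rw [color_eq, color_eq, hz, h1]
    exact (latticeCol_add_one_ne _ _).symm
  diag_between {a b} h := by
    obtain ⟨hz, hx, hy⟩ := h
    refine ⟨of a.z (a.x + 1) a.y, of a.z a.x (a.y + 1), ?_, ⟨rfl, Or.inl ⟨rfl, rfl⟩⟩,
      ⟨hz, Or.inr ⟨hx, hy⟩⟩, ?_, ⟨rfl, Or.inr ⟨rfl, rfl⟩⟩, ⟨hz, Or.inl ⟨hx, hy⟩⟩⟩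
    · rw [color_eq, color_eq, hz, hx]
      rfl
    · rw [color_eq, color_eq]
      rfl

variable (hgen : IsGeneric lq ld) (hμ : ∀ a b : ℤ, Complex.exp (μ * (2 * lq)) ≠
      q₁ (Complex.exp lq) (Complex.exp ld) ^ (2 * a) * q₂ (Complex.exp lq) ^ b)

include hgen hμ

/-- The order of the weight of a box at a position of the lattice. -/
lemma ordAt_boxWeight_lattice (b : PlaneBox) (z : Fin 2) (x y : ℤ) :
    ordAt (latticePos lq ld μ z x y) ((vermaFrame hgen hμ).boxWeight b (latticeCol z x)) =
      cornerOrder (fun x y => if At z x y b then 1 else 0) x y := by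
  change ordAt _ (rootA _ _ ((vermaData lq ld μ).color b) ((vermaData lq ld μ).position lq ld b)
    (latticeCol z x))⁻¹ = _
  rw [color_eq, position_eq, ordAt_rootA_inv (Complex.exp_ne_zero _) (Complex.exp_ne_zero _),
    q₁_mul_latticePos, q₂_mul_latticePos, q₃_mul_latticePos, q₁_mul_latticePos, q₂_mul_latticePos,
    q₃_mul_latticePos]
  unfold cornerOrder At
  by_cases hc : latticeCol b.z b.x = latticeCol z x
  · rw [if_pos hc]
    -- Within a plane the color is the parity of x, so the terms of `cornerOrder` that are absent
    -- from this case of the box weight vanish automatically.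
    have hx : b.z = z → (b.x : ℤ) ≠ x + 1 ∧ (b.x : ℤ) ≠ x - 1 := by
      rintro rfl
      constructor
      · intro h
        rw [h] at hc
        exact latticeCol_add_one_ne _ _ hc
      · intro h
        rw [h] at hc
        exact (latticeCol_sub_one_eq_iff _ _ _ _).1 hc rfl
    simp only [latticePos_eq_iff hgen hμ hc.symm]
    by_cases hz : b.z = z
    · obtain ⟨h1, h2⟩ := hx hz
      simp only [hz, true_and, h1, h2, false_and, if_false]
      split_ifs <;> lia
    · simp [hz, Ne.symm hz]
  · rw [if_neg hc]
    have h1 := (latticeCol_add_one_eq_iff _ _ _ _).2 hc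
    have h2 := (latticeCol_sub_one_eq_iff _ _ _ _).2 hc
    have h3 := (latticeCol_add_one_eq_iff _ _ _ _).2 (Ne.symm hc)
    have h4 := (latticeCol_sub_one_eq_iff _ _ _ _).2 (Ne.symm hc)
    have hx : b.z = z → (b.x : ℤ) ≠ x := by
      rintro rfl h
      rw [h] at hc
      exact hc rfl
    simp only [latticePos_eq_iff hgen hμ h1.symm, latticePos_eq_iff hgen hμ h2.symm,
      latticePos_eq_iff hgen hμ h3, latticePos_eq_iff hgen hμ h4]
    by_cases hz : b.z = z
    · simp only [hz, true_and, hx hz, false_and, if_false]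
      split_ifs <;> lia
    · simp [hz, Ne.symm hz]

/-- The weight of a box has zeros and poles only on the lattice. -/
lemma ordAt_boxWeight_eq_zero (b : PlaneBox) {p : ℂ} {j : ZMod 2}
    (h : ∀ z x y, latticeCol z x = j → latticePos lq ld μ z x y ≠ p) :
    ordAt p ((vermaFrame hgen hμ).boxWeight b j) = 0 := by
  change ordAt _ (rootA _ _ ((vermaData lq ld μ).color b) ((vermaData lq ld μ).position lq ld b)
    j)⁻¹ = _
  have hm : ∀ {u a r : ℂ}, u ≠ 0 → u * a = r → (u * p = r ↔ a = p) := by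
    rintro u a r hu rfl
    rw [mul_right_inj' hu, eq_comm]
  have h1 := q₁_ne_zero (Complex.exp_ne_zero lq) (Complex.exp_ne_zero ld)
  have h2 := q₂_ne_zero (Complex.exp_ne_zero lq)
  have h3 := q₃_ne_zero (Complex.exp_ne_zero lq) (Complex.exp_ne_zero ld)
  rw [color_eq, position_eq, ordAt_rootA_inv (Complex.exp_ne_zero _) (Complex.exp_ne_zero _),
    q₁_mul_latticePos, q₂_mul_latticePos, q₃_mul_latticePos]
  simp only [
    hm h1 ((q₁_mul_latticePos lq ld μ b.z (b.x + 1) b.y).trans (by rw [add_sub_cancel_right])),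
    hm h2 ((q₂_mul_latticePos lq ld μ b.z b.x (b.y + 1)).trans (by rw [add_sub_cancel_right])),
    hm h3 ((q₃_mul_latticePos lq ld μ b.z (b.x - 1) (b.y - 1)).trans (by
      rw [sub_add_cancel, sub_add_cancel]))]
  by_cases hc : latticeCol b.z b.x = j
  · rw [if_pos hc, if_neg fun e => h _ _ _ hc e.symm, if_neg (h _ _ _ hc), sub_self]
  · have hne : ∀ i j : ZMod 2, i ≠ j → i = j + 1 := by decide
    have h4 : latticeCol b.z (b.x + 1) = j := by
      rw [hne j _ (Ne.symm hc), latticeCol, latticeCol]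
      push_cast
      ring
    have h5 : latticeCol b.z (b.x - 1) = j := by
      rw [← h4]
      unfold latticeCol
      push_cast
      generalize (b.x : ZMod 2) = a
      generalize (b.z.val : ZMod 2) = c
      revert a c
      decide
    rw [if_neg hc, if_neg fun e => h _ _ _ h5 e.symm, if_neg fun e => h _ _ _ h4 e.symm,
      if_neg (h _ _ _ h4), if_neg (h _ _ _ h5), sub_self]

end Frame

open PlaneBox

/-! ### Orders and leading coefficients of a fraction with one zero and one pole -/

section Fraction

variable {c : ℂ} (hc : c ≠ 0) (a b : ℂ)

lemma fraction_eq (c a b : ℂ) :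
    (RatFunc.C c * (RatFunc.X - RatFunc.C a) / (RatFunc.X - RatFunc.C b) : RatFunc ℂ) =
    (RatFunc.C c * RatFunc.X - RatFunc.C (c * a)) / (RatFunc.C 1 * RatFunc.X - RatFunc.C b) := by
  rw [map_mul, ← mul_sub, map_one, one_mul]

include hc

lemma fraction_ne_zero :
    (RatFunc.C c * (RatFunc.X - RatFunc.C a) / (RatFunc.X - RatFunc.C b) : RatFunc ℂ) ≠ 0 :=
  div_ne_zero (mul_ne_zero ((map_ne_zero _).2 hc) (X_sub_C_ne_zero a)) (X_sub_C_ne_zero b)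

lemma order_leading_fraction (p : ℂ) :
    ordAt p (RatFunc.C c * (RatFunc.X - RatFunc.C a) / (RatFunc.X - RatFunc.C b)) =
      (if p = a then 1 else 0) - (if p = b then 1 else 0) ∧
    (p ≠ a → p ≠ b →
      leadAt p (RatFunc.C c * (RatFunc.X - RatFunc.C a) / (RatFunc.X - RatFunc.C b)) =
        c * (p - a) / (p - b)) := by
  obtain ⟨h1, h2⟩ := order_leading_linear p hc (c * a)
  obtain ⟨h3, h4⟩ := order_leading_linear p one_ne_zero b
  simp only [mul_right_inj' hc] at h1 h2
  simp only [one_mul] at h3 h4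
  refine ⟨?_, fun ha hb => ?_⟩
  · unfold ordAt at h1 h3 ⊢
    rw [fraction_eq c a b, order_hom_div _ (linear_ne_zero hc _) (linear_ne_zero one_ne_zero _), h1,
      h3]
  · rw [fraction_eq c a b, map_div₀, h2, h4, if_neg ha, if_neg hb, mul_sub]

lemma order_leading_fraction_infty :
    (expandInfty (RatFunc.C c * (RatFunc.X - RatFunc.C a) / (RatFunc.X - RatFunc.C b))).order = 0 ∧
    lead expandInfty (RatFunc.C c * (RatFunc.X - RatFunc.C a) / (RatFunc.X - RatFunc.C b)) = c := by
  obtain ⟨h1, h2⟩ := order_leading_linear_infty hc (c * a)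
  obtain ⟨h3, h4⟩ := order_leading_linear_infty one_ne_zero b
  rw [fraction_eq c a b, order_hom_div _ (linear_ne_zero hc _) (linear_ne_zero one_ne_zero _), h1,
    h3, map_div₀ (lead expandInfty), h2, h4, div_one]
  exact ⟨sub_self _, rfl⟩

end Fraction

/-! ### The highest weight in lattice coordinates -/

section Weight

variable (lq ld μ : ℂ)

/-- The leading coefficient of the highest weight at infinity. -/
def vermaConst (j : ZMod 2) : ℂ :=
  if j = 0 then q₃ (Complex.exp lq) (Complex.exp ld) * Complex.exp (-μ * lq)
  else Complex.exp (μ * lq)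

/-- The plane in which the corner box has color `j`. -/
def polePlane (j : ZMod 2) : Fin 2 := if j = 0 then 0 else 1

lemma vermaConst_ne_zero (j : ZMod 2) : vermaConst lq ld μ j ≠ 0 := by
  unfold vermaConst
  split_ifs
  · exact mul_ne_zero (q₃_ne_zero (Complex.exp_ne_zero _) (Complex.exp_ne_zero _))
      (Complex.exp_ne_zero _)
  · exact Complex.exp_ne_zero _

/-- Component j has its pole at the origin of the plane whose corner box has color j. Its zero lies
at (-1, -1) of the other plane, where the color is again j because the first coordinate is odd. -/
lemma vermaWeight_eq (j : ZMod 2) : vermaWeight lq ld μ j = RatFunc.C (vermaConst lq ld μ j) *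
      (RatFunc.X - RatFunc.C (latticePos lq ld μ (1 - polePlane j) (-1) (-1))) /
      (RatFunc.X - RatFunc.C (latticePos lq ld μ (polePlane j) 0 0)) := by
  unfold vermaWeight vermaConst polePlane
  dsimp only
  have h : (1 : Fin 2) - 1 = 0 := rfl
  split_ifs
  · have e1 : latticePos lq ld μ (1 - 0) (-1) (-1) =
        (q₃ (Complex.exp lq) (Complex.exp ld))⁻¹ ^ 2 := by
      rw [q₃_exp, latticePos, ← Complex.exp_neg, ← Complex.exp_nat_mul]
      congr 1
      simp
      ring
    have e2 : latticePos lq ld μ 0 0 0 = Complex.exp (-μ * (2 * lq)) := by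
      rw [latticePos]
      congr 1
      simp
    rw [e1, e2]
  · have e1 : latticePos lq ld μ (1 - 1) (-1) (-1) =
        (q₃ (Complex.exp lq) (Complex.exp ld))⁻¹ * Complex.exp (-μ * (2 * lq)) := by
      rw [h, q₃_exp, latticePos, ← Complex.exp_neg, ← Complex.exp_add]
      congr 1
      simp
      ring
    have e2 : latticePos lq ld μ 1 0 0 = (q₃ (Complex.exp lq) (Complex.exp ld))⁻¹ := by
      rw [q₃_exp, latticePos, ← Complex.exp_neg]
      congr 1
      simp
    rw [e1, e2]

lemma latticeCol_polePlane (z : Fin 2) (j : ZMod 2) : latticeCol z 0 = j ↔ z = polePlane j := by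
  unfold latticeCol polePlane
  rw [Int.cast_zero]
  revert z j
  decide

lemma latticeCol_one_sub_polePlane (z : Fin 2) (j : ZMod 2) :
    latticeCol z (-1) = j ↔ z = 1 - polePlane j := by
  unfold latticeCol polePlane
  rw [Int.cast_neg, Int.cast_one]
  revert z j
  decide

/-- The product of the values at infinity and at zero; the normalizing constants are chosen so that
the constant terms of the two Cartan series are inverse to each other. -/
lemma vermaWeight_lead_mul (j : ZMod 2) : vermaConst lq ld μ j * (vermaConst lq ld μ j *
      (0 - latticePos lq ld μ (1 - polePlane j) (-1) (-1)) /
      (0 - latticePos lq ld μ (polePlane j) 0 0)) = 1 := by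
  have h : (1 : Fin 2) - 1 = 0 := rfl
  rw [zero_sub, zero_sub, mul_neg, neg_div_neg_eq, ← mul_div_assoc,
    div_eq_one_iff_eq (latticePos_ne_zero _ _ _ _ _ _)]
  unfold vermaConst polePlane
  split_ifs
  · rw [q₃_exp, latticePos, latticePos]
    simp only [← Complex.exp_add]
    congr 1
    simp
    ring
  · rw [h, latticePos, latticePos]
    simp only [← Complex.exp_add]
    congr 1
    simp
    ring

end Weight

/-! ### Pole structure of the weights and the final geometry -/

section Verma

variable {lq ld μ : ℂ} (hgen : IsGeneric lq ld) (hμ : ∀ a b : ℤ, Complex.exp (μ * (2 * lq)) ≠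
      q₁ (Complex.exp lq) (Complex.exp ld) ^ (2 * a) * q₂ (Complex.exp lq) ^ b)

include hgen hμ

lemma ordAt_vermaWeight_lattice (z : Fin 2) (x y : ℤ) :
    ordAt (latticePos lq ld μ z x y) (vermaWeight lq ld μ (latticeCol z x)) =
      (if x = -1 ∧ y = -1 then 1 else 0) - (if x = 0 ∧ y = 0 then 1 else 0) := by
  set j := latticeCol z x with hj
  have h1 : latticePos lq ld μ z x y = latticePos lq ld μ (1 - polePlane j) (-1) (-1) ↔
      x = -1 ∧ y = -1 := by
    rw [latticePos_eq_iff hgen hμ (hj.symm.trans ((latticeCol_one_sub_polePlane _ j).2 rfl).symm)]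
    refine and_iff_right_of_imp ?_
    rintro ⟨rfl, -⟩
    exact (latticeCol_one_sub_polePlane z j).1 hj.symm
  have h2 : latticePos lq ld μ z x y = latticePos lq ld μ (polePlane j) 0 0 ↔ x = 0 ∧ y = 0 := by
    rw [latticePos_eq_iff hgen hμ (hj.symm.trans ((latticeCol_polePlane _ j).2 rfl).symm)]
    refine and_iff_right_of_imp ?_
    rintro ⟨rfl, -⟩
    exact (latticeCol_polePlane z j).1 hj.symm
  rw [vermaWeight_eq, (order_leading_fraction (vermaConst_ne_zero lq ld μ j) _ _ _).1]
  simp only [h1, h2]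

open Classical in
lemma ordAt_weight_lattice (s : Finset PlaneBox) (z : Fin 2) (x y : ℤ) :
    ordAt (latticePos lq ld μ z x y)
      ((vermaFrame hgen hμ).weight (vermaWeight lq ld μ) s (latticeCol z x)) =
        cornerOrder (fun x y => if Filled s z x y then 1 else 0) x y := by
  have hne : ∀ b ∈ s, (vermaFrame hgen hμ).boxWeight b (latticeCol z x) ≠ 0 := fun b _ =>
    Frame.boxWeight_ne_zero (Complex.exp_ne_zero _) (Complex.exp_ne_zero _) _ _
  have hΨ : vermaWeight lq ld μ (latticeCol z x) ≠ 0 := by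
    rw [vermaWeight_eq]
    exact fraction_ne_zero (vermaConst_ne_zero _ _ _ _) _ _
  have h := ordAt_vermaWeight_lattice hgen hμ z x y
  unfold ordAt at h
  rw [← cornerOrder_sum, ordAt, Frame.weight,
    order_hom_mul _ hΨ (Finset.prod_ne_zero_iff.2 hne), order_hom_prod _ _ _ hne, h]
  congr 1
  exact Finset.sum_congr rfl fun b _ => ordAt_boxWeight_lattice hgen hμ b z x y

/-- At the position diagonally above a box, no smaller box has a zero or a pole. -/
lemma exists_separating_position (b : PlaneBox) :
    ∃ i p, ordAt p ((vermaFrame hgen hμ).boxWeight b i) ≠ 0 ∧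
      ∀ b' < b, ordAt p ((vermaFrame hgen hμ).boxWeight b' i) = 0 := by
  refine ⟨latticeCol b.z (b.x + 1), latticePos lq ld μ b.z (b.x + 1) (b.y + 1), ?_,
    fun b' hb' => ?_⟩
  · rw [ordAt_boxWeight_lattice hgen hμ]
    simp [cornerOrder, At, add_assoc]
  · rw [ordAt_boxWeight_lattice hgen hμ]
    rw [lt_iff'] at hb'
    -- Among the six cells entering `cornerOrder` at this point, b is the smallest in the order by y
    -- and then x. The other plane does not contribute.
    have h : ∀ X Y : ℤ, (b.y : ℤ) < Y ∨ ((b.y : ℤ) = Y ∧ (b.x : ℤ) ≤ X) → ¬At b.z X Y b' := by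
      unfold At
      rintro X Y hXY ⟨hz, rfl, rfl⟩
      lia
    simp only [cornerOrder]
    rw [if_neg (h _ _ (by lia)), if_neg (h _ _ (by lia)), if_neg (h _ _ (by lia)),
      if_neg (h _ _ (by lia)), if_neg (h _ _ (by lia)), if_neg (h _ _ (by lia))]
    rfl

/-- The geometry of the evaluation Verma module. -/
def vermaGeometry : Geometry partitionPairs (Complex.exp lq) (Complex.exp ld) where
  toFrame := vermaFrame hgen hμ
  Ψ := vermaWeight lq ld μ
  hq := Complex.exp_ne_zero _
  hd := Complex.exp_ne_zero _
  q₂_ne_one h := by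
    rw [q₂_exp] at h
    have := (hgen 2 0 (by rw [← h]; congr 1; push_cast; ring)).1
    norm_num at this
  pos_inj {a b} hc hp := by
    change (vermaData lq ld μ).color a = (vermaData lq ld μ).color b at hc
    change (vermaData lq ld μ).position lq ld a = (vermaData lq ld μ).position lq ld b at hp
    rw [color_eq, color_eq] at hc
    rw [position_eq, position_eq, latticePos_eq_iff hgen hμ hc] at hp
    rw [ext_iff']
    lia
  finite_add s _ := finite_concave_corners s
  Ψ_ne_zero j := by
    rw [vermaWeight_eq]
    exact fraction_ne_zero (vermaConst_ne_zero _ _ _ _) _ _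
  order_infty j := by
    rw [vermaWeight_eq]
    exact (order_leading_fraction_infty (vermaConst_ne_zero _ _ _ _) _ _).1
  order_zero j := by
    rw [vermaWeight_eq, (order_leading_fraction (vermaConst_ne_zero _ _ _ _) _ _ _).1,
      if_neg (latticePos_ne_zero _ _ _ _ _ _).symm, if_neg (latticePos_ne_zero _ _ _ _ _ _).symm,
      sub_self]
  lead_mul j := by
    rw [vermaWeight_eq, (order_leading_fraction_infty (vermaConst_ne_zero _ _ _ _) _ _).2,
      (order_leading_fraction (vermaConst_ne_zero _ _ _ _) _ _ _).2
        (latticePos_ne_zero _ _ _ _ _ _).symm (latticePos_ne_zero _ _ _ _ _ _).symm,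
      vermaWeight_lead_mul]
  ord_corner s hs b hb := by
    change ordAt ((vermaData lq ld μ).position lq ld b)
      ((vermaFrame hgen hμ).weight _ s ((vermaData lq ld μ).color b)) = -1
    rw [position_eq, color_eq, ordAt_weight_lattice hgen hμ]
    exact (cornerOrder_filled hs _ _ _).1 hb.cornerAt
  ord_nonneg s hs i p h := by
    -- On the lattice the corner count applies; off the lattice neither the highest weight nor any
    -- box has a zero or a pole.
    by_cases hl : ∃ z x y, latticeCol z x = i ∧ latticePos lq ld μ z x y = p
    · obtain ⟨z, x, y, rfl, rfl⟩ := hl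
      rw [ordAt_weight_lattice hgen hμ]
      refine (cornerOrder_filled hs _ _ _).2 fun hc => ?_
      obtain ⟨b, ⟨rfl, rfl, rfl⟩, hb⟩ := hc.exists_box hs
      exact h b hb (color_eq lq ld μ b) (position_eq lq ld μ b)
    · push Not at hl
      have hne : ∀ b ∈ s, (vermaFrame hgen hμ).boxWeight b i ≠ 0 := fun b _ =>
        Frame.boxWeight_ne_zero (Complex.exp_ne_zero _) (Complex.exp_ne_zero _) _ _
      have hΨ : vermaWeight lq ld μ i ≠ 0 := by
        rw [vermaWeight_eq]
        exact fraction_ne_zero (vermaConst_ne_zero _ _ _ _) _ _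
      have h1 : ordAt p (vermaWeight lq ld μ i) = 0 := by
        rw [vermaWeight_eq, (order_leading_fraction (vermaConst_ne_zero _ _ _ _) _ _ _).1,
          if_neg (hl _ _ _ ((latticeCol_one_sub_polePlane _ i).2 rfl)).symm,
          if_neg (hl _ _ _ ((latticeCol_polePlane _ i).2 rfl)).symm, sub_self]
      unfold ordAt at h1 ⊢
      rw [Frame.weight, order_hom_mul _ hΨ (Finset.prod_ne_zero_iff.2 hne),
        order_hom_prod _ _ _ hne, h1, zero_add]
      exact (Finset.sum_eq_zero fun b _ => ordAt_boxWeight_eq_zero hgen hμ b hl).ge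
  exists_ord := exists_separating_position hgen hμ

lemma vermaGeometry_level : lead expandInfty ((vermaGeometry hgen hμ).Ψ 0) *
    lead expandInfty ((vermaGeometry hgen hμ).Ψ 1) = q₃ (Complex.exp lq) (Complex.exp ld) := by
  change lead expandInfty (vermaWeight lq ld μ 0) * lead expandInfty (vermaWeight lq ld μ 1) = _
  rw [vermaWeight_eq, vermaWeight_eq,
    (order_leading_fraction_infty (vermaConst_ne_zero _ _ _ _) _ _).2,
    (order_leading_fraction_infty (vermaConst_ne_zero _ _ _ _) _ _).2, vermaConst, vermaConst,
    if_pos rfl, if_neg one_ne_zero, mul_assoc, ← Complex.exp_add, neg_mul, neg_add_cancel,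
    Complex.exp_zero, mul_one]

end Verma

end ToroidalGL2

end

theorem mainTheorem5 (lq ld μ : ℂ) (hgen : ToroidalGL2.IsGeneric lq ld)
    (hμ : ∀ a b : ℤ, Complex.exp (μ * (2 * lq)) ≠
      ToroidalGL2.q₁ (Complex.exp lq) (Complex.exp ld) ^ (2 * a) *
        ToroidalGL2.q₂ (Complex.exp lq) ^ b) :
    ∃ (_ : Module (ToroidalGL2.QTA (Complex.exp lq) (Complex.exp ld))
          (ToroidalGL2.vermaData lq ld μ).Space)
      (_ : IsScalarTower ℂ (ToroidalGL2.QTA (Complex.exp lq) (Complex.exp ld))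
          (ToroidalGL2.vermaData lq ld μ).Space),
      (ToroidalGL2.vermaData lq ld μ).IsCombinatorialModule lq ld ∧
      IsSimpleModule (ToroidalGL2.QTA (Complex.exp lq) (Complex.exp ld))
        (ToroidalGL2.vermaData lq ld μ).Space ∧
      ToroidalGL2.IsTame (Complex.exp lq) (Complex.exp ld)
        (ToroidalGL2.vermaData lq ld μ).Space ∧
      ToroidalGL2.IsHighestLWeight (Complex.exp lq) (Complex.exp ld)
        (ToroidalGL2.vermaData lq ld μ).Space (ToroidalGL2.vermaWeight lq ld μ) ∧
      ToroidalGL2.HasLevel (Complex.exp lq) (Complex.exp ld)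
        (ToroidalGL2.vermaData lq ld μ).Space
        (ToroidalGL2.q₃ (Complex.exp lq) (Complex.exp ld)) := by
  -- The boxes, their order and the states of `vermaData` unfold to `PlaneBox` and `partitionPairs`,
  -- so the geometry has this type by definition, and colors, positions and highest weight agree by
  -- `rfl`.
  let g : ToroidalGL2.Geometry (ToroidalGL2.vermaData lq ld μ).states (Complex.exp lq)
    (Complex.exp ld) := ToroidalGL2.vermaGeometry hgen hμ
  refine ⟨g.module, g.isScalarTower, g.isCombinatorialModule rfl rfl rfl, g.isSimpleModule,
    g.isTame, g.isHighestLWeight, ?_⟩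
  have h := g.hasLevel
  rwa [show ToroidalGL2.lead _ (g.Ψ 0) * ToroidalGL2.lead _ (g.Ψ 1) = _ from
    ToroidalGL2.vermaGeometry_level hgen hμ] at h
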